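/- Let $a<b$ and let $g$ be a probability density on $\mathbb R$ which is zero outside $[a,b]$, bounded below by a positive constant on $[a,b]$, and differentiable with bounded derivative in $(a,b)$. Put $k(x\mid\theta)=g(x-\theta)$. Let $Q_0$ be a probability measure on $\mathbb R$ with a bounded Lebesgue density $q_0$. For a probability measure $\pi$ on $(0,\infty)$ consider the Dirichlet process mixture model $X_i\mid\theta_i\sim k(\cdot\mid\theta_i)$ independently, $\theta_i\mid\tilde P\sim\tilde P$ i.i.d., $\tilde P\mid\alpha\sim\mathrm{DP}(\alpha,Q_0)$, $\alpha\sim\pi$, and let $K_n$ be the number of clusters among the first $n$ observations. Explicitly, with $\tau_s(n)$ the set of partitions of $\{1,\dots,n\}$ into $s$ nonempty blocks and $\alpha^{(n)}=\alpha(\alpha+1)\cdots(\alpha+n-1)$, $$\mathrm{pr}(X_{1:n}=x_{1:n},K_n=s)=\sum_{A=\{A_1,\dots,A_s\}\in\tau_s(n)}\left(\int\frac{\alpha^s}{\alpha^{(n)}}\prod_{j=1}^s(|A_j|-1)!\;\pi(d\alpha)\right)\prod_{j=1}^s\int\prod_{i\in A_j}g(x_i-\theta)\,q_0(\theta)\,d\theta,$$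 and $\mathrm{pr}(K_n=s\mid X_{1:n})$ is this quantity at $x_{1:n}=X_{1:n}$ divided by its sum over $s$. Consider the following assumptions on $\pi$. * (A1) $\pi$ has a Lebesgue density, also denoted $\pi$. * (A2) There are $\epsilon,\delta>0$ and $\beta\in\mathbb R$ with $\frac1\delta\alpha^\beta\le\pi(\alpha)\le\delta\alpha^\beta$ for all $\alpha\in(0,\epsilon)$. * (A3, with parameter $\rho>0$) There are $D,\nu>0$ with $\int\alpha^s\,\pi(d\alpha)<D\rho^{-s}\Gamma(\nu+s+1)$ for every integer $s\ge1$. A true distribution is called admissible if it has the form $P=\sum_{j=1}^t p_jR_j$, where $t\ge1$, $p_j>0$, $\sum_jp_j=1$, $R_j$ has density $k(\cdot\mid\theta_j^*)$, the atoms are completely separated ($|\theta_j^*-\theta_k^*|>b-a$ for all $j\ne k$), and each $\theta_j^*$ lies in the interior of the support of $Q_0$ in the sense that $q_0$ is bounded below by a positive constant in a neighbourhood of $\theta_j^*$. **Theorem.** 1. There is $\rho_0>0$, depending only on $g$ and $q_0$, such that if $\pi$ satisfies A1, A2 and A3 with some $\rho\ge\rho_0$, then for every admissible $P$, with $X_1,X_2,\dots$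 i.i.d. from $P$, $$\mathrm{pr}(K_n=t\mid X_{1:n})\to1\quad\text{in probability as }n\to\infty.$$ 2. On the contrary, if $\pi=\delta_{\alpha^*}$ with $\alpha^*>0$, then for every admissible $P$ there is a constant $c<1$ such that, with $X_1,X_2,\dots$ i.i.d. from $P$, the probability that $\mathrm{pr}(K_n=t\mid X_{1:n})>c$ tends to $0$ as $n\to\infty$, and moreover $\limsup_{n\to\infty}\mathrm{pr}(K_n=t\mid X_{1:n})\le c$ almost surely. -/

import Mathlib

open MeasureTheory ProbabilityTheory Filter Topology

noncomputable section

namespace DPMixture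

/-- `f` is a probability density on the real line with respect to Lebesgue measure. -/
structure IsDensity (f : ℝ → ℝ) : Prop where
  measurable : Measurable f
  nonneg : ∀ x, 0 ≤ f x
  lintegral_eq_one : ∫⁻ x, ENNReal.ofReal (f x) = 1

/-! ### The Dirichlet process mixture model, in its partition form -/

/-- Probability `α ^ s / α ^ (n) * ∏ (a_j - 1)!` of a partition of `n` items, with `s` blocks of
sizes `a_1, …, a_s`, under the Dirichlet process with concentration parameter `α`.
Here `α ^ (n) = α (α + 1) ⋯ (α + n - 1)` is the ascending factorial. -/
def partitionProb {n : ℕ} (α : ℝ) (A : Finpartition (Finset.univ : Finset (Fin n))) : ℝ :=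
  α ^ A.parts.card / (ascPochhammer ℝ n).eval α *
    ∏ B ∈ A.parts, (Nat.factorial (B.card - 1) : ℝ)

/-- Probability of a partition when the concentration parameter has law `π`. -/
def priorPartitionProb {n : ℕ} (π : Measure ℝ)
    (A : Finpartition (Finset.univ : Finset (Fin n))) : ℝ :=
  ∫ α, partitionProb α A ∂π

/-- Marginal likelihood `∫ ∏_{i ∈ B} g (x_i - θ) q₀ (θ) dθ` of the observations in the block `B`,
for the location kernel `k (x | θ) = g (x - θ)`. -/
def marginalLik (g q₀ : ℝ → ℝ) {n : ℕ} (x : Fin n → ℝ) (B : Finset (Fin n)) : ℝ :=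
  ∫ θ, (∏ i ∈ B, g (x i - θ)) * q₀ θ

/-- Joint density `pr (X_{1:n} = x, K_n = s)` of the data and of the number of clusters. -/
def jointDensity (g q₀ : ℝ → ℝ) (π : Measure ℝ) {n : ℕ} (x : Fin n → ℝ) (s : ℕ) : ℝ :=
  ∑ A : Finpartition (Finset.univ : Finset (Fin n)) with A.parts.card = s,
    priorPartitionProb π A * ∏ B ∈ A.parts, marginalLik g q₀ x B

/-- Posterior probability `pr (K_n = s | X_{1:n} = x)`. -/
def posteriorClusters (g q₀ : ℝ → ℝ) (π : Measure ℝ) {n : ℕ} (x : Fin n → ℝ) (s : ℕ) : ℝ :=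
  jointDensity g q₀ π x s / ∑ r ∈ Finset.range (n + 1), jointDensity g q₀ π x r

/-! ### Assumptions on the prior of the concentration parameter -/

/-- `π` has Lebesgue density `f`. -/
structure HasLebesgueDensity (π : Measure ℝ) (f : ℝ → ℝ) : Prop where
  measurable : Measurable f
  nonneg : ∀ x, 0 ≤ f x
  eq_withDensity : π = volume.withDensity (fun x => ENNReal.ofReal (f x))

/-- Polynomial behaviour of a density `f` to the right of the origin. -/
def PolynomialNearZero (f : ℝ → ℝ) : Prop :=
  ∃ ε > (0 : ℝ), ∃ δ > (0 : ℝ), ∃ β : ℝ, ∀ α ∈ Set.Ioo 0 ε,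
    1 / δ * α ^ β ≤ f α ∧ f α ≤ δ * α ^ β

/-- Subfactorial moments of `π` with parameter `ρ`. -/
def SubfactorialMoments (π : Measure ℝ) (ρ : ℝ) : Prop :=
  ∃ D > (0 : ℝ), ∃ ν > (0 : ℝ), ∀ s : ℕ, 1 ≤ s →
    ∫⁻ α, ENNReal.ofReal (α ^ s) ∂π <
      ENNReal.ofReal (D * (ρ ^ s)⁻¹ * Real.Gamma (ν + s + 1))

/-! ### Assumptions on the kernel and on the base measure -/

/-- `g` is a density that vanishes off `[a, b]`, is bounded below by a positive constant on
`[a, b]`, and is differentiable with bounded derivative in `(a, b)`. -/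
structure BoundedSupportKernel (a b : ℝ) (g : ℝ → ℝ) : Prop where
  isDensity : IsDensity g
  pos_on : ∃ m > (0 : ℝ), ∀ x ∈ Set.Icc a b, m ≤ g x
  zero_off : ∀ x, x ∉ Set.Icc a b → g x = 0
  differentiableOn : DifferentiableOn ℝ g (Set.Ioo a b)
  deriv_bounded : ∃ R : ℝ, ∀ x ∈ Set.Ioo a b, |deriv g x| ≤ R

/-- `q₀` is a bounded density. -/
structure BoundedBaseDensity (q₀ : ℝ → ℝ) : Prop where
  isDensity : IsDensity q₀
  bounded : ∃ U : ℝ, ∀ x, q₀ x ≤ U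

/-! ### The data-generating mixture -/

/-- The mixture `∑ j, p_j R_j`, where `R_j` has density `g (· - θ_j)`. -/
def mixture (g : ℝ → ℝ) {t : ℕ} (p θ : Fin t → ℝ) : Measure ℝ :=
  ∑ j, ENNReal.ofReal (p j) • volume.withDensity (fun x => ENNReal.ofReal (g (x - θ j)))

/-- Admissible weights and atoms of the true mixture: positive weights summing to one (hence
`t ≥ 1`), completely separated atoms, and a base density that is bounded away from zero in a
neighbourhood of each atom. -/
structure AdmissibleTruth (a b : ℝ) (q₀ : ℝ → ℝ) {t : ℕ} (p θ : Fin t → ℝ) : Prop where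
  weight_pos : ∀ j, 0 < p j
  weight_sum : ∑ j, p j = 1
  separated : ∀ j k, j ≠ k → b - a < |θ j - θ k|
  base_pos_near : ∀ j, ∃ L > (0 : ℝ), ∀ᶠ x in 𝓝 (θ j), L ≤ q₀ x

/-- `X 0, X 1, …` are independent with common law `P`. -/
structure IsIIDSample {Ω : Type*} [MeasurableSpace Ω] (μ : Measure Ω) (X : ℕ → Ω → ℝ)
    (P : Measure ℝ) : Prop where
  measurable : ∀ i, Measurable (X i)
  indep : iIndepFun X μ
  law : ∀ i, μ.map (X i) = P

end DPMixture

end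

namespace DPMixture

/-! ### Set partitions as finite sets of blocks -/

section SetPartitions

variable {ι : Type*} [DecidableEq ι]

/-! Write J_s for the joint density of the data and of s clusters, and V_n for the integral of α^t /
α^(n) against π.

Fixed α. Moving one observation out of a block B of size at least two into a singleton multiplies
the prior weight by α / (|B| - 1) and the likelihood by a factor bounded away from zero. The |B|
choices of the observation make up for the division by |B| - 1. Hence J_{t+1} is at least a constant
times J_t, uniformly in n, and the posterior of t stays below some c < 1
(`mul_jointDensity_le_jointDensity_succ`).

Random α. Here α^(n) = α (n-1)! ∏ (1 + α/i), and the last product grows like a power n^α up to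
constants in the exponent, so that α^t / α^(n) pushes α to zero while every additional cluster costs
a factor α. To make this quantitative, J_t is bounded below through the partition into true
components (`le_jointDensity`). The sum of the J_s with s > t is bounded in mean after division by
the true density of the sample, one vector c of component labels at a time
(`lintegral_sum_marginalLik_le`). A block then contributes the average over the base measure of the
probability that observations sharing one parameter fall into the supports prescribed by c. Times
(|B| - 1)!, this is at most C W(B), where W(B) = ∏_j k_j! / (k_j + 1)² and k_j counts the label j in
B (`exists_block_bound`). The weights W are stable under convolution: over the partitions into s
blocks, the products of W sum to at most (8^t)^s / s! times the W of the whole sample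
(`sum_setPartitionsInto_labelWeight_le`). Summing over s > t leaves the integral of α e^{Kα} α^t /
α^(n), which is negligible against V_n (`eventually_lintegral_mul_exp_le`). The factor e^{Kα} is
tolerated only for α ≤ √n. Beyond √n the prior weights of all partitions sum to at most 1
(`sum_setPartitions_factorial_le`), and a polynomial moment of π suffices (`eventually_tail_le`).
Markov's inequality turns the means into probabilities; the bound for the label vector c is
proportional to ∏ p(c_i), and these products sum to 1. Fewer than t clusters are impossible as soon
as every component has an observation near its right end, since such observations are pairwise too
far apart to share a block. -/

theorem sum_le_sum_of_injOn {α β : Type*} {s : Finset α} {t : Finset β} (φ : α → β)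
    {F : α → ℝ} {G : β → ℝ} (hφ : ∀ x ∈ s, φ x ∈ t) (hinj : Set.InjOn φ s)
    (hFG : ∀ x ∈ s, F x ≤ G (φ x)) (hG : ∀ y ∈ t, 0 ≤ G y) :
    ∑ x ∈ s, F x ≤ ∑ y ∈ t, G y := by
  classical
  calc ∑ x ∈ s, F x ≤ ∑ x ∈ s, G (φ x) := Finset.sum_le_sum hFG
    _ = ∑ y ∈ s.image φ, G y := (Finset.sum_image hinj).symm
    _ ≤ ∑ y ∈ t, G y := Finset.sum_le_sum_of_subset_of_nonneg
        (Finset.image_subset_iff.2 hφ) fun y hy _ => hG y hy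

open Classical in
/-- The partitions of a finite set, each given as its set of (nonempty) blocks. -/
noncomputable def setPartitions (T : Finset ι) : Finset (Finset (Finset ι)) :=
  T.powerset.powerset.filter fun P =>
    (P : Set (Finset ι)).PairwiseDisjoint id ∧ ∅ ∉ P ∧ P.sup id = T

/-- The partitions of a finite set into `s` blocks. -/
noncomputable def setPartitionsInto (T : Finset ι) (s : ℕ) : Finset (Finset (Finset ι)) :=
  (setPartitions T).filter fun P => P.card = s

theorem mem_setPartitions {T : Finset ι} {P : Finset (Finset ι)} :
    P ∈ setPartitions T ↔
      (P : Set (Finset ι)).PairwiseDisjoint id ∧ ∅ ∉ P ∧ P.sup id = T := by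
  simp only [setPartitions, Finset.mem_filter, Finset.mem_powerset, and_iff_right_iff_imp]
  rintro ⟨-, -, rfl⟩ B hB
  exact Finset.mem_powerset.2 (Finset.le_sup (f := id) hB)

theorem mem_setPartitionsInto {T : Finset ι} {s : ℕ} {P : Finset (Finset ι)} :
    P ∈ setPartitionsInto T s ↔ P ∈ setPartitions T ∧ P.card = s := by
  simp [setPartitionsInto]

theorem subset_of_mem_setPartitions {T : Finset ι} {P : Finset (Finset ι)}
    (hP : P ∈ setPartitions T) {B : Finset ι} (hB : B ∈ P) : B ⊆ T := by
  rw [← (mem_setPartitions.1 hP).2.2]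
  exact Finset.le_sup (f := id) hB

theorem nonempty_of_mem_setPartitions {T : Finset ι} {P : Finset (Finset ι)}
    (hP : P ∈ setPartitions T) {B : Finset ι} (hB : B ∈ P) : B.Nonempty := by
  rw [Finset.nonempty_iff_ne_empty]
  rintro rfl
  exact (mem_setPartitions.1 hP).2.1 hB

theorem exists_mem_of_mem_setPartitions {T : Finset ι} {P : Finset (Finset ι)}
    (hP : P ∈ setPartitions T) {i : ι} (hi : i ∈ T) : ∃ B ∈ P, i ∈ B := by
  rw [← (mem_setPartitions.1 hP).2.2] at hi
  simpa [Finset.mem_sup] using hi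

theorem eq_of_mem_setPartitions {T : Finset ι} {P : Finset (Finset ι)}
    (hP : P ∈ setPartitions T) {B B' : Finset ι} (hB : B ∈ P) (hB' : B' ∈ P) {i : ι}
    (hi : i ∈ B) (hi' : i ∈ B') : B = B' := by
  by_contra hne
  exact Finset.disjoint_left.1 ((mem_setPartitions.1 hP).1 hB hB' hne) hi hi'

theorem sum_card_of_mem_setPartitions {T : Finset ι} {P : Finset (Finset ι)}
    (hP : P ∈ setPartitions T) : ∑ B ∈ P, B.card = T.card := by
  have h := mem_setPartitions.1 hP
  rw [← h.2.2, Finset.sup_eq_biUnion, Finset.card_biUnion]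
  · rfl
  · exact h.1

theorem prod_blocks_of_mem_setPartitions {M : Type*} [CommMonoid M] {T : Finset ι}
    {P : Finset (Finset ι)} (hP : P ∈ setPartitions T) (f : ι → M) :
    ∏ B ∈ P, ∏ i ∈ B, f i = ∏ i ∈ T, f i := by
  have h := mem_setPartitions.1 hP
  rw [← h.2.2, Finset.sup_eq_biUnion, Finset.prod_biUnion h.1]
  rfl

theorem card_le_of_mem_setPartitions {T : Finset ι} {P : Finset (Finset ι)}
    (hP : P ∈ setPartitions T) : P.card ≤ T.card := by
  rw [← sum_card_of_mem_setPartitions hP, Finset.card_eq_sum_ones]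
  exact Finset.sum_le_sum fun B hB =>
    Finset.card_pos.2 (nonempty_of_mem_setPartitions hP hB)

theorem erase_mem_setPartitions {T : Finset ι} {P : Finset (Finset ι)}
    (hP : P ∈ setPartitions T) {B : Finset ι} (hB : B ∈ P) :
    P.erase B ∈ setPartitions (T \ B) := by
  have h := mem_setPartitions.1 hP
  refine mem_setPartitions.2 ⟨h.1.subset (by simp), fun h0 =>
    h.2.1 (Finset.mem_of_mem_erase h0), ?_⟩
  ext i
  simp only [Finset.mem_sup, Finset.mem_erase, id, Finset.mem_sdiff]
  constructor
  · rintro ⟨B', ⟨hne, hB'⟩, hi⟩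
    exact ⟨subset_of_mem_setPartitions hP hB' hi,
      fun hiB => hne (eq_of_mem_setPartitions hP hB' hB hi hiB)⟩
  · rintro ⟨hiT, hiB⟩
    obtain ⟨B', hB', hi⟩ := exists_mem_of_mem_setPartitions hP hiT
    exact ⟨B', ⟨fun h => hiB (h ▸ hi), hB'⟩, hi⟩

theorem insert_mem_setPartitions {T : Finset ι} {P : Finset (Finset ι)}
    (hP : P ∈ setPartitions T) {B : Finset ι} (hB : B.Nonempty) (hd : Disjoint B T) :
    insert B P ∈ setPartitions (B ∪ T) ∧ B ∉ P := by
  have h := mem_setPartitions.1 hP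
  refine ⟨mem_setPartitions.2 ⟨?_, ?_, ?_⟩, ?_⟩
  · rw [Finset.coe_insert]
    exact h.1.insert fun B' hB' _ => hd.mono_right (subset_of_mem_setPartitions hP hB')
  · rw [Finset.mem_insert, not_or]
    exact ⟨hB.ne_empty.symm, h.2.1⟩
  · rw [Finset.sup_insert, h.2.2]
    rfl
  · intro hBP
    obtain ⟨i, hi⟩ := hB
    exact Finset.disjoint_left.1 hd hi (subset_of_mem_setPartitions hP hBP hi)

/-- Distinguishing a block of a partition. -/
theorem succ_mul_sum_setPartitionsInto_le (w : Finset ι → ℝ) (hw : ∀ B, 0 ≤ w B)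
    (T : Finset ι) (s : ℕ) :
    (s + 1 : ℝ) * ∑ P ∈ setPartitionsInto T (s + 1), ∏ B ∈ P, w B ≤
      ∑ B ∈ T.powerset, w B * ∑ Q ∈ setPartitionsInto (T \ B) s, ∏ B' ∈ Q, w B' := by
  have h1 : (s + 1 : ℝ) * ∑ P ∈ setPartitionsInto T (s + 1), ∏ B ∈ P, w B =
      ∑ P ∈ setPartitionsInto T (s + 1), ∑ _B ∈ P, ∏ B ∈ P, w B := by
    rw [Finset.mul_sum]
    refine Finset.sum_congr rfl fun P hP => ?_
    rw [Finset.sum_const, (mem_setPartitionsInto.1 hP).2, nsmul_eq_mul]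
    push_cast
    ring
  simp_rw [h1, Finset.mul_sum]
  rw [Finset.sum_sigma', Finset.sum_sigma']
  refine sum_le_sum_of_injOn (fun x => ⟨x.2, x.1.erase x.2⟩) ?_ ?_ ?_ ?_
  · rintro ⟨P, B⟩ h
    simp only [Finset.mem_sigma, mem_setPartitionsInto] at h ⊢
    exact ⟨Finset.mem_powerset.2 (subset_of_mem_setPartitions h.1.1 h.2),
      erase_mem_setPartitions h.1.1 h.2, by rw [Finset.card_erase_of_mem h.2, h.1.2]; rfl⟩
  · rintro ⟨P, B⟩ h ⟨P', B'⟩ h' heq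
    simp only [Finset.coe_sigma, Set.mem_sigma_iff, Finset.mem_coe] at h h'
    simp only [Sigma.mk.injEq, heq_eq_eq] at heq
    obtain ⟨rfl, heq⟩ := heq
    rw [← Finset.insert_erase h.2, heq, Finset.insert_erase h'.2]
  · rintro ⟨P, B⟩ h
    simp only [Finset.mem_sigma] at h
    exact (Finset.mul_prod_erase P w h.2).symm.le
  · rintro ⟨B, Q⟩ -
    exact mul_nonneg (hw _) (Finset.prod_nonneg fun _ _ => hw _)

/-- Isolating the block that contains a given element. -/
theorem sum_setPartitions_insert_le (w : Finset ι → ℝ) (hw : ∀ B, 0 ≤ w B)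
    (T : Finset ι) {x : ι} (hx : x ∉ T) :
    ∑ P ∈ setPartitions (insert x T), ∏ B ∈ P, w B ≤
      ∑ B ∈ T.powerset, w (insert x B) * ∑ Q ∈ setPartitions (T \ B), ∏ B' ∈ Q, w B' := by
  classical
  simp_rw [Finset.mul_sum]
  rw [Finset.sum_sigma']
  have hex : ∀ P ∈ setPartitions (insert x T), ∃ B ∈ P, x ∈ B := fun P hP =>
    exists_mem_of_mem_setPartitions hP (Finset.mem_insert_self x T)
  choose! β hβ hxβ using hex
  have key : ∀ P ∈ setPartitions (insert x T), insert x ((β P).erase x) = β P := fun P hP =>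
    Finset.insert_erase (hxβ P hP)
  -- `β P` is the block that contains x. Both it and P can be rebuilt from the image, because x is
  -- put back into the first component.
  refine sum_le_sum_of_injOn (fun P => ⟨(β P).erase x, P.erase (β P)⟩) ?_ ?_ ?_ ?_
  · intro P hP
    have h1 := subset_of_mem_setPartitions hP (hβ P hP)
    refine Finset.mem_sigma.2 ⟨Finset.mem_powerset.2 ?_, ?_⟩
    · intro i hi
      exact (Finset.mem_insert.1 (h1 (Finset.mem_of_mem_erase hi))).resolve_left
        (Finset.ne_of_mem_erase hi)
    · have h2 := erase_mem_setPartitions hP (hβ P hP)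
      convert h2 using 2
      have h3 := hxβ P hP
      ext i
      simp only [Finset.mem_sdiff, Finset.mem_insert, Finset.mem_erase]
      by_cases hi : i = x
      · simp [hi, hx, h3]
      · simp [hi]
  · intro P hP P' hP' heq
    simp only [Sigma.mk.injEq, heq_eq_eq] at heq
    obtain ⟨h1, h2⟩ := heq
    have h3 : β P = β P' := by rw [← key P hP, h1, key P' hP']
    rw [← Finset.insert_erase (hβ P hP), h2, h3, Finset.insert_erase (hβ P' hP')]
  · intro P hP
    simp only [key P hP]
    exact (Finset.mul_prod_erase P w (hβ P hP)).symm.le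
  · rintro ⟨B, Q⟩ -
    exact mul_nonneg (hw _) (Finset.prod_nonneg fun _ _ => hw _)

theorem setPartitions_empty : setPartitions (∅ : Finset ι) = {∅} := by
  ext P
  rw [mem_setPartitions, Finset.mem_singleton]
  constructor
  · rintro ⟨-, h0, h⟩
    rw [Finset.eq_empty_iff_forall_notMem]
    intro B hB
    have : B ⊆ ∅ := h ▸ Finset.le_sup (f := id) hB
    rw [Finset.subset_empty] at this
    exact h0 (this ▸ hB)
  · rintro rfl
    simp

/-- Plain sets of blocks carry no ground set in their type, so blocks can be erased, split and
inserted while the underlying set changes. This is the passage from the partitions of the model to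
that description. -/
theorem sum_finpartition_eq {n : ℕ} {M : Type*} [AddCommMonoid M] (s : ℕ)
    (F : Finset (Finset (Fin n)) → M) :
    ∑ A : Finpartition (Finset.univ : Finset (Fin n)) with A.parts.card = s, F A.parts =
      ∑ P ∈ setPartitionsInto (Finset.univ : Finset (Fin n)) s, F P := by
  refine Finset.sum_bij (fun A _ => A.parts) ?_ ?_ ?_ ?_
  · intro A hA
    refine mem_setPartitionsInto.2 ⟨mem_setPartitions.2 ⟨?_, A.bot_notMem, A.sup_parts⟩,
      (Finset.mem_filter.1 hA).2⟩
    exact Finset.supIndep_iff_pairwiseDisjoint.1 A.supIndep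
  · intro A _ A' _ h
    exact Finpartition.ext h
  · intro P hP
    obtain ⟨hP, hc⟩ := mem_setPartitionsInto.1 hP
    have h := mem_setPartitions.1 hP
    exact ⟨⟨P, Finset.supIndep_iff_pairwiseDisjoint.2 h.1, h.2.2, h.2.1⟩, by simp [hc], rfl⟩
  · intros
    rfl

end SetPartitions

/-! ### Exponential generating function bounds -/

/-- The correction -1/(n+1) is what makes the induction close: 1/(n+2)² is at most the telescoping
difference 1/(n+1) - 1/(n+2). -/
theorem sum_range_inv_sq_le (n : ℕ) :
    ∑ k ∈ Finset.range (n + 1), (1 : ℝ) / (k + 1) ^ 2 ≤ 2 - 1 / ((n : ℝ) + 1) := by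
  induction n with
  | zero => norm_num
  | succ n ih =>
    rw [Finset.sum_range_succ]
    have h1 : (1 : ℝ) / ((n + 1 : ℕ) + 1) ^ 2 ≤ 1 / ((n : ℝ) + 1) - 1 / ((n + 1 : ℕ) + 1) := by
      push_cast
      rw [div_sub_div _ _ (by positivity) (by positivity),
        div_le_div_iff₀ (by positivity) (by positivity)]
      nlinarith [(n.cast_nonneg : (0 : ℝ) ≤ n)]
    linarith

/-- Since n + 1 is at most (k+1) + (n-k+1), its square is at most twice the sum of the two squares.
So each term is at most 2/(n+1)² times the sum of the two factors, and each factor sums to at most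
2, whence 8 = 2 · (2 + 2). -/
theorem sum_inv_sq_convolution_le (n : ℕ) :
    ∑ k ∈ Finset.range (n + 1), (1 : ℝ) / (k + 1) ^ 2 * (1 / ((n - k : ℕ) + 1) ^ 2) ≤
      8 * (1 / ((n : ℝ) + 1) ^ 2) := by
  have hterm : ∀ k ∈ Finset.range (n + 1),
      (1 : ℝ) / (k + 1) ^ 2 * (1 / ((n - k : ℕ) + 1) ^ 2) ≤
        2 * (1 / (n + 1) ^ 2) * (1 / (k + 1) ^ 2 + 1 / ((n - k : ℕ) + 1) ^ 2) := by
    intro k hk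
    have hkn : k ≤ n := Nat.lt_succ_iff.1 (Finset.mem_range.1 hk)
    have hn : (n : ℝ) = k + (n - k : ℕ) := by push_cast [Nat.cast_sub hkn]; ring
    rw [hn]
    generalize (n - k : ℕ) = l
    have hx : (0 : ℝ) < k + 1 := by positivity
    have hy : (0 : ℝ) < (l : ℝ) + 1 := by positivity
    have hz : (0 : ℝ) < (k : ℝ) + l + 1 := by positivity
    have hzle : ((k : ℝ) + l + 1) ^ 2 ≤ 2 * (((k : ℝ) + 1) ^ 2 + ((l : ℝ) + 1) ^ 2) := by
      have h1 : (k : ℝ) + l + 1 ≤ (k + 1) + (l + 1) := by linarith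
      nlinarith [sq_nonneg ((k : ℝ) - l), hz]
    rw [div_add_div _ _ (by positivity) (by positivity), mul_one_div, mul_one_div, div_mul_div_comm,
      div_div, div_le_div_iff₀ (by positivity) (by positivity)]
    have : (0 : ℝ) ≤ (k + 1) ^ 2 * (l + 1) ^ 2 := by positivity
    nlinarith [mul_le_mul_of_nonneg_left hzle this]
  have hrefl : ∑ k ∈ Finset.range (n + 1), (1 : ℝ) / ((n - k : ℕ) + 1) ^ 2 =
      ∑ k ∈ Finset.range (n + 1), (1 : ℝ) / (k + 1) ^ 2 :=
    Finset.sum_range_reflect (fun k => (1 : ℝ) / ((k : ℕ) + 1) ^ 2) (n + 1)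
  have h2 : ∑ k ∈ Finset.range (n + 1), (1 : ℝ) / (k + 1) ^ 2 ≤ 2 :=
    (sum_range_inv_sq_le n).trans (sub_le_self _ (by positivity))
  calc _ ≤ ∑ k ∈ Finset.range (n + 1),
        2 * ((1 : ℝ) / (n + 1) ^ 2) * (1 / (k + 1) ^ 2 + 1 / ((n - k : ℕ) + 1) ^ 2) :=
        Finset.sum_le_sum hterm
    _ = 2 * (1 / (n + 1) ^ 2) * (2 * ∑ k ∈ Finset.range (n + 1), (1 : ℝ) / (k + 1) ^ 2) := by
        rw [← Finset.mul_sum, Finset.sum_add_distrib, hrefl]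
        ring
    _ ≤ 2 * (1 / (n + 1) ^ 2) * (2 * 2) := by gcongr
    _ = _ := by ring

/-- The weight `k! / (k + 1)²`. -/
noncomputable def sizeWeight (k : ℕ) : ℝ := (k.factorial : ℝ) * (1 / (k + 1) ^ 2)

theorem sizeWeight_pos (k : ℕ) : 0 < sizeWeight k := by
  unfold sizeWeight
  positivity

/-- The binomial coefficient counting subsets of size k cancels k! (n-k)! against n!, which reduces
the sum to the convolution of inverse squares. -/
theorem sum_powerset_sizeWeight_le {ι : Type*} [DecidableEq ι] (T : Finset ι) :
    ∑ B ∈ T.powerset, sizeWeight B.card * sizeWeight (T.card - B.card) ≤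
      8 * sizeWeight T.card := by
  rw [Finset.sum_powerset_apply_card (fun k => sizeWeight k * sizeWeight (T.card - k))]
  set n := T.card
  calc _ = ∑ k ∈ Finset.range (n + 1), (n.factorial : ℝ) *
        ((1 : ℝ) / (k + 1) ^ 2 * (1 / ((n - k : ℕ) + 1) ^ 2)) := by
        refine Finset.sum_congr rfl fun k hk => ?_
        have hkn : k ≤ n := Nat.lt_succ_iff.1 (Finset.mem_range.1 hk)
        have h := Nat.choose_mul_factorial_mul_factorial hkn
        rw [nsmul_eq_mul, sizeWeight, sizeWeight, ← h]
        push_cast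
        ring
    _ ≤ (n.factorial : ℝ) * (8 * (1 / (n + 1) ^ 2)) := by
        rw [← Finset.mul_sum]
        exact mul_le_mul_of_nonneg_left (sum_inv_sq_convolution_le n) (by positivity)
    _ = _ := by rw [sizeWeight]; ring

section Labels

variable {ι : Type*} {t : ℕ}

/-- The number of elements of `B` with label `j`. -/
def labelCount (c : ι → Fin t) (B : Finset ι) (j : Fin t) : ℕ := (B.filter fun i => c i = j).card

/-- The weight `∏ j, k_j! / (k_j + 1)²` of a set with `k_j` elements of label `j`. -/
noncomputable def labelWeight (c : ι → Fin t) (B : Finset ι) : ℝ :=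
  ∏ j, sizeWeight (labelCount c B j)

theorem labelWeight_pos (c : ι → Fin t) (B : Finset ι) : 0 < labelWeight c B :=
  Finset.prod_pos fun _ _ => sizeWeight_pos _

theorem sum_labelCount (c : ι → Fin t) (B : Finset ι) : ∑ j, labelCount c B j = B.card := by
  rw [Finset.card_eq_sum_card_fiberwise (f := c) (t := Finset.univ) (fun _ _ => by simp)]
  rfl

theorem prod_pow_labelCount {M : Type*} [CommMonoid M] (c : ι → Fin t) (B : Finset ι)
    (p : Fin t → M) : ∏ j, p j ^ labelCount c B j = ∏ i ∈ B, p (c i) := by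
  rw [← Finset.prod_fiberwise B c]
  refine Finset.prod_congr rfl fun j _ => ?_
  rw [Finset.prod_congr rfl (g := fun _ => p j), Finset.prod_const]
  · rfl
  · intro i hi
    rw [(Finset.mem_filter.1 hi).2]

/-- A subset of T is a tuple of subsets of its label classes, and the weight is a product over the
labels. The sum therefore factorises into t one-label sums, each costing a factor 8. -/
theorem sum_powerset_labelWeight_le [DecidableEq ι] (c : ι → Fin t) (T : Finset ι) :
    ∑ B ∈ T.powerset, labelWeight c B * labelWeight c (T \ B) ≤ 8 ^ t * labelWeight c T := by
  classical
  let Tj : Fin t → Finset ι := fun j => T.filter fun i => c i = j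
  calc _ ≤ ∑ x ∈ Fintype.piFinset fun j => (Tj j).powerset,
        ∏ j, sizeWeight (x j).card * sizeWeight ((Tj j).card - (x j).card) := by
        refine sum_le_sum_of_injOn (fun B j => B.filter fun i => c i = j) ?_ ?_ ?_ ?_
        · intro B hB
          rw [Fintype.mem_piFinset]
          exact fun j => Finset.mem_powerset.2
            (Finset.filter_subset_filter _ (Finset.mem_powerset.1 hB))
        · intro B _ B' _ h
          ext i
          have := congrArg (fun s => i ∈ s (c i)) h
          simpa using this
        · intro B hB
          rw [labelWeight, labelWeight, ← Finset.prod_mul_distrib]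
          refine le_of_eq (Finset.prod_congr rfl fun j _ => ?_)
          have hsub : (B.filter fun i => c i = j) ⊆ Tj j :=
            Finset.filter_subset_filter _ (Finset.mem_powerset.1 hB)
          rw [labelCount, labelCount, ← Finset.card_sdiff_of_subset hsub]
          congr 3
          ext i
          simp only [Tj, Finset.mem_filter, Finset.mem_sdiff]
          tauto
        · intro x _
          exact Finset.prod_nonneg fun j _ =>
            mul_nonneg (sizeWeight_pos _).le (sizeWeight_pos _).le
    _ = ∏ j, ∑ B ∈ (Tj j).powerset, sizeWeight B.card * sizeWeight ((Tj j).card - B.card) :=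
        (Finset.prod_univ_sum (fun j => (Tj j).powerset)
          (fun j B => sizeWeight B.card * sizeWeight ((Tj j).card - B.card))).symm
    _ ≤ ∏ j, 8 * sizeWeight (Tj j).card :=
        Finset.prod_le_prod (fun j _ => Finset.sum_nonneg fun B _ =>
          mul_nonneg (sizeWeight_pos _).le (sizeWeight_pos _).le)
          fun j _ => sum_powerset_sizeWeight_le (Tj j)
    _ = _ := by
        rw [Finset.prod_mul_distrib, Finset.prod_const, Finset.card_univ, Fintype.card_fin]
        rfl

/-- Induction on s. Distinguishing one of s + 1 blocks produces the division by s + 1, hence the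
factorial in the end; convolving the distinguished block with the rest costs 8^t. The 1/s! is what
later turns the sum over s into an exponential series. -/
theorem sum_setPartitionsInto_labelWeight_le [DecidableEq ι] (c : ι → Fin t) (s : ℕ) (T : Finset ι) :
    ∑ P ∈ setPartitionsInto T s, ∏ B ∈ P, labelWeight c B ≤
      (8 ^ t) ^ s / s.factorial * labelWeight c T := by
  induction s generalizing T with
  | zero =>
    have h0 : ∀ P ∈ setPartitionsInto T 0, P = ∅ ∧ T = ∅ := by
      intro P hP
      obtain ⟨hP, hc⟩ := mem_setPartitionsInto.1 hP
      have hP0 := Finset.card_eq_zero.1 hc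
      have := (mem_setPartitions.1 hP).2.2
      rw [hP0] at this
      exact ⟨hP0, by simpa using this.symm⟩
    rcases T.eq_empty_or_nonempty with rfl | hT
    · have h1 : labelWeight c (∅ : Finset ι) = 1 := by
        simp [labelWeight, labelCount, sizeWeight]
      have h2 : setPartitionsInto (∅ : Finset ι) 0 = {∅} := by
        simp [setPartitionsInto, setPartitions_empty]
      simp [h1, h2]
    · rw [Finset.sum_eq_zero]
      · exact mul_nonneg (by positivity) (labelWeight_pos c T).le
      · intro P hP
        exact absurd (h0 P hP).2 hT.ne_empty
  | succ s ih =>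
    have h1 := succ_mul_sum_setPartitionsInto_le (labelWeight c)
      (fun B => (labelWeight_pos c B).le) T s
    have h2 : ∑ B ∈ T.powerset, labelWeight c B *
        ∑ Q ∈ setPartitionsInto (T \ B) s, ∏ B' ∈ Q, labelWeight c B' ≤
        (8 ^ t) ^ s / s.factorial * (8 ^ t * labelWeight c T) := by
      refine le_trans ?_ (mul_le_mul_of_nonneg_left (sum_powerset_labelWeight_le c T)
        (by positivity))
      rw [Finset.mul_sum]
      refine Finset.sum_le_sum fun B _ => ?_
      calc _ ≤ labelWeight c B * ((8 ^ t) ^ s / s.factorial * labelWeight c (T \ B)) :=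
            mul_le_mul_of_nonneg_left (ih _) (labelWeight_pos c B).le
        _ = _ := by ring
    have h3 := h1.trans h2
    rw [Nat.factorial_succ]
    push_cast
    rw [mul_comm, ← le_div_iff₀ (by positivity)] at h3
    refine h3.trans (le_of_eq ?_)
    field_simp
    ring

/-- A single term of the multinomial theorem. -/
theorem factorial_mul_prod_pow_le (p : Fin t → ℝ) (hp : ∀ j, 0 ≤ p j) (c : ι → Fin t)
    (B : Finset ι) :
    (B.card.factorial : ℝ) * ∏ i ∈ B, p (c i) ≤
      (∏ j, ((labelCount c B j).factorial : ℝ)) * (∑ j, p j) ^ B.card := by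
  rw [Finset.sum_pow_eq_sum_piAntidiag]
  have hmem : labelCount c B ∈ (Finset.univ : Finset (Fin t)).piAntidiag B.card := by
    simp [sum_labelCount]
  have h1 := Finset.single_le_sum (f := fun k : Fin t → ℕ =>
    (Nat.multinomial Finset.univ k : ℝ) * ∏ i, p i ^ k i)
    (fun k _ => mul_nonneg (Nat.cast_nonneg _)
      (Finset.prod_nonneg fun j _ => pow_nonneg (hp j) _)) hmem
  refine le_trans (le_of_eq ?_) (mul_le_mul_of_nonneg_left h1 (by positivity))
  have h2 := Nat.multinomial_spec Finset.univ (labelCount c B)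
  rw [sum_labelCount] at h2
  rw [← mul_assoc, prod_pow_labelCount, ← h2]
  push_cast
  rfl

end Labels

/-! ### The Ewens sampling formula -/

/-- The hockey-stick identity for rising factorials, needed to sum over the size of the block of one
given element. -/
theorem sum_range_ascPochhammer (α : ℝ) (n : ℕ) :
    α * ∑ m ∈ Finset.range (n + 1), (ascPochhammer ℝ m).eval α / m.factorial =
      (ascPochhammer ℝ (n + 1)).eval α / n.factorial := by
  induction n with
  | zero => simp
  | succ n ih =>
    rw [Finset.sum_range_succ, mul_add, ih, ascPochhammer_succ_eval (n + 1), Nat.factorial_succ]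
    push_cast
    field_simp
    ring

/-- Strong induction on the size of T. Fix x in T: a block consisting of x and k others has weight α
k!, it arises in C(m, k) ways, and the remaining elements are handled by induction. The sum over k
is the hockey-stick identity. Equality is true, but only this direction is used. -/
theorem sum_setPartitions_factorial_le {ι : Type*} [DecidableEq ι] {α : ℝ} (hα : 0 ≤ α)
    (T : Finset ι) :
    ∑ P ∈ setPartitions T, ∏ B ∈ P, α * ((B.card - 1).factorial : ℝ) ≤
      (ascPochhammer ℝ T.card).eval α := by
  induction hn : T.card using Nat.strong_induction_on generalizing T with
  | _ n ih =>
    rcases T.eq_empty_or_nonempty with rfl | ⟨x, hx⟩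
    · subst hn
      simp [setPartitions_empty]
    · obtain ⟨m, rfl⟩ : ∃ m, n = m + 1 :=
        Nat.exists_eq_succ_of_ne_zero (by rw [← hn]; exact (Finset.card_pos.2 ⟨x, hx⟩).ne')
      set S := T.erase x with hS
      have hxS : x ∉ S := Finset.notMem_erase x T
      have hT : T = insert x S := (Finset.insert_erase hx).symm
      have hcS : S.card = m := by rw [hS, Finset.card_erase_of_mem hx, hn]; rfl
      rw [hT]
      refine (sum_setPartitions_insert_le (fun B => α * ((B.card - 1).factorial : ℝ))
        (fun B => by positivity) S hxS).trans ?_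
      calc _ ≤ ∑ B ∈ S.powerset, α * (B.card.factorial : ℝ) *
            (ascPochhammer ℝ (S.card - B.card)).eval α := by
            refine Finset.sum_le_sum fun B hB => ?_
            have hBS := Finset.mem_powerset.1 hB
            rw [Finset.card_insert_of_notMem fun h => hxS (hBS h), Nat.add_sub_cancel]
            refine mul_le_mul_of_nonneg_left ?_ (by positivity)
            refine ih (S.card - B.card) (by omega) _ (Finset.card_sdiff_of_subset hBS)
        _ = ∑ k ∈ Finset.range (m + 1), α * (m.factorial : ℝ) *
            ((ascPochhammer ℝ (m - k)).eval α / (m - k).factorial) := by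
            rw [Finset.sum_powerset_apply_card (fun k => α * (k.factorial : ℝ) *
              (ascPochhammer ℝ (S.card - k)).eval α), hcS]
            refine Finset.sum_congr rfl fun k hk => ?_
            have hkn : k ≤ m := Nat.lt_succ_iff.1 (Finset.mem_range.1 hk)
            rw [nsmul_eq_mul, ← Nat.choose_mul_factorial_mul_factorial hkn]
            push_cast
            field_simp
        _ = (m.factorial : ℝ) * (α * ∑ k ∈ Finset.range (m + 1),
            (ascPochhammer ℝ k).eval α / k.factorial) := by
            have h := Finset.sum_range_reflect
              (fun k => (ascPochhammer ℝ k).eval α / k.factorial) (m + 1)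
            simp only [Nat.add_sub_cancel] at h
            rw [← Finset.mul_sum, h]
            ring
        _ = _ := by
            rw [sum_range_ascPochhammer]
            field_simp

/-! ### Marginal likelihoods -/

/-- The prior probability of a partition of `n` items given as its set of blocks. -/
noncomputable def priorWeight (π : Measure ℝ) (n : ℕ) (P : Finset (Finset (Fin n))) : ℝ :=
  ∫ α, α ^ P.card / (ascPochhammer ℝ n).eval α * ∏ B ∈ P, (Nat.factorial (B.card - 1) : ℝ) ∂π

theorem jointDensity_eq (g q₀ : ℝ → ℝ) (π : Measure ℝ) {n : ℕ} (x : Fin n → ℝ) (s : ℕ) :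
    jointDensity g q₀ π x s =
      ∑ P ∈ setPartitionsInto (Finset.univ : Finset (Fin n)) s,
        priorWeight π n P * ∏ B ∈ P, marginalLik g q₀ x B :=
  sum_finpartition_eq s fun P => priorWeight π n P * ∏ B ∈ P, marginalLik g q₀ x B

theorem mul_le_integral_of_le_on_Ioo {F : ℝ → ℝ} (hF : Integrable F) (h0 : ∀ θ, 0 ≤ F θ)
    {u v κ : ℝ} (huv : u ≤ v) (hκ : ∀ θ ∈ Set.Ioo u v, κ ≤ F θ) :
    κ * (v - u) ≤ ∫ θ, F θ := by
  calc κ * (v - u) = ∫ _ in Set.Ioo u v, κ := by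
        rw [setIntegral_const, smul_eq_mul, measureReal_def, Real.volume_Ioo,
          ENNReal.toReal_ofReal (by linarith), mul_comm]
    _ ≤ ∫ θ in Set.Ioo u v, F θ :=
        setIntegral_mono_on (integrableOn_const (by simp)) hF.integrableOn measurableSet_Ioo hκ
    _ ≤ ∫ θ, F θ := setIntegral_le_integral hF (ae_of_all _ h0)

section Kernel

variable {a b : ℝ} {g q₀ : ℝ → ℝ}

theorem IsDensity.integrable (hq₀ : IsDensity q₀) : Integrable q₀ := by
  refine ⟨hq₀.measurable.aestronglyMeasurable, ?_⟩
  rw [hasFiniteIntegral_iff_ofReal (ae_of_all _ hq₀.nonneg), hq₀.lintegral_eq_one]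
  exact ENNReal.one_lt_top

theorem BoundedSupportKernel.abs_sub_le (hg : BoundedSupportKernel a b g) :
    ∃ R ≥ (0 : ℝ), ∀ x ∈ Set.Ioo a b, ∀ y ∈ Set.Ioo a b, |g y - g x| ≤ R * |y - x| := by
  obtain ⟨R, hR⟩ := hg.deriv_bounded
  refine ⟨max R 0, le_max_right _ _, fun x hx y hy => ?_⟩
  have := (convex_Ioo a b).norm_image_sub_le_of_norm_deriv_le (f := g) (C := max R 0)
    (fun z hz => (hg.differentiableOn z hz).differentiableAt (isOpen_Ioo.mem_nhds hz))
    (fun z hz => (hR z hz).trans (le_max_left _ _)) hx hy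
  simpa [Real.norm_eq_abs] using this

theorem BoundedSupportKernel.exists_bound (hg : BoundedSupportKernel a b g) (hab : a < b) :
    ∃ M > (0 : ℝ), ∀ x, g x ≤ M := by
  obtain ⟨R, hR0, hR⟩ := hg.abs_sub_le
  have hc : (a + b) / 2 ∈ Set.Ioo a b := ⟨by linarith, by linarith⟩
  have h0 := hg.isDensity.nonneg
  -- The Lipschitz bound reaches the open interval only; g a and g b take care of the endpoints, and
  -- 1 makes the bound positive.
  refine ⟨g ((a + b) / 2) + R * (b - a) + g a + g b + 1, ?_, fun x => ?_⟩
  · have := mul_nonneg hR0 (sub_nonneg.2 hab.le)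
    linarith [h0 ((a + b) / 2), h0 a, h0 b]
  · have h1 := mul_nonneg hR0 (sub_nonneg.2 hab.le)
    by_cases hx : x ∈ Set.Icc a b
    · rcases eq_or_lt_of_le hx.1 with rfl | hax
      · linarith [h0 ((a + b) / 2), h0 a, h0 b]
      rcases eq_or_lt_of_le hx.2 with rfl | hxb
      · linarith [h0 ((a + x) / 2), h0 a, h0 x]
      have h2 := (le_abs_self _).trans (hR _ hc x ⟨hax, hxb⟩)
      have h3 : |x - (a + b) / 2| ≤ b - a := abs_le.2 ⟨by linarith, by linarith⟩
      linarith [mul_le_mul_of_nonneg_left h3 hR0, h0 a, h0 b]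
    · rw [hg.zero_off x hx]
      linarith [h0 ((a + b) / 2), h0 a, h0 b]

/-- As g ≥ m and |g'| ≤ R inside the interval, log g is Lipschitz there with constant R / m. The
exponential form is the one that multiplies over many observations. -/
theorem BoundedSupportKernel.mul_exp_le (hg : BoundedSupportKernel a b g) :
    ∃ L ≥ (0 : ℝ), ∀ x ∈ Set.Ioo a b, ∀ y ∈ Set.Ioo a b,
      g x * Real.exp (-(L * |x - y|)) ≤ g y := by
  obtain ⟨R, hR0, hR⟩ := hg.abs_sub_le
  obtain ⟨m, hm, hgm⟩ := hg.pos_on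
  refine ⟨R / m, by positivity, fun x hx y hy => ?_⟩
  have hy' := hgm y (Set.Ioo_subset_Icc_self hy)
  have hgy : 0 < g y := hm.trans_le hy'
  rw [Real.exp_neg, ← div_eq_mul_inv, div_le_iff₀ (Real.exp_pos _)]
  have h1 := (le_abs_self _).trans (hR y hy x hx)
  have h2 : R * |x - y| ≤ g y * (R / m * |x - y|) := by
    calc R * |x - y| = m * (R / m * |x - y|) := by field_simp
      _ ≤ _ := mul_le_mul_of_nonneg_right hy' (by positivity)
  have h3 := mul_le_mul_of_nonneg_left (Real.add_one_le_exp (R / m * |x - y|)) hgy.le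
  linarith

theorem integrable_marginalLik (hg : BoundedSupportKernel a b g) (hab : a < b)
    (hq₀ : BoundedBaseDensity q₀) {n : ℕ} (x : Fin n → ℝ) (B : Finset (Fin n)) :
    Integrable fun θ => (∏ i ∈ B, g (x i - θ)) * q₀ θ := by
  obtain ⟨M, hM, hgM⟩ := hg.exists_bound hab
  refine hq₀.isDensity.integrable.bdd_mul (c := M ^ B.card) ?_ (ae_of_all _ fun θ => ?_)
  · exact (Finset.measurable_prod _ fun i _ =>
      hg.isDensity.measurable.comp (measurable_const.sub measurable_id)).aestronglyMeasurable
  · rw [Real.norm_of_nonneg (Finset.prod_nonneg fun i _ => hg.isDensity.nonneg _),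
      ← Finset.prod_const]
    exact Finset.prod_le_prod (fun i _ => hg.isDensity.nonneg _) fun i _ => hgM _

theorem marginalLik_integrand_nonneg (hg : BoundedSupportKernel a b g)
    (hq₀ : BoundedBaseDensity q₀) {n : ℕ} (x : Fin n → ℝ) (B : Finset (Fin n)) (θ : ℝ) :
    0 ≤ (∏ i ∈ B, g (x i - θ)) * q₀ θ :=
  mul_nonneg (Finset.prod_nonneg fun _ _ => hg.isDensity.nonneg _) (hq₀.isDensity.nonneg _)

theorem marginalLik_nonneg (hg : BoundedSupportKernel a b g) (hq₀ : BoundedBaseDensity q₀)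
    {n : ℕ} (x : Fin n → ℝ) (B : Finset (Fin n)) : 0 ≤ marginalLik g q₀ x B :=
  integral_nonneg (marginalLik_integrand_nonneg hg hq₀ x B)

theorem marginalLik_le_mul_erase (hg : BoundedSupportKernel a b g) (hab : a < b)
    (hq₀ : BoundedBaseDensity q₀) {M : ℝ} (hM : ∀ x, g x ≤ M) {n : ℕ} (x : Fin n → ℝ)
    {B : Finset (Fin n)} {i : Fin n} (hi : i ∈ B) :
    marginalLik g q₀ x B ≤ M * marginalLik g q₀ x (B.erase i) := by
  rw [marginalLik, marginalLik, ← integral_const_mul]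
  refine integral_mono (integrable_marginalLik hg hab hq₀ x B)
    ((integrable_marginalLik hg hab hq₀ x _).const_mul M) fun θ => ?_
  simp only
  rw [← Finset.mul_prod_erase B _ hi, mul_assoc]
  exact mul_le_mul_of_nonneg_right (hM _) (marginalLik_integrand_nonneg hg hq₀ x _ θ)

/-- The marginal likelihood of a single observation near an atom is bounded away from zero. -/
theorem exists_le_marginalLik_singleton (hg : BoundedSupportKernel a b g) (hab : a < b)
    (hq₀ : BoundedBaseDensity q₀) {θ₀ : ℝ}
    (h : ∃ L > (0 : ℝ), ∀ᶠ x in 𝓝 θ₀, L ≤ q₀ x) :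
    ∃ κ > (0 : ℝ), ∀ {n : ℕ} (x : Fin n → ℝ) (i : Fin n),
      x i ∈ Set.Ioo (θ₀ + a) (θ₀ + b) → κ ≤ marginalLik g q₀ x {i} := by
  obtain ⟨L, hL, hq⟩ := h
  obtain ⟨r, hr, hq⟩ := Metric.eventually_nhds_iff.1 hq
  obtain ⟨m, hm, hgm⟩ := hg.pos_on
  set ρ := min r ((b - a) / 2) with hρ
  have hρr : ρ ≤ r := min_le_left _ _
  have hρb : ρ ≤ (b - a) / 2 := min_le_right _ _
  have hρ0 : 0 < ρ := lt_min hr (by linarith)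
  refine ⟨m * L * ρ, by positivity, fun {n} x i hx => ?_⟩
  have key : ∀ u v : ℝ, v - u = ρ → θ₀ - ρ ≤ u → v ≤ θ₀ + ρ → x i - b ≤ u → v ≤ x i - a →
      m * L * ρ ≤ marginalLik g q₀ x {i} := by
    intro u v huv h1 h2 h3 h4
    rw [← huv]
    refine mul_le_integral_of_le_on_Ioo (integrable_marginalLik hg hab hq₀ x {i})
      (marginalLik_integrand_nonneg hg hq₀ x {i}) (by linarith) fun θ hθ => ?_
    rw [Finset.prod_singleton]
    refine mul_le_mul (hgm _ ⟨by linarith [hθ.2], by linarith [hθ.1]⟩) (hq ?_) hL.le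
      (hg.isDensity.nonneg _)
    rw [Real.dist_eq, abs_lt]
    exact ⟨by linarith [hθ.1], by linarith [hθ.2]⟩
  -- The parameters θ that can produce x_i form an interval of length b - a around the midpoint x_i
  -- - (a+b)/2, and θ₀ lies in it. It therefore extends at least (b - a)/2 from θ₀ on the side of
  -- the midpoint.
  rcases le_total (x i - (a + b) / 2) θ₀ with hle | hle
  · exact key (θ₀ - ρ) θ₀ (by ring) le_rfl (by linarith) (by linarith) (by linarith [hx.1])
  · exact key θ₀ (θ₀ + ρ) (by ring) (by linarith) le_rfl (by linarith [hx.2]) (by linarith)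

end Kernel

/-! ### Positivity of prior weights, joint densities and posterior probabilities. -/

theorem ascPochhammer_eval_eq_prod (α : ℝ) (n : ℕ) :
    (ascPochhammer ℝ n).eval α = ∏ i ∈ Finset.range n, (α + i) := by
  induction n with
  | zero => simp
  | succ n ih => rw [ascPochhammer_succ_eval, ih, Finset.prod_range_succ]

theorem ascPochhammer_eval_nonneg {α : ℝ} (hα : 0 ≤ α) (n : ℕ) :
    0 ≤ (ascPochhammer ℝ n).eval α := by
  rw [ascPochhammer_eval_eq_prod]
  exact Finset.prod_nonneg fun i _ => by positivity

theorem priorWeight_nonneg {π : Measure ℝ} (hπ : π (Set.Iic 0) = 0) (n : ℕ)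
    (P : Finset (Finset (Fin n))) : 0 ≤ priorWeight π n P := by
  refine integral_nonneg_of_ae ?_
  have : ∀ᵐ α ∂π, α ∉ Set.Iic (0 : ℝ) := measure_eq_zero_iff_ae_notMem.1 hπ
  filter_upwards [this] with α hα
  have hα : 0 ≤ α := (not_le.1 hα).le
  have := ascPochhammer_eval_nonneg hα n
  simp only [Pi.zero_apply]
  positivity

theorem jointDensity_nonneg {a b : ℝ} {g q₀ : ℝ → ℝ} (hg : BoundedSupportKernel a b g)
    (hq₀ : BoundedBaseDensity q₀) {π : Measure ℝ} (hπ : π (Set.Iic 0) = 0) {n : ℕ}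
    (x : Fin n → ℝ) (s : ℕ) : 0 ≤ jointDensity g q₀ π x s := by
  rw [jointDensity_eq]
  exact Finset.sum_nonneg fun P _ => mul_nonneg (priorWeight_nonneg hπ n P)
    (Finset.prod_nonneg fun B _ => marginalLik_nonneg hg hq₀ x B)

theorem posteriorClusters_nonneg {a b : ℝ} {g q₀ : ℝ → ℝ} (hg : BoundedSupportKernel a b g)
    (hq₀ : BoundedBaseDensity q₀) {π : Measure ℝ} (hπ : π (Set.Iic 0) = 0) {n : ℕ}
    (x : Fin n → ℝ) (s : ℕ) : 0 ≤ posteriorClusters g q₀ π x s :=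
  div_nonneg (jointDensity_nonneg hg hq₀ hπ x s)
    (Finset.sum_nonneg fun r _ => jointDensity_nonneg hg hq₀ hπ x r)

/-! ### Splitting off singletons -/

theorem split_mem_setPartitions {ι : Type*} [DecidableEq ι] {T : Finset ι}
    {P : Finset (Finset ι)} (hP : P ∈ setPartitions T) {B : Finset ι} (hB : B ∈ P)
    (h2 : 2 ≤ B.card) {i : ι} (hi : i ∈ B) :
    insert {i} (insert (B.erase i) (P.erase B)) ∈ setPartitions T ∧
      B.erase i ∉ P.erase B ∧ {i} ∉ insert (B.erase i) (P.erase B) := by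
  have hBT := subset_of_mem_setPartitions hP hB
  have h1 := erase_mem_setPartitions hP hB
  have hne : (B.erase i).Nonempty := by
    rw [← Finset.card_pos, Finset.card_erase_of_mem hi]
    omega
  obtain ⟨h3, h4⟩ := insert_mem_setPartitions h1 hne
    (Finset.disjoint_sdiff.mono_left (Finset.erase_subset i B))
  have hdis : Disjoint {i} (B.erase i ∪ T \ B) := by
    simp [hi]
  obtain ⟨h5, h6⟩ := insert_mem_setPartitions h3 (Finset.singleton_nonempty i) hdis
  refine ⟨?_, h4, h6⟩
  convert h5 using 2
  ext k
  simp only [Finset.mem_union, Finset.mem_singleton, Finset.mem_erase, Finset.mem_sdiff]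
  by_cases hk : k = i
  · simp [hk, hBT hi]
  · by_cases hkB : k ∈ B
    · simp [hkB, hk, hBT hkB]
    · simp [hkB, hk]

theorem priorWeight_dirac (α : ℝ) (n : ℕ) (P : Finset (Finset (Fin n))) :
    priorWeight (Measure.dirac α) n P = α ^ P.card / (ascPochhammer ℝ n).eval α *
      ∏ B ∈ P, (Nat.factorial (B.card - 1) : ℝ) := by
  rw [priorWeight, integral_dirac]

variable {a b : ℝ} {g q₀ : ℝ → ℝ}

/-- Detaching i from B multiplies the prior weight by α / (|B| - 1). The likelihood loses at most
the factor M for the removed observation and gains at least κ for the new singleton. The factor |B|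
on the right is harmless: the bound is summed over i in B. -/
theorem split_weight_le (hg : BoundedSupportKernel a b g) (hab : a < b)
    (hq₀ : BoundedBaseDensity q₀) {M : ℝ} (hM0 : 0 < M) (hM : ∀ x, g x ≤ M) {α κ : ℝ}
    (hα : 0 < α) {n : ℕ} (x : Fin n → ℝ)
    (hx : ∀ i, κ ≤ marginalLik g q₀ x {i}) (hκ : 0 ≤ κ) {P : Finset (Finset (Fin n))}
    (hP : P ∈ setPartitions Finset.univ) {B : Finset (Fin n)} (hB : B ∈ P) (h2 : 2 ≤ B.card)
    {i : Fin n} (hi : i ∈ B) :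
    α * κ / M * (priorWeight (Measure.dirac α) n P * ∏ B ∈ P, marginalLik g q₀ x B) ≤
      B.card * (priorWeight (Measure.dirac α) n (insert {i} (insert (B.erase i) (P.erase B))) *
        ∏ B' ∈ insert {i} (insert (B.erase i) (P.erase B)), marginalLik g q₀ x B') := by
  obtain ⟨-, h4, h5⟩ := split_mem_setPartitions hP hB h2 hi
  have hcP : (P.erase B).card + 1 = P.card := Finset.card_erase_add_one hB
  rw [priorWeight_dirac, priorWeight_dirac, Finset.prod_insert h5, Finset.prod_insert h4,
    Finset.prod_insert h5, Finset.prod_insert h4, Finset.card_insert_of_notMem h5,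
    Finset.card_insert_of_notMem h4, hcP, Finset.card_erase_of_mem hi, Finset.card_singleton,
    ← Finset.mul_prod_erase P _ hB, ← Finset.mul_prod_erase P (marginalLik g q₀ x) hB]
  set F : ℝ := ∏ B' ∈ P.erase B, (Nat.factorial (B'.card - 1) : ℝ)
  set W : ℝ := ∏ B' ∈ P.erase B, marginalLik g q₀ x B'
  have hF : 0 ≤ F := Finset.prod_nonneg fun _ _ => by positivity
  have hW : 0 ≤ W := Finset.prod_nonneg fun _ _ => marginalLik_nonneg hg hq₀ x _
  have hA := ascPochhammer_eval_nonneg hα.le n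
  have hm := marginalLik_le_mul_erase hg hab hq₀ hM x hi
  have hm0 := marginalLik_nonneg hg hq₀ x (B.erase i)
  obtain ⟨k, hk⟩ : ∃ k, B.card = k + 2 := ⟨B.card - 2, by omega⟩
  rw [hk]
  simp only [Nat.add_sub_cancel, show k + 2 - 1 = k + 1 by omega, show 1 - 1 = 0 by rfl,
    Nat.factorial_zero, Nat.factorial_succ, pow_succ]
  push_cast
  set E := α ^ P.card / (ascPochhammer ℝ n).eval α * F * W * (k.factorial : ℝ) * α with hE
  have hE0 : 0 ≤ E := by positivity
  have h6 : κ * (marginalLik g q₀ x B / M) ≤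
      marginalLik g q₀ x {i} * marginalLik g q₀ x (B.erase i) := by
    refine mul_le_mul (hx i) ?_ (div_nonneg (marginalLik_nonneg hg hq₀ x B) hM0.le)
      (hκ.trans (hx i))
    rw [div_le_iff₀ hM0]
    linarith
  calc _ = E * ((k : ℝ) + 1) * (κ * (marginalLik g q₀ x B / M)) := by
        rw [hE]
        ring
    _ ≤ E * ((k : ℝ) + 2) *
        (marginalLik g q₀ x {i} * marginalLik g q₀ x (B.erase i)) := by
        gcongr
        · exact mul_nonneg hκ (div_nonneg (marginalLik_nonneg hg hq₀ x B) hM0.le)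
        · norm_num
    _ = _ := by
        rw [hE]
        ring

/-- For a fixed concentration parameter, `t + 1` clusters are at least as likely as `t` clusters,
up to a constant. -/
theorem mul_jointDensity_le_jointDensity_succ (hg : BoundedSupportKernel a b g) (hab : a < b)
    (hq₀ : BoundedBaseDensity q₀) {M : ℝ} (hM0 : 0 < M) (hM : ∀ x, g x ≤ M) {α κ : ℝ}
    (hα : 0 < α) {n : ℕ} (x : Fin n → ℝ)
    (hx : ∀ i, κ ≤ marginalLik g q₀ x {i}) (hκ : 0 ≤ κ) {t : ℕ} (htn : t < n) :
    α * κ / M * jointDensity g q₀ (Measure.dirac α) x t ≤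
      (t + 1) ^ 2 * jointDensity g q₀ (Measure.dirac α) x (t + 1) := by
  classical
  have hdir : (Measure.dirac α) (Set.Iic (0 : ℝ)) = 0 := by simp [hα]
  rw [jointDensity_eq, jointDensity_eq]
  set w : Finset (Finset (Fin n)) → ℝ := fun P =>
    priorWeight (Measure.dirac α) n P * ∏ B ∈ P, marginalLik g q₀ x B with hw
  have hw0 : ∀ P, 0 ≤ w P := fun P => mul_nonneg (priorWeight_nonneg hdir n P)
    (Finset.prod_nonneg fun B _ => marginalLik_nonneg hg hq₀ x B)
  have hex : ∀ P ∈ setPartitionsInto (Finset.univ : Finset (Fin n)) t,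
      ∃ B ∈ P, 2 ≤ B.card := by
    intro P hP
    obtain ⟨hP, hc⟩ := mem_setPartitionsInto.1 hP
    by_contra! hcon
    have h1 := sum_card_of_mem_setPartitions hP
    have h2 : ∑ B ∈ P, B.card ≤ ∑ B ∈ P, 1 :=
      Finset.sum_le_sum fun B hB => Nat.lt_succ_iff.1 (hcon B hB)
    rw [Finset.sum_const, h1, hc, Finset.card_univ, Fintype.card_fin] at h2
    simp at h2
    omega
  -- One block with at least two elements is fixed in each partition; it exists because t < n.
  choose! β hβ hβ2 using hex
  calc _ ≤ ∑ P ∈ setPartitionsInto (Finset.univ : Finset (Fin n)) t,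
        ∑ i ∈ β P, α * κ / M * w P / (β P).card := by
        rw [Finset.mul_sum]
        refine Finset.sum_le_sum fun P hP => ?_
        have : ((β P).card : ℝ) ≠ 0 := by
          have := hβ2 P hP
          positivity
        rw [Finset.sum_const, nsmul_eq_mul, mul_div_cancel₀ _ this]
    _ ≤ ∑ P ∈ setPartitionsInto (Finset.univ : Finset (Fin n)) (t + 1),
        ∑ _y ∈ P ×ˢ P, w P := by
        rw [Finset.sum_sigma', Finset.sum_sigma']
        -- The new partition is recorded with the ordered pair formed by the singleton {i} and the
        -- rest of the split block. The pair determines i and the split block, hence P. There are at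
        -- most (t + 1)² such pairs in a partition into t + 1 blocks, which is the constant in the
        -- statement.
        refine sum_le_sum_of_injOn (fun y => ⟨insert {y.2} (insert ((β y.1).erase y.2)
          (y.1.erase (β y.1))), ({y.2}, (β y.1).erase y.2)⟩) ?_ ?_ ?_ ?_
        · rintro ⟨P, i⟩ h
          simp only [Finset.mem_sigma] at h
          have hP := (mem_setPartitionsInto.1 h.1)
          obtain ⟨h3, h4, h5⟩ := split_mem_setPartitions hP.1 (hβ P h.1) (hβ2 P h.1) h.2
          simp only [Finset.mem_sigma, mem_setPartitionsInto, Finset.mem_product]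
          refine ⟨⟨h3, ?_⟩, Finset.mem_insert_self _ _,
            Finset.mem_insert_of_mem (Finset.mem_insert_self _ _)⟩
          rw [Finset.card_insert_of_notMem h5, Finset.card_insert_of_notMem h4,
            Finset.card_erase_add_one (hβ P h.1), hP.2]
        · rintro ⟨P, i⟩ h ⟨P', i'⟩ h' heq
          simp only [Finset.coe_sigma, Set.mem_sigma_iff, Finset.mem_coe] at h h'
          simp only [Sigma.mk.injEq, heq_eq_eq, Prod.mk.injEq, Finset.singleton_inj] at heq
          obtain ⟨h1, rfl, h2⟩ := heq
          have hP := (mem_setPartitionsInto.1 h.1).1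
          have hP' := (mem_setPartitionsInto.1 h'.1).1
          obtain ⟨-, h4, h5⟩ := split_mem_setPartitions hP (hβ P h.1) (hβ2 P h.1) h.2
          obtain ⟨-, h4', h5'⟩ := split_mem_setPartitions hP' (hβ P' h'.1) (hβ2 P' h'.1) h'.2
          have hββ : β P = β P' := by
            rw [← Finset.insert_erase h.2, h2, Finset.insert_erase h'.2]
          have h6 : insert ((β P).erase i) (P.erase (β P)) =
              insert ((β P').erase i) (P'.erase (β P')) := by
            rw [← Finset.erase_insert h5, h1, Finset.erase_insert h5']
          have h7 : P.erase (β P) = P'.erase (β P') := by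
            rw [← Finset.erase_insert h4, h6, h2, Finset.erase_insert h4']
          have h8 : P = P' := by
            rw [← Finset.insert_erase (hβ P h.1), h7, hββ, Finset.insert_erase (hβ P' h'.1)]
          subst h8
          rfl
        · rintro ⟨P, i⟩ h
          simp only [Finset.mem_sigma] at h
          have hP := (mem_setPartitionsInto.1 h.1).1
          have := hβ2 P h.1
          rw [div_le_iff₀ (by positivity), mul_comm (w _)]
          exact split_weight_le hg hab hq₀ hM0 hM hα x hx hκ hP (hβ P h.1) this h.2
        · rintro ⟨P, y⟩ -
          exact hw0 P
    _ = _ := by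
        rw [Finset.mul_sum]
        refine Finset.sum_congr rfl fun P hP => ?_
        rw [Finset.sum_const, Finset.card_product, (mem_setPartitionsInto.1 hP).2, nsmul_eq_mul]
        push_cast
        ring

/-- With J_{t+1} ≥ κ' J_t, the total mass is at least (1 + κ') J_t. -/
theorem posteriorClusters_dirac_le (hg : BoundedSupportKernel a b g) (hab : a < b)
    (hq₀ : BoundedBaseDensity q₀) {M : ℝ} (hM0 : 0 < M) (hM : ∀ x, g x ≤ M) {α κ : ℝ}
    (hα : 0 < α) {n : ℕ} (x : Fin n → ℝ)
    (hx : ∀ i, κ ≤ marginalLik g q₀ x {i}) (hκ : 0 < κ) {t : ℕ} (htn : t < n) :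
    posteriorClusters g q₀ (Measure.dirac α) x t ≤
      1 / (1 + α * κ / M / (t + 1) ^ 2) := by
  have hdir : (Measure.dirac α) (Set.Iic (0 : ℝ)) = 0 := by simp [hα]
  have h1 := mul_jointDensity_le_jointDensity_succ hg hab hq₀ hM0 hM hα x hx hκ.le htn
  have hJ := fun s => jointDensity_nonneg hg hq₀ hdir x s
  set κ' := α * κ / M / (t + 1) ^ 2 with hκ'
  have hκ'0 : 0 < κ' := by positivity
  have h2 : κ' * jointDensity g q₀ (Measure.dirac α) x t ≤
      jointDensity g q₀ (Measure.dirac α) x (t + 1) := by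
    rw [hκ', div_mul_eq_mul_div, div_le_iff₀ (by positivity)]
    linarith
  have h3 : jointDensity g q₀ (Measure.dirac α) x t +
      jointDensity g q₀ (Measure.dirac α) x (t + 1) ≤
      ∑ r ∈ Finset.range (n + 1), jointDensity g q₀ (Measure.dirac α) x r := by
    rw [← Finset.sum_pair (f := fun r => jointDensity g q₀ (Measure.dirac α) x r)
      (Nat.succ_ne_self t).symm]
    refine Finset.sum_le_sum_of_subset_of_nonneg (fun r hr => ?_) fun r _ _ => hJ r
    simp only [Finset.mem_insert, Finset.mem_singleton] at hr
    rw [Finset.mem_range]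
    omega
  rw [posteriorClusters]
  rcases (hJ t).eq_or_lt with h0 | h0
  · rw [← h0, zero_div]
    positivity
  · rw [div_le_div_iff₀ (by linarith [hJ (t + 1)]) (by positivity)]
    nlinarith

/-! ### The true mixture -/

/-- Open intervals are wanted because the regularity of g is assumed only inside (a, b); the
endpoints are Lebesgue-null. -/
theorem ae_mixture_mem (hg : BoundedSupportKernel a b g) {t : ℕ} (p θ : Fin t → ℝ) :
    ∀ᵐ x ∂mixture g p θ, ∃ j, x ∈ Set.Ioo (θ j + a) (θ j + b) := by
  have hgm := hg.isDensity.measurable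
  rw [mixture, ← Measure.sum_fintype, Measure.ae_sum_iff]
  intro j
  refine Measure.ae_smul_measure ?_ _
  rw [ae_withDensity_iff (by fun_prop)]
  have h1 : ∀ᵐ x : ℝ, x ≠ θ j + a := Measure.ae_ne volume _
  have h2 : ∀ᵐ x : ℝ, x ≠ θ j + b := Measure.ae_ne volume _
  filter_upwards [h1, h2] with x hxa hxb hx
  have h3 : x - θ j ∈ Set.Icc a b := by
    by_contra h
    rw [hg.zero_off _ h] at hx
    simp at hx
  exact ⟨j, lt_of_le_of_ne (by linarith [h3.1]) hxa.symm, lt_of_le_of_ne (by linarith [h3.2]) hxb⟩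

theorem IsIIDSample.ae_forall_mem (hg : BoundedSupportKernel a b g) {t : ℕ} {p θ : Fin t → ℝ}
    {Ω : Type*} [MeasurableSpace Ω] {μ : Measure Ω} {X : ℕ → Ω → ℝ}
    (hX : IsIIDSample μ X (mixture g p θ)) :
    ∀ᵐ ω ∂μ, ∀ i, ∃ j, X i ω ∈ Set.Ioo (θ j + a) (θ j + b) := by
  rw [ae_all_iff]
  intro i
  have h := ae_mixture_mem hg p θ
  rw [← hX.law i] at h
  exact ae_of_ae_map (hX.measurable i).aemeasurable h

/-! ### Inconsistency for a fixed concentration parameter. -/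

/-- Almost surely every observation lies in the open support of a component, so every singleton has
marginal likelihood at least a common κ₀. The posterior bound then holds for all n > t at once, and
gives both assertions. -/
theorem fixed_concentration_inconsistent (hab : a < b) (hg : BoundedSupportKernel a b g)
    (hq₀ : BoundedBaseDensity q₀) {α : ℝ} (hα : 0 < α) {t : ℕ} {p θ : Fin t → ℝ}
    (hP : AdmissibleTruth a b q₀ p θ) :
    ∃ c < (1 : ℝ), ∀ (Ω : Type*) [MeasurableSpace Ω] (μ : Measure Ω) [IsProbabilityMeasure μ]
      (X : ℕ → Ω → ℝ), IsIIDSample μ X (mixture g p θ) →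
      Tendsto (fun n : ℕ => μ {ω | c < posteriorClusters g q₀
        (Measure.dirac α) (fun i : Fin n => X i ω) t}) atTop (𝓝 0) ∧
      ∀ᵐ ω ∂μ, limsup (fun n : ℕ => posteriorClusters g q₀
        (Measure.dirac α) (fun i : Fin n => X i ω) t) atTop ≤ c := by
  obtain ⟨M, hM0, hM⟩ := hg.exists_bound hab
  choose κ hκ0 hκ using fun j => exists_le_marginalLik_singleton hg hab hq₀ (hP.base_pos_near j)
  obtain ⟨κ₀, hκ₀⟩ : ∃ κ₀ : ℝ, 0 < κ₀ ∧ ∀ j, κ₀ ≤ κ j := by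
    have h : ∀ᶠ y in 𝓝[>] (0 : ℝ), 0 < y ∧ ∀ j, y ≤ κ j :=
      (eventually_mem_nhdsWithin (s := Set.Ioi (0 : ℝ))).and (eventually_all.2 fun j =>
        mem_nhdsWithin_of_mem_nhds (Iic_mem_nhds (hκ0 j)))
    exact h.exists
  refine ⟨1 / (1 + α * κ₀ / M / (t + 1) ^ 2), ?_, ?_⟩
  · rw [div_lt_one (by have := hκ₀.1; positivity)]
    have : 0 < α * κ₀ / M / ((t : ℝ) + 1) ^ 2 := by have := hκ₀.1; positivity
    linarith
  · intro Ω _ μ _ X hX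
    have hdir : (Measure.dirac α) (Set.Iic (0 : ℝ)) = 0 := by simp [hα]
    have key : ∀ᵐ ω ∂μ, ∀ n : ℕ, t < n → posteriorClusters g q₀ (Measure.dirac α)
        (fun i : Fin n => X i ω) t ≤ 1 / (1 + α * κ₀ / M / (t + 1) ^ 2) := by
      filter_upwards [hX.ae_forall_mem hg] with ω hω n hn
      refine posteriorClusters_dirac_le hg hab hq₀ hM0 hM hα _ (fun i => ?_) hκ₀.1 hn
      obtain ⟨j, hj⟩ := hω i
      exact (hκ₀.2 j).trans (hκ j _ _ hj)
    constructor
    · refine tendsto_const_nhds.congr' ?_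
      filter_upwards [eventually_gt_atTop t] with n hn
      symm
      rw [measure_eq_zero_iff_ae_notMem]
      filter_upwards [key] with ω hω
      simpa using hω n hn
    · filter_upwards [key] with ω hω
      refine limsup_le_of_le ?_ ?_
      · exact IsBoundedUnder.isCoboundedUnder_le
          (isBoundedUnder_of ⟨0, fun n => posteriorClusters_nonneg hg hq₀ hdir _ _⟩)
      · filter_upwards [eventually_gt_atTop t] with n hn using hω n hn

/-! ### Expectations of products over blocks -/

section Blocks

variable {n : ℕ} {Ω : Type*} [MeasurableSpace Ω] {μ : Measure Ω} {X : Fin n → Ω → ℝ}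
  {ν : Measure ℝ} [SFinite ν] {G : Fin n → ℝ → ℝ → ENNReal}

theorem measurable_lintegral_prod_block (hG : ∀ i, Measurable (Function.uncurry (G i)))
    (B : Finset (Fin n)) :
    Measurable fun z : Fin n → ℝ => ∫⁻ θ, ∏ i ∈ B, G i (z i) θ ∂ν := by
  refine Measurable.lintegral_prod_right' (f := fun q : (Fin n → ℝ) × ℝ =>
    ∏ i ∈ B, G i (q.1 i) q.2) ?_
  refine Finset.measurable_prod _ fun i _ => ?_
  have h : Measurable fun q : (Fin n → ℝ) × ℝ => (q.1 i, q.2) := by fun_prop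
  exact (hG i).comp h

/-- Functions that depend on disjoint sets of independent coordinates are independent. -/
theorem indepFun_of_disjoint_support (hX : iIndepFun X μ) (hXm : ∀ i, Measurable (X i))
    {S T : Finset (Fin n)} (hST : Disjoint S T) {φ ψ : (Fin n → ℝ) → ENNReal}
    (hφ : Measurable φ) (hψ : Measurable ψ)
    (hφS : ∀ z z' : Fin n → ℝ, (∀ i ∈ S, z i = z' i) → φ z = φ z')
    (hψT : ∀ z z' : Fin n → ℝ, (∀ i ∈ T, z i = z' i) → ψ z = ψ z') :
    IndepFun (fun ω => φ fun i => X i ω) (fun ω => ψ fun i => X i ω) μ := by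
  classical
  let ext : ∀ S : Finset (Fin n), (S → ℝ) → Fin n → ℝ :=
    fun S z i => if h : i ∈ S then z ⟨i, h⟩ else 0
  have hext : ∀ S, Measurable (ext S) := by
    intro S
    refine measurable_pi_lambda _ fun i => ?_
    by_cases h : i ∈ S
    · simp only [ext, h, dite_true]
      exact measurable_pi_apply _
    · simp only [ext, h, dite_false]
      exact measurable_const
  have h := (hX.indepFun_finset S T hST hXm).comp (hφ.comp (hext S)) (hψ.comp (hext T))
  convert h using 1
  · ext ω
    exact hφS _ _ fun i hi => by simp [ext, hi]
  · ext ω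
    exact hψT _ _ fun i hi => by simp [ext, hi]

/-- Distinct blocks involve disjoint sets of independent observations, so the mean of the product
factorises over the blocks. Within a block the parameter integral comes out by Tonelli, and for
fixed θ independence applies once more. -/
theorem lintegral_prod_blocks [IsProbabilityMeasure μ] (hX : iIndepFun X μ)
    (hXm : ∀ i, Measurable (X i)) (hG : ∀ i, Measurable (Function.uncurry (G i)))
    (P : Finset (Finset (Fin n))) (hP : (P : Set (Finset (Fin n))).PairwiseDisjoint id) :
    ∫⁻ ω, ∏ B ∈ P, ∫⁻ θ, ∏ i ∈ B, G i (X i ω) θ ∂ν ∂μ =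
      ∏ B ∈ P, ∫⁻ θ, ∏ i ∈ B, ∫⁻ ω, G i (X i ω) θ ∂μ ∂ν := by
  induction P using Finset.induction_on with
  | empty => simp
  | insert B Q hBQ ih =>
    simp_rw [Finset.prod_insert hBQ]
    rw [Finset.coe_insert] at hP
    have hQ := hP.subset (Set.subset_insert _ _)
    have hXvec : Measurable fun ω => fun i => X i ω := measurable_pi_lambda _ hXm
    have hmB := measurable_lintegral_prod_block (ν := ν) hG
    have hdis : Disjoint B (Q.sup id) := by
      rw [Finset.disjoint_sup_right]
      intro B' hB'
      exact hP (Set.mem_insert _ _) (Set.mem_insert_of_mem _ hB') fun h => hBQ (h ▸ hB')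
    have hind : IndepFun (fun ω => ∫⁻ θ, ∏ i ∈ B, G i (X i ω) θ ∂ν)
        (fun ω => ∏ B' ∈ Q, ∫⁻ θ, ∏ i ∈ B', G i (X i ω) θ ∂ν) μ := by
      refine indepFun_of_disjoint_support hX hXm hdis
        (φ := fun z => ∫⁻ θ, ∏ i ∈ B, G i (z i) θ ∂ν)
        (ψ := fun z => ∏ B' ∈ Q, ∫⁻ θ, ∏ i ∈ B', G i (z i) θ ∂ν)
        (hmB B) (Finset.measurable_prod _ fun B' _ => hmB B') ?_ ?_
      · intro z z' h
        refine lintegral_congr fun θ => Finset.prod_congr rfl fun i hi => ?_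
        rw [h i hi]
      · intro z z' h
        refine Finset.prod_congr rfl fun B' hB' => lintegral_congr fun θ =>
          Finset.prod_congr rfl fun i hi => ?_
        rw [h i (Finset.mem_sup.2 ⟨B', hB', hi⟩)]
    have hm1 : Measurable fun ω => ∫⁻ θ, ∏ i ∈ B, G i (X i ω) θ ∂ν := (hmB B).comp hXvec
    have hm2 : Measurable fun ω => ∏ B' ∈ Q, ∫⁻ θ, ∏ i ∈ B', G i (X i ω) θ ∂ν :=
      (Finset.measurable_prod Q fun B' _ => hmB B').comp hXvec
    rw [lintegral_mul_eq_lintegral_mul_lintegral_of_indepFun'' hm1.aemeasurable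
      hm2.aemeasurable hind, ih hQ]
    congr 1
    rw [lintegral_lintegral_swap]
    · refine lintegral_congr fun θ => ?_
      have hGθ : ∀ i, Measurable fun x => G i x θ := fun i => (hG i).of_uncurry_right
      exact lintegral_prod_eq_prod_lintegral_of_indepFun B (fun i ω => G i (X i ω) θ)
        (hX.comp (fun i x => G i x θ) hGθ) fun i => (hGθ i).comp (hXm i)
    · refine Measurable.aemeasurable ?_
      refine Finset.measurable_prod _ fun i _ => ?_
      have h : Measurable fun q : Ω × ℝ => (X i q.1, q.2) :=
        ((hXm i).comp measurable_fst).prodMk measurable_snd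
      exact (hG i).comp h

end Blocks

/-! ### The density of the mixture -/

/-- The density of the mixture `∑ j, p_j R_j`. -/
noncomputable def mixtureDensity (g : ℝ → ℝ) {t : ℕ} (p θ : Fin t → ℝ) (x : ℝ) : ENNReal :=
  ∑ j, ENNReal.ofReal (p j) * ENNReal.ofReal (g (x - θ j))

theorem measurable_mixtureDensity {g : ℝ → ℝ} (hg : Measurable g) {t : ℕ} (p θ : Fin t → ℝ) :
    Measurable (mixtureDensity g p θ) := by
  unfold mixtureDensity
  fun_prop

theorem mixture_eq_withDensity {g : ℝ → ℝ} (hg : Measurable g) {t : ℕ} (p θ : Fin t → ℝ) :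
    mixture g p θ = volume.withDensity (mixtureDensity g p θ) := by
  ext s hs
  rw [mixture, withDensity_apply _ hs, Measure.finsetSum_apply]
  unfold mixtureDensity
  rw [lintegral_finsetSum _ fun j _ => by fun_prop]
  refine Finset.sum_congr rfl fun j _ => ?_
  rw [Measure.smul_apply, withDensity_apply _ hs, lintegral_const_mul _ (by fun_prop), smul_eq_mul]

/-- The change of measure that removes the true density. It is an inequality because H may vanish,
and then H · H⁻¹ = 0. -/
theorem lintegral_mul_inv_density_le {H u : ℝ → ENNReal} (hH : Measurable H)
    (hu : Measurable u) :
    ∫⁻ x, u x * (H x)⁻¹ ∂(volume.withDensity H) ≤ ∫⁻ x, u x := by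
  have hm : Measurable fun x => u x * (H x)⁻¹ := hu.mul hH.inv
  rw [lintegral_withDensity_eq_lintegral_mul _ hH hm]
  refine lintegral_mono fun x => ?_
  simp only [Pi.mul_apply]
  calc H x * (u x * (H x)⁻¹) = u x * (H x * (H x)⁻¹) := by ring
    _ ≤ u x * 1 := by gcongr; exact ENNReal.mul_inv_le_one _
    _ = u x := mul_one _

/-! ### Probability that a shifted kernel hits the support of a component -/

theorem lintegral_exp_neg_mul_abs_sub_le {r : ℝ} (hr : 0 < r) (θ₀ : ℝ) :
    ∫⁻ θ, ENNReal.ofReal (Real.exp (-(r * |θ - θ₀|))) ≤ ENNReal.ofReal (2 / r) := by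
  rw [lintegral_sub_right_eq_self (fun y : ℝ => ENNReal.ofReal (Real.exp (-(r * |y|)))) θ₀,
    ← lintegral_add_compl _ (measurableSet_Iic (a := (0 : ℝ))), Set.compl_Iic]
  have h1 : ∫⁻ y in Set.Iic (0 : ℝ), ENNReal.ofReal (Real.exp (-(r * |y|))) =
      ENNReal.ofReal (1 / r) := by
    rw [setLIntegral_congr_fun measurableSet_Iic (g := fun y => ENNReal.ofReal (Real.exp (r * y))),
      ← ofReal_integral_eq_lintegral_ofReal (integrableOn_exp_mul_Iic hr 0)
        (ae_of_all _ fun _ => (Real.exp_pos _).le), integral_exp_mul_Iic hr]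
    · simp
    · intro y hy
      simp only
      rw [abs_of_nonpos hy]
      ring_nf
  have h2 : ∫⁻ y in Set.Ioi (0 : ℝ), ENNReal.ofReal (Real.exp (-(r * |y|))) =
      ENNReal.ofReal (1 / r) := by
    rw [setLIntegral_congr_fun measurableSet_Ioi
        (g := fun y => ENNReal.ofReal (Real.exp (-r * y))),
      ← ofReal_integral_eq_lintegral_ofReal (integrableOn_exp_mul_Ioi (neg_lt_zero.2 hr) 0)
        (ae_of_all _ fun _ => (Real.exp_pos _).le), integral_exp_mul_Ioi (neg_lt_zero.2 hr)]
    · simp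
    · intro y hy
      simp only
      rw [abs_of_pos hy]
      ring_nf
  rw [h1, h2, ← ENNReal.ofReal_add (by positivity) (by positivity)]
  exact ENNReal.ofReal_le_ofReal (by ring_nf; rfl)

/-- The probability that an observation with parameter `θ` falls in `(θ₀ + a, θ₀ + b)`. -/
noncomputable def hitProb (a b : ℝ) (g : ℝ → ℝ) (θ₀ θ : ℝ) : ENNReal :=
  ∫⁻ x in Set.Ioo (θ₀ + a) (θ₀ + b), ENNReal.ofReal (g (x - θ))

section Hit

variable {a b : ℝ} {g q₀ : ℝ → ℝ}

theorem IsDensity.lintegral_shift (hg : IsDensity g) (θ : ℝ) :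
    ∫⁻ x, ENNReal.ofReal (g (x - θ)) = 1 := by
  rw [lintegral_sub_right_eq_self (fun y : ℝ => ENNReal.ofReal (g y)) θ, hg.lintegral_eq_one]

/-- The shifted kernel has total mass 1 and is at least m on its support, so any part (u, v) of the
support that S misses costs S at least m (v - u). -/
theorem setLIntegral_add_le_one (hg : BoundedSupportKernel a b g) {m : ℝ}
    (hm0 : 0 ≤ m) (hm : ∀ x ∈ Set.Icc a b, m ≤ g x) (θ : ℝ) {S : Set ℝ} (hS : MeasurableSet S) {u v : ℝ}
    (hu : θ + a ≤ u) (hv : v ≤ θ + b) (hd : Disjoint S (Set.Ioo u v)) :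
    (∫⁻ x in S, ENNReal.ofReal (g (x - θ))) + ENNReal.ofReal (m * (v - u)) ≤ 1 := by
  have htot := lintegral_add_compl (fun x => ENNReal.ofReal (g (x - θ))) hS (μ := volume)
  rw [hg.isDensity.lintegral_shift θ] at htot
  refine le_trans (add_le_add le_rfl ?_) htot.le
  calc ENNReal.ofReal (m * (v - u)) ≤ ∫⁻ _ in Set.Ioo u v, ENNReal.ofReal m := by
        rw [setLIntegral_const, Real.volume_Ioo]
        rw [ENNReal.ofReal_mul hm0]
    _ ≤ ∫⁻ x in Set.Ioo u v, ENNReal.ofReal (g (x - θ)) := by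
        refine setLIntegral_mono' measurableSet_Ioo fun x hx => ENNReal.ofReal_le_ofReal (hm _ ?_)
        exact ⟨by linarith [hx.1], by linarith [hx.2]⟩
    _ ≤ _ := lintegral_mono_set hd.symm.subset_compl_right

theorem hitProb_eq_zero (hg : BoundedSupportKernel a b g) {θ₀ θ : ℝ} (h : b - a ≤ |θ - θ₀|) :
    hitProb a b g θ₀ θ = 0 := by
  rw [hitProb, setLIntegral_congr_fun measurableSet_Ioo (g := fun _ => 0), lintegral_zero]
  intro x hx
  simp only
  rw [hg.zero_off, ENNReal.ofReal_zero]
  rintro ⟨h1, h2⟩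
  rcases le_abs.1 h with h | h
  · linarith [hx.1, hx.2]
  · linarith [hx.1, hx.2]

theorem hitProb_le_one (hg : BoundedSupportKernel a b g) (θ₀ θ : ℝ) :
    hitProb a b g θ₀ θ ≤ 1 := by
  rw [← hg.isDensity.lintegral_shift θ]
  exact setLIntegral_le_lintegral _ _

theorem measurable_hitProb (hg : BoundedSupportKernel a b g) (θ₀ : ℝ) :
    Measurable (hitProb a b g θ₀) := by
  refine Measurable.lintegral_prod_right' (f := fun q : ℝ × ℝ => ENNReal.ofReal (g (q.2 - q.1))) ?_
  exact (hg.isDensity.measurable.comp (measurable_snd.sub measurable_fst)).ennreal_ofReal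

/-- Shifting the parameter by |θ - θ₀| pushes a piece of that length of the kernel's support out of
the target interval, leaving at most 1 - m |θ - θ₀|, which is below the exponential. For shifts of
length b - a or more the probability is zero. -/
theorem hitProb_le_exp (hg : BoundedSupportKernel a b g) {m : ℝ} (hm0 : 0 < m)
    (hm : ∀ x ∈ Set.Icc a b, m ≤ g x) (θ₀ θ : ℝ) :
    hitProb a b g θ₀ θ ≤ ENNReal.ofReal (Real.exp (-(m * |θ - θ₀|))) := by
  rcases le_total (b - a) |θ - θ₀| with h | h
  · rw [hitProb_eq_zero hg h]
    exact zero_le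
  have key : hitProb a b g θ₀ θ + ENNReal.ofReal (m * |θ - θ₀|) ≤ 1 := by
    rcases le_total θ₀ θ with h' | h'
    · rw [abs_of_nonneg (sub_nonneg.2 h')] at h ⊢
      have := setLIntegral_add_le_one hg hm0.le hm θ (measurableSet_Ioo (a := θ₀ + a) (b := θ₀ + b))
        (u := θ₀ + b) (v := θ + b) (by linarith) le_rfl
        (Set.disjoint_left.2 fun x hx hx' => by linarith [hx.2, hx'.1])
      rwa [show θ + b - (θ₀ + b) = θ - θ₀ by ring] at this
    · rw [abs_of_nonpos (sub_nonpos.2 h')] at h ⊢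
      have := setLIntegral_add_le_one hg hm0.le hm θ (measurableSet_Ioo (a := θ₀ + a) (b := θ₀ + b))
        (u := θ + a) (v := θ₀ + a) le_rfl (by linarith)
        (Set.disjoint_left.2 fun x hx hx' => by linarith [hx.1, hx'.2])
      rwa [show θ₀ + a - (θ + a) = -(θ - θ₀) by ring] at this
  have h1 := ENNReal.le_sub_of_add_le_right ENNReal.ofReal_ne_top key
  refine h1.trans ?_
  rw [← ENNReal.ofReal_one, ← ENNReal.ofReal_sub _ (by positivity)]
  refine ENNReal.ofReal_le_ofReal ?_
  linarith [Real.add_one_le_exp (-(m * |θ - θ₀|))]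

/-- A kernel that reaches two components has a support straddling the gap to the right of the left
one. That gap contains an interval of length γ missed by all components, so a mass of at least m γ
is lost. -/
theorem sum_hitProb_add_le_one (hg : BoundedSupportKernel a b g) {m : ℝ}
    (hm0 : 0 < m) (hm : ∀ x ∈ Set.Icc a b, m ≤ g x) {t : ℕ} {θ' : Fin t → ℝ} {γ : ℝ} (hγ : 0 < γ)
    (hsep : ∀ j k, j ≠ k → b - a + γ ≤ |θ' j - θ' k|) (θ : ℝ) {j l : Fin t} (hjl : j ≠ l)
    (hj : hitProb a b g (θ' j) θ ≠ 0) (hl : hitProb a b g (θ' l) θ ≠ 0) :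
    (∑ i, hitProb a b g (θ' i) θ) + ENNReal.ofReal (m * γ) ≤ 1 := by
  wlog hlt : θ' j ≤ θ' l generalizing j l
  · exact this hjl.symm hl hj (le_of_not_ge hlt)
  have hj' : |θ - θ' j| < b - a := not_le.1 fun h => hj (hitProb_eq_zero hg h)
  have hl' : |θ - θ' l| < b - a := not_le.1 fun h => hl (hitProb_eq_zero hg h)
  rw [abs_lt] at hj' hl'
  have hgap := hsep j l hjl
  rw [abs_of_nonpos (sub_nonpos.2 hlt)] at hgap
  have hdisj : Pairwise (Function.onFun Disjoint
      fun i => Set.Ioo (θ' i + a) (θ' i + b)) := by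
    intro i k hik
    refine Set.disjoint_left.2 fun x hx hx' => ?_
    have := hsep i k hik
    rcases le_abs.1 this with h | h
    · linarith [hx.1, hx.2, hx'.1, hx'.2]
    · linarith [hx.1, hx.2, hx'.1, hx'.2]
  have hsum : ∑ i, hitProb a b g (θ' i) θ =
      ∫⁻ x in ⋃ i, Set.Ioo (θ' i + a) (θ' i + b), ENNReal.ofReal (g (x - θ)) := by
    rw [lintegral_iUnion (fun i => measurableSet_Ioo) hdisj, tsum_fintype]
    rfl
  rw [hsum]
  have := setLIntegral_add_le_one hg hm0.le hm θ (MeasurableSet.iUnion fun i : Fin t =>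
    measurableSet_Ioo (a := θ' i + a) (b := θ' i + b)) (u := θ' j + b) (v := θ' j + b + γ)
    (by linarith) (by linarith) ?_
  · rwa [add_sub_cancel_left] at this
  · refine Set.disjoint_left.2 fun x hx hx' => ?_
    obtain ⟨i, hi⟩ := Set.mem_iUnion.1 hx
    by_cases hij : i = j
    · subst hij
      linarith [hi.2, hx'.1]
    · rcases le_abs.1 (hsep i j hij) with h | h
      · linarith [hi.1, hi.2, hx'.1, hx'.2]
      · linarith [hi.1, hi.2, hx'.1, hx'.2]

/-- The law of the atoms. -/
noncomputable def baseMeasure (q₀ : ℝ → ℝ) : Measure ℝ :=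
  volume.withDensity fun θ => ENNReal.ofReal (q₀ θ)

/-! ### Bounds for the contribution of a single block. -/

theorem IsDensity.isProbabilityMeasure (hq₀ : IsDensity q₀) :
    IsProbabilityMeasure (baseMeasure q₀) :=
  ⟨by rw [baseMeasure, withDensity_apply _ MeasurableSet.univ, Measure.restrict_univ,
    hq₀.lintegral_eq_one]⟩

/-- Average over the base measure of the probability that observations sharing one parameter
fall into the supports prescribed by the labels `c`. -/
noncomputable def blockProb (a b : ℝ) (g q₀ : ℝ → ℝ) {t n : ℕ} (θ' : Fin t → ℝ)
    (c : Fin n → Fin t) (B : Finset (Fin n)) : ENNReal :=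
  ∫⁻ θ, ∏ i ∈ B, hitProb a b g (θ' (c i)) θ ∂(baseMeasure q₀)

/-- For k observations from one component, hitting decays like exp(-m k |θ - θ'_j|). Integrating
this against a bounded base density gives a factor of order 1/k, and (k-1)!/k = k!/k². -/
theorem exists_pure_block_bound (hg : BoundedSupportKernel a b g) (hq₀ : BoundedBaseDensity q₀)
    {t : ℕ} (θ' : Fin t → ℝ) :
    ∃ C > (0 : ℝ), ∀ {n : ℕ} (c : Fin n → Fin t) (B : Finset (Fin n)) (j : Fin t),
      B.Nonempty → (∀ i ∈ B, c i = j) →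
      ENNReal.ofReal ((B.card - 1).factorial : ℝ) * blockProb a b g q₀ θ' c B ≤
        ENNReal.ofReal (C * labelWeight c B) := by
  obtain ⟨m, hm0, hm⟩ := hg.pos_on
  obtain ⟨U, hU⟩ := hq₀.bounded
  set U' := max U 1
  have hU0 : 0 < U' := lt_max_of_lt_right one_pos
  have hU' : ∀ x, q₀ x ≤ U' := fun x => (hU x).trans (le_max_left _ _)
  -- The factor 2/m comes from the two-sided exponential integral, and 4 from replacing (k+1)⁻² by
  -- (k+2)⁻², where |B| = k + 1.
  refine ⟨8 * U' / m, by positivity, fun {n} c B j hB hc => ?_⟩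
  obtain ⟨k, hk⟩ : ∃ k, B.card = k + 1 :=
    Nat.exists_eq_succ_of_ne_zero (Finset.card_pos.2 hB).ne'
  have hweight : labelWeight c B = sizeWeight B.card := by
    rw [labelWeight, Finset.prod_eq_single j]
    · rw [labelCount, Finset.filter_true_of_mem hc]
    · intro l _ hl
      have h0 : ∀ i ∈ B, ¬c i = l := fun i hi h => hl (h.symm.trans (hc i hi))
      rw [labelCount, Finset.filter_false_of_mem h0]
      simp [sizeWeight]
    · simp
  have hI : blockProb a b g q₀ θ' c B ≤ ENNReal.ofReal (2 * U' / (m * (k + 1))) := by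
    calc blockProb a b g q₀ θ' c B
        ≤ ∫⁻ θ, ENNReal.ofReal (Real.exp (-((m * (k + 1)) * |θ - θ' j|))) ∂(baseMeasure q₀) := by
          refine lintegral_mono fun θ => ?_
          calc ∏ i ∈ B, hitProb a b g (θ' (c i)) θ
              ≤ ∏ i ∈ B, ENNReal.ofReal (Real.exp (-(m * |θ - θ' j|))) :=
                Finset.prod_le_prod' fun i hi => by
                  rw [hc i hi]
                  exact hitProb_le_exp hg hm0 hm _ _
            _ = _ := by
                rw [Finset.prod_const, hk, ← ENNReal.ofReal_pow (Real.exp_pos _).le,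
                  ← Real.exp_nat_mul]
                push_cast
                ring_nf
      _ = ∫⁻ θ, ENNReal.ofReal (q₀ θ) *
            ENNReal.ofReal (Real.exp (-((m * (k + 1)) * |θ - θ' j|))) := by
          rw [baseMeasure, lintegral_withDensity_eq_lintegral_mul _
            hq₀.isDensity.measurable.ennreal_ofReal (by fun_prop)]
          rfl
      _ ≤ ∫⁻ θ, ENNReal.ofReal U' *
            ENNReal.ofReal (Real.exp (-((m * (k + 1)) * |θ - θ' j|))) :=
          lintegral_mono fun θ => by
            gcongr
            exact hU' θ
      _ ≤ ENNReal.ofReal U' * ENNReal.ofReal (2 / (m * (k + 1))) := by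
          rw [lintegral_const_mul _ (by fun_prop)]
          gcongr
          exact lintegral_exp_neg_mul_abs_sub_le (by positivity) _
      _ = _ := by
          rw [← ENNReal.ofReal_mul hU0.le]
          congr 1
          ring
  calc _ ≤ ENNReal.ofReal ((B.card - 1).factorial : ℝ) *
        ENNReal.ofReal (2 * U' / (m * (k + 1))) := by gcongr
    _ = ENNReal.ofReal (((B.card - 1).factorial : ℝ) * (2 * U' / (m * (k + 1)))) := by
        rw [← ENNReal.ofReal_mul (by positivity)]
    _ ≤ _ := by
        refine ENNReal.ofReal_le_ofReal ?_
        rw [hweight, sizeWeight, hk, Nat.add_sub_cancel, Nat.factorial_succ]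
        push_cast
        have h1 : (1 : ℝ) / (k + 1) ^ 2 ≤ 4 * (1 / (k + 1 + 1) ^ 2) := by
          rw [mul_one_div, div_le_div_iff₀ (by positivity) (by positivity)]
          nlinarith [(k.cast_nonneg : (0 : ℝ) ≤ k)]
        calc (k.factorial : ℝ) * (2 * U' / (m * (k + 1)))
            = 2 * U' / m * ((k + 1) * k.factorial) * (1 / (k + 1) ^ 2) := by
              field_simp
          _ ≤ 2 * U' / m * ((k + 1) * k.factorial) * (4 * (1 / (k + 1 + 1) ^ 2)) := by gcongr
          _ = _ := by ring

theorem exists_pow_le_inv_sq {r : ℝ} (hr0 : 0 ≤ r) (hr : r < 1) :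
    ∃ C > (0 : ℝ), ∀ k : ℕ, r ^ k ≤ C * (1 / ((k : ℝ) + 1) ^ 2) := by
  have h := tendsto_pow_const_mul_const_pow_of_lt_one 2 hr0 hr
  obtain ⟨C, hC⟩ := h.bddAbove_range
  -- From (k+1)² ≤ 2k² + 2, where both k² r^k and r^k are at most max C 1.
  refine ⟨4 * max C 1, by positivity, fun k => ?_⟩
  rw [mul_one_div, le_div_iff₀ (by positivity)]
  have h1 : (k : ℝ) ^ 2 * r ^ k ≤ max C 1 := (hC ⟨k, rfl⟩).trans (le_max_left _ _)
  have h2 : r ^ k ≤ max C 1 := (pow_le_one₀ hr0 hr.le).trans (le_max_right _ _)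
  have h3 := pow_nonneg hr0 k
  nlinarith [sq_nonneg ((k : ℝ) - 1), mul_nonneg h3 (sq_nonneg ((k : ℝ) - 1))]

/-- If θ can produce two different labels, the hitting probabilities sum to at most r < 1. The
multinomial theorem then bounds |B|! times their product over the block by ∏ k_j! r^{k_j}, and
geometric decay is stronger than the inverse squares in the weight. The bound is pointwise in θ, so
averaging over the base measure is free. -/
theorem exists_mixed_block_bound (hg : BoundedSupportKernel a b g)
    (hq₀ : BoundedBaseDensity q₀) {t : ℕ} {θ' : Fin t → ℝ} {γ : ℝ} (hγ : 0 < γ)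
    (hsep : ∀ j k, j ≠ k → b - a + γ ≤ |θ' j - θ' k|) :
    ∃ C > (0 : ℝ), ∀ {n : ℕ} (c : Fin n → Fin t) (B : Finset (Fin n)),
      (∃ i ∈ B, ∃ i' ∈ B, c i ≠ c i') →
      ENNReal.ofReal ((B.card - 1).factorial : ℝ) * blockProb a b g q₀ θ' c B ≤
        ENNReal.ofReal (C * labelWeight c B) := by
  obtain ⟨m, hm0, hm⟩ := hg.pos_on
  set r := max (1 - m * γ) 0 with hr
  have hr0 : 0 ≤ r := le_max_right _ _
  have hr1 : r < 1 := max_lt (by linarith [mul_pos hm0 hγ]) one_pos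
  obtain ⟨C, hC0, hC⟩ := exists_pow_le_inv_sq hr0 hr1
  refine ⟨C ^ t, by positivity, fun {n} c B ⟨i, hi, i', hi', hii'⟩ => ?_⟩
  have hprob := hq₀.isDensity.isProbabilityMeasure
  have hmain : ∀ θ, ENNReal.ofReal ((B.card - 1).factorial : ℝ) *
      ∏ i ∈ B, hitProb a b g (θ' (c i)) θ ≤ ENNReal.ofReal (C ^ t * labelWeight c B) := by
    intro θ
    by_cases h0 : ∏ i ∈ B, hitProb a b g (θ' (c i)) θ = 0
    · rw [h0, mul_zero]
      exact zero_le
    rw [Finset.prod_eq_zero_iff] at h0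
    push Not at h0
    have hle := sum_hitProb_add_le_one hg hm0 hm hγ hsep θ hii' (h0 i hi) (h0 i' hi')
    set p : Fin t → ℝ := fun j => (hitProb a b g (θ' j) θ).toReal with hp
    have hfin : ∀ j, hitProb a b g (θ' j) θ ≠ ⊤ := fun j =>
      ((hitProb_le_one hg _ _).trans_lt ENNReal.one_lt_top).ne
    have hofReal : ∀ j, hitProb a b g (θ' j) θ = ENNReal.ofReal (p j) := fun j =>
      (ENNReal.ofReal_toReal (hfin j)).symm
    have hp0 : ∀ j, 0 ≤ p j := fun j => ENNReal.toReal_nonneg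
    have hsum : ∑ j, p j ≤ r := by
      simp_rw [hofReal] at hle
      rw [← ENNReal.ofReal_sum_of_nonneg fun j _ => hp0 j,
        ← ENNReal.ofReal_add (Finset.sum_nonneg fun j _ => hp0 j) (by positivity),
        ENNReal.ofReal_le_one] at hle
      exact le_max_of_le_left (by linarith)
    simp_rw [hofReal]
    rw [← ENNReal.ofReal_prod_of_nonneg fun i _ => hp0 _, ← ENNReal.ofReal_mul (by positivity)]
    refine ENNReal.ofReal_le_ofReal ?_
    calc ((B.card - 1).factorial : ℝ) * ∏ i ∈ B, p (c i)
        ≤ (B.card.factorial : ℝ) * ∏ i ∈ B, p (c i) := by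
          refine mul_le_mul_of_nonneg_right ?_ (Finset.prod_nonneg fun i _ => hp0 _)
          exact_mod_cast Nat.factorial_le (Nat.sub_le _ _)
      _ ≤ (∏ j, ((labelCount c B j).factorial : ℝ)) * (∑ j, p j) ^ B.card :=
          factorial_mul_prod_pow_le p hp0 c B
      _ ≤ (∏ j, ((labelCount c B j).factorial : ℝ)) * r ^ B.card := by
          refine mul_le_mul_of_nonneg_left ?_ (Finset.prod_nonneg fun _ _ => by positivity)
          exact pow_le_pow_left₀ (Finset.sum_nonneg fun j _ => hp0 j) hsum _
      _ = ∏ j, ((labelCount c B j).factorial : ℝ) * r ^ labelCount c B j := by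
          rw [Finset.prod_mul_distrib, Finset.prod_pow_eq_pow_sum, sum_labelCount]
      _ ≤ ∏ j, C * sizeWeight (labelCount c B j) := by
          refine Finset.prod_le_prod (fun j _ => by positivity) fun j _ => ?_
          rw [sizeWeight, mul_left_comm]
          exact mul_le_mul_of_nonneg_left (hC _) (by positivity)
      _ = C ^ t * labelWeight c B := by
          rw [Finset.prod_mul_distrib, Finset.prod_const, Finset.card_univ, Fintype.card_fin]
          rfl
  have hmeas : Measurable fun θ => ∏ i ∈ B, hitProb a b g (θ' (c i)) θ :=
    Finset.measurable_prod _ fun i _ => measurable_hitProb hg _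
  calc _ = ∫⁻ θ, ENNReal.ofReal ((B.card - 1).factorial : ℝ) *
        ∏ i ∈ B, hitProb a b g (θ' (c i)) θ ∂(baseMeasure q₀) :=
        (lintegral_const_mul _ hmeas).symm
    _ ≤ ∫⁻ _, ENNReal.ofReal (C ^ t * labelWeight c B) ∂(baseMeasure q₀) := lintegral_mono hmain
    _ = _ := by rw [lintegral_const, measure_univ, mul_one]

theorem exists_block_bound (hg : BoundedSupportKernel a b g)
    (hq₀ : BoundedBaseDensity q₀) {t : ℕ} {θ' : Fin t → ℝ} {γ : ℝ} (hγ : 0 < γ)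
    (hsep : ∀ j k, j ≠ k → b - a + γ ≤ |θ' j - θ' k|) :
    ∃ C > (0 : ℝ), ∀ {n : ℕ} (c : Fin n → Fin t) (B : Finset (Fin n)), B.Nonempty →
      ENNReal.ofReal ((B.card - 1).factorial : ℝ) * blockProb a b g q₀ θ' c B ≤
        ENNReal.ofReal (C * labelWeight c B) := by
  obtain ⟨C₁, h₁, hC₁⟩ := exists_pure_block_bound (a := a) (b := b) hg hq₀ θ'
  obtain ⟨C₂, h₂, hC₂⟩ := exists_mixed_block_bound hg hq₀ hγ hsep
  refine ⟨max C₁ C₂, lt_max_of_lt_left h₁, fun {n} c B hB => ?_⟩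
  have hw := (labelWeight_pos c B).le
  by_cases h : ∃ i ∈ B, ∃ i' ∈ B, c i ≠ c i'
  · exact (hC₂ c B h).trans (ENNReal.ofReal_le_ofReal
      (mul_le_mul_of_nonneg_right (le_max_right _ _) hw))
  · push Not at h
    obtain ⟨i, hi⟩ := hB
    exact (hC₁ c B (c i) ⟨i, hi⟩ fun i' hi' => h i' hi' i hi).trans (ENNReal.ofReal_le_ofReal
      (mul_le_mul_of_nonneg_right (le_max_left _ _) hw))

end Hit

/-! ### Asymptotics of the prior on the concentration parameter -/

/-- The factor `α ^ t / α ^ (n)`. -/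
noncomputable def ewensFactor (t n : ℕ) (α : ℝ) : ℝ := α ^ t / (ascPochhammer ℝ n).eval α

theorem measurable_ewensFactor (t n : ℕ) : Measurable (ewensFactor t n) := by
  unfold ewensFactor
  exact (measurable_id.pow_const t).div (Polynomial.continuous _).measurable

theorem ewensFactor_nonneg {α : ℝ} (hα : 0 ≤ α) (t n : ℕ) : 0 ≤ ewensFactor t n α :=
  div_nonneg (pow_nonneg hα t) (ascPochhammer_eval_nonneg hα n)

/-- The marginal prior factor `∫ α ^ t / α ^ (n) π(dα)`. -/
noncomputable def priorFactor (π : Measure ℝ) (t n : ℕ) : ENNReal :=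
  ∫⁻ α, ENNReal.ofReal (ewensFactor t n α) ∂π

/-- Taking out α and n! leaves the product of the 1 + α/i, the part that penalises large α by
roughly a power of n. -/
theorem ascPochhammer_eval_succ_eq (α : ℝ) (n : ℕ) :
    (ascPochhammer ℝ (n + 1)).eval α =
      α * (n.factorial * ∏ i ∈ Finset.range n, (1 + α / (i + 1))) := by
  induction n with
  | zero => simp
  | succ n ih =>
    rw [ascPochhammer_succ_eval, ih, Finset.prod_range_succ, Nat.factorial_succ]
    push_cast
    field_simp
    ring

theorem prod_one_add_div_le {α : ℝ} (hα : 0 ≤ α) (n : ℕ) :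
    ∏ i ∈ Finset.range n, (1 + α / ((i : ℝ) + 1)) ≤
      Real.exp (α * (1 + Real.log ((n : ℝ) + 1))) := by
  calc ∏ i ∈ Finset.range n, (1 + α / ((i : ℝ) + 1))
      ≤ ∏ i ∈ Finset.range n, Real.exp (α / ((i : ℝ) + 1)) :=
        Finset.prod_le_prod (fun i _ => by positivity) fun i _ => by
          rw [add_comm]; exact Real.add_one_le_exp _
    _ = Real.exp (α * (harmonic n : ℚ)) := by
        rw [← Real.exp_sum, harmonic]
        push_cast
        rw [Finset.mul_sum]
        rfl
    _ ≤ _ := by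
        refine Real.exp_le_exp.2 (mul_le_mul_of_nonneg_left ?_ hα)
        refine (harmonic_le_one_add_log n).trans ?_
        rcases n.eq_zero_or_pos with rfl | hn
        · simp
        · have : (0 : ℝ) < n := by exact_mod_cast hn
          gcongr
          linarith

/-- For 0 ≤ u ≤ 1 one has 1 + u ≥ exp(u/2). This applies to the factors with i + 1 ≥ m ≥ α and gives
(n/m)^{α/2}, the earlier factors being at least 1. Since m² ≤ n, n/m is at least √n, hence the
exponent α/4. -/
theorem le_prod_one_add_div {α : ℝ} (hα : 0 ≤ α) {m n : ℕ} (hm : 1 ≤ m) (hαm : α ≤ m)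
    (hmn : m * m ≤ n) :
    Real.exp (α / 4 * Real.log n) ≤ ∏ i ∈ Finset.range (n - 1), (1 + α / ((i : ℝ) + 1)) := by
  have hmn' : m ≤ n := (Nat.le_mul_self m).trans hmn
  have hm0 : (0 : ℝ) < m := by exact_mod_cast hm
  have key : ∀ k : ℕ, Real.exp (α / 2 * (Real.log (m + k : ℕ) - Real.log m)) ≤
      ∏ i ∈ Finset.range (m + k - 1), (1 + α / ((i : ℝ) + 1)) := by
    intro k
    induction k with
    | zero =>
      simp only [add_zero, sub_self, mul_zero, Real.exp_zero]
      refine (Finset.prod_const_one (s := Finset.range (m - 1)) (M := ℝ)).symm.le.trans ?_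
      refine Finset.prod_le_prod (fun _ _ => zero_le_one) fun i _ => ?_
      have : 0 ≤ α / ((i : ℝ) + 1) := by positivity
      linarith
    | succ k ih =>
      obtain ⟨l, hl⟩ : ∃ l, m + k = l + 1 := ⟨m + k - 1, by omega⟩
      have hl0 : (m : ℝ) ≤ l + 1 := by
        have : (m : ℝ) + k = l + 1 := by exact_mod_cast hl
        linarith [(k.cast_nonneg : (0 : ℝ) ≤ k)]
      rw [show m + (k + 1) = l + 1 + 1 by omega, Nat.add_sub_cancel, Finset.prod_range_succ]
      rw [hl, Nat.add_sub_cancel] at ih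
      have hlog : Real.log ((l + 1 + 1 : ℕ) : ℝ) ≤ Real.log ((l + 1 : ℕ) : ℝ) + 1 / (l + 1) := by
        have h1 : ((l + 1 + 1 : ℕ) : ℝ) = ((l + 1 : ℕ) : ℝ) * (1 + 1 / (l + 1)) := by
          push_cast
          field_simp
        rw [h1, Real.log_mul (by positivity) (by positivity)]
        gcongr
        exact (Real.log_le_sub_one_of_pos (by positivity)).trans (by linarith)
      set u := α / ((l : ℝ) + 1) with hu
      have hu0 : 0 ≤ u := by positivity
      have hu1 : u ≤ 1 := (div_le_one (by positivity)).2 (hαm.trans hl0)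
      have hexp : Real.exp (u / 2) ≤ 1 + u := by
        have h1 := Real.add_one_le_exp (-(u / 2))
        rw [Real.exp_neg] at h1
        have h2 := Real.exp_pos (u / 2)
        have h3 : (-(u / 2) + 1) * Real.exp (u / 2) ≤ 1 := by
          calc _ ≤ (Real.exp (u / 2))⁻¹ * Real.exp (u / 2) :=
                mul_le_mul_of_nonneg_right h1 h2.le
            _ = 1 := inv_mul_cancel₀ h2.ne'
        nlinarith
      calc _ ≤ Real.exp (α / 2 * (Real.log ((l + 1 : ℕ) : ℝ) - Real.log m) + u / 2) := by
            refine Real.exp_le_exp.2 ?_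
            have := mul_le_mul_of_nonneg_left hlog (by positivity : 0 ≤ α / 2)
            have h5 : α / 2 * (1 / ((l : ℝ) + 1)) = u / 2 := by rw [hu]; ring
            linarith
        _ = Real.exp (α / 2 * (Real.log ((l + 1 : ℕ) : ℝ) - Real.log m)) * Real.exp (u / 2) :=
            Real.exp_add _ _
        _ ≤ _ := mul_le_mul ih hexp (Real.exp_pos _).le
            ((Real.exp_pos _).le.trans ih)
  refine le_trans (Real.exp_le_exp.2 ?_) ((key (n - m)).trans (le_of_eq ?_))
  · rw [Nat.add_sub_cancel' hmn']
    have h1 : 2 * Real.log m ≤ Real.log n := by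
      rw [← Real.log_rpow hm0]
      refine Real.log_le_log (by positivity) ?_
      norm_num
      rw [pow_two]
      exact_mod_cast hmn
    nlinarith
  · rw [Nat.add_sub_cancel' hmn']

section Prior

variable {π : Measure ℝ} {t : ℕ}

theorem ewensFactor_succ_eq {α : ℝ} (hα : α ≠ 0) (t n : ℕ) :
    ewensFactor (t + 1) (n + 1) α =
      α ^ t / (n.factorial * ∏ i ∈ Finset.range n, (1 + α / ((i : ℝ) + 1))) := by
  rw [ewensFactor, ascPochhammer_eval_succ_eq, pow_succ, mul_comm (α ^ t), mul_div_mul_left _ _ hα]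

/-- Restrict the integral to α < e: there the product of the 1 + α/i is at most exp(e (1 + log n)).
So V_n (n-1)! decays more slowly than any power of n, as soon as π charges every interval (0, e). -/
theorem exists_le_priorFactor [IsProbabilityMeasure π] (hpos : ∀ e > (0 : ℝ), π (Set.Ioo 0 e) ≠ 0)
    (ht : 1 ≤ t) {e : ℝ} (he : 0 < e) (he1 : e ≤ 1) :
    ∃ κ > (0 : ℝ), ∀ n : ℕ, 1 ≤ n →
      ENNReal.ofReal (κ * Real.exp (-(e * Real.log n)) / (n - 1).factorial) ≤
        priorFactor π t n := by
  obtain ⟨t, rfl⟩ : ∃ s, t = s + 1 := ⟨t - 1, by omega⟩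
  set I := ∫⁻ α in Set.Ioo 0 e, ENNReal.ofReal (α ^ t) ∂π with hI
  have hI0 : I ≠ 0 := by
    rw [hI, ← pos_iff_ne_zero, setLIntegral_pos_iff (by fun_prop)]
    refine (pos_iff_ne_zero.2 (hpos e he)).trans_le (measure_mono fun α hα => ⟨?_, hα⟩)
    rw [Function.mem_support, ← pos_iff_ne_zero, ENNReal.ofReal_pos]
    exact pow_pos hα.1 t
  have hI1 : I ≠ ⊤ := by
    refine ne_top_of_le_ne_top ENNReal.one_ne_top ?_
    calc I ≤ ∫⁻ _ in Set.Ioo 0 e, 1 ∂π := setLIntegral_mono' measurableSet_Ioo fun α hα => by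
          rw [ENNReal.ofReal_le_one]
          exact pow_le_one₀ hα.1.le (hα.2.le.trans he1)
      _ ≤ 1 := by
          rw [setLIntegral_one]
          exact prob_le_one
  refine ⟨I.toReal * Real.exp (-e), mul_pos (ENNReal.toReal_pos hI0 hI1) (Real.exp_pos _),
    fun n hn => ?_⟩
  obtain ⟨n, rfl⟩ : ∃ s, n = s + 1 := ⟨n - 1, by omega⟩
  rw [Nat.add_sub_cancel]
  have h1 : ∀ α ∈ Set.Ioo 0 e, ENNReal.ofReal (Real.exp (-e) *
      Real.exp (-(e * Real.log (n + 1 : ℕ))) / n.factorial) * ENNReal.ofReal (α ^ t) ≤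
      ENNReal.ofReal (ewensFactor (t + 1) (n + 1) α) := by
    intro α hα
    have hα0 : 0 ≤ α := hα.1.le
    rw [← ENNReal.ofReal_mul (by positivity), ewensFactor_succ_eq hα.1.ne']
    refine ENNReal.ofReal_le_ofReal ?_
    have hprod : 0 < ∏ i ∈ Finset.range n, (1 + α / ((i : ℝ) + 1)) :=
      Finset.prod_pos fun i _ => by positivity
    rw [le_div_iff₀ (by positivity)]
    have h2 : ∏ i ∈ Finset.range n, (1 + α / ((i : ℝ) + 1)) ≤
        Real.exp (e * (1 + Real.log ((n : ℝ) + 1))) := by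
      refine (prod_one_add_div_le hα0 n).trans (Real.exp_le_exp.2 ?_)
      refine mul_le_mul_of_nonneg_right hα.2.le ?_
      have := Real.log_nonneg (x := (n : ℝ) + 1) (by linarith [(n.cast_nonneg : (0 : ℝ) ≤ n)])
      linarith
    have h3 : Real.exp (-e) * Real.exp (-(e * Real.log (n + 1 : ℕ))) *
        Real.exp (e * (1 + Real.log ((n : ℝ) + 1))) = 1 := by
      rw [← Real.exp_add, ← Real.exp_add, Real.exp_eq_one_iff]
      push_cast
      ring
    calc _ = α ^ t * (Real.exp (-e) * Real.exp (-(e * Real.log (n + 1 : ℕ))) *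
          ∏ i ∈ Finset.range n, (1 + α / ((i : ℝ) + 1))) := by
          field_simp
      _ ≤ α ^ t * (Real.exp (-e) * Real.exp (-(e * Real.log (n + 1 : ℕ))) *
          Real.exp (e * (1 + Real.log ((n : ℝ) + 1)))) := by gcongr
      _ = α ^ t := by rw [h3, mul_one]
  calc _ = ENNReal.ofReal (Real.exp (-e) *
        Real.exp (-(e * Real.log (n + 1 : ℕ))) / n.factorial) * I := by
        rw [← ENNReal.ofReal_toReal hI1, ← ENNReal.ofReal_mul (by positivity),
          ENNReal.toReal_ofReal ENNReal.toReal_nonneg]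
        congr 1
        ring
    _ = ∫⁻ α in Set.Ioo 0 e, ENNReal.ofReal (Real.exp (-e) *
        Real.exp (-(e * Real.log (n + 1 : ℕ))) / n.factorial) * ENNReal.ofReal (α ^ t) ∂π :=
        (lintegral_const_mul _ (by fun_prop)).symm
    _ ≤ ∫⁻ α in Set.Ioo 0 e, ENNReal.ofReal (ewensFactor (t + 1) (n + 1) α) ∂π :=
        setLIntegral_mono' measurableSet_Ioo h1
    _ ≤ _ := setLIntegral_le_lintegral _ _

/-- The extra factor α e^{Kα} is small for α ≤ d. For d ≤ α ≤ √n the Ewens factor is smaller than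
its value scale near zero by the power n^{-α/4}, which absorbs the exponential and beats the lower
bound n^{-d/8} for V_n (n-1)!. The cutoff √n is the range in which the lower bound for the product
of the 1 + α/i is available. -/
theorem eventually_lintegral_mul_exp_le [IsProbabilityMeasure π]
    (hpos : ∀ e > (0 : ℝ), π (Set.Ioo 0 e) ≠ 0) (ht : 1 ≤ t) {K : ℝ} (hK : 0 ≤ K) {ε : ℝ}
    (hε : 0 < ε) :
    ∀ᶠ n : ℕ in atTop, ∫⁻ α in Set.Ioc (0 : ℝ) n.sqrt,
      ENNReal.ofReal (α * Real.exp (K * α) * ewensFactor t n α) ∂π ≤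
        ENNReal.ofReal ε * priorFactor π t n := by
  set d := min 1 (ε / (2 * Real.exp K)) with hd
  have hd0 : 0 < d := lt_min one_pos (by positivity)
  have hd1 : d ≤ 1 := min_le_left _ _
  have hdε : d * Real.exp (K * d) ≤ ε / 2 := by
    calc d * Real.exp (K * d) ≤ (ε / (2 * Real.exp K)) * Real.exp K := by
          gcongr
          · exact min_le_right _ _
          · exact mul_le_of_le_one_right hK hd1
      _ = ε / 2 := by field_simp
  -- The decay n^{-d/4} far from zero is split in two halves: one matches this lower bound, the
  -- other tends to zero.
  obtain ⟨κ, hκ, hκn⟩ := exists_le_priorFactor hpos ht (e := d / 8) (by positivity) (by linarith)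
  have hlog : Tendsto (fun n : ℕ => Real.log n) atTop atTop :=
    Real.tendsto_log_atTop.comp tendsto_natCast_atTop_atTop
  have hsmall : ∀ᶠ n : ℕ in atTop, (t.factorial : ℝ) * Real.exp (d * (K + 1)) *
      Real.exp (-(d / 8 * Real.log n)) ≤ ε / 2 * κ := by
    have h1 : Tendsto (fun n : ℕ => (t.factorial : ℝ) * Real.exp (d * (K + 1)) *
        Real.exp (-(d / 8 * Real.log n))) atTop
        (𝓝 ((t.factorial : ℝ) * Real.exp (d * (K + 1)) * 0)) := by
      refine Tendsto.const_mul _ (Real.tendsto_exp_atBot.comp (tendsto_neg_atTop_atBot.comp ?_))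
      exact hlog.const_mul_atTop (by positivity)
    rw [mul_zero] at h1
    exact h1.eventually_le_const (by positivity)
  filter_upwards [eventually_ge_atTop 1, hlog.eventually_ge_atTop (4 * (K + 1)), hsmall]
    with n hn1 hnlog hns
  have hfar : ∀ α ∈ Set.Icc d (n.sqrt : ℝ),
      ENNReal.ofReal (α * Real.exp (K * α) * ewensFactor t n α) ≤
        ENNReal.ofReal (ε / 2) *
          ENNReal.ofReal (κ * Real.exp (-(d / 8 * Real.log n)) / (n - 1).factorial) := by
    intro α hα
    have hα0 : 0 < α := hd0.trans_le hα.1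
    rw [← ENNReal.ofReal_mul (by positivity)]
    refine ENNReal.ofReal_le_ofReal ?_
    obtain ⟨t, rfl⟩ : ∃ s, t = s + 1 := ⟨t - 1, by omega⟩
    have hs1 : 1 ≤ n.sqrt := Nat.le_sqrt.2 (by simpa using hn1)
    have h1 := le_prod_one_add_div hα0.le hs1 hα.2 n.sqrt_le
    obtain ⟨n, rfl⟩ : ∃ s, n = s + 1 := ⟨n - 1, by omega⟩
    rw [Nat.add_sub_cancel] at h1 ⊢
    rw [ewensFactor_succ_eq hα0.ne']
    have h2 : α ^ (t + 1) ≤ (t + 1).factorial * Real.exp α := by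
      have := Real.pow_div_factorial_le_exp α hα0.le (t + 1)
      rw [div_le_iff₀ (by positivity)] at this
      linarith
    set ℓ := Real.log ((n + 1 : ℕ) : ℝ) with hℓ
    -- Once log n ≥ 4 (K + 1) the exponent is nonincreasing in α, so its value at α = d is the
    -- largest.
    have h3 : Real.exp ((K + 1) * α - α / 4 * ℓ) ≤ Real.exp (d * (K + 1) - d / 4 * ℓ) := by
      refine Real.exp_le_exp.2 ?_
      nlinarith [mul_nonneg (sub_nonneg.2 hα.1) (sub_nonneg.2 hnlog)]
    calc α * Real.exp (K * α) *
          (α ^ t / (n.factorial * ∏ i ∈ Finset.range n, (1 + α / ((i : ℝ) + 1))))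
        = α ^ (t + 1) * Real.exp (K * α) / n.factorial /
            ∏ i ∈ Finset.range n, (1 + α / ((i : ℝ) + 1)) := by
          rw [pow_succ]
          field_simp
      _ ≤ (t + 1).factorial * Real.exp α * Real.exp (K * α) / n.factorial /
            Real.exp (α / 4 * ℓ) := by
          gcongr
      _ = (t + 1).factorial * Real.exp ((K + 1) * α - α / 4 * ℓ) / n.factorial := by
          rw [Real.exp_sub, add_mul, one_mul, Real.exp_add]
          ring
      _ ≤ (t + 1).factorial * Real.exp (d * (K + 1) - d / 4 * ℓ) / n.factorial := by gcongr
      _ = (t + 1).factorial * Real.exp (d * (K + 1)) * Real.exp (-(d / 8 * ℓ)) *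
            Real.exp (-(d / 8 * ℓ)) / n.factorial := by
          rw [mul_assoc _ (Real.exp _) (Real.exp _), mul_assoc, ← Real.exp_add, ← Real.exp_add]
          ring_nf
      _ ≤ ε / 2 * κ * Real.exp (-(d / 8 * ℓ)) / n.factorial := by gcongr
      _ = _ := by ring
  have hnear : ∀ α ∈ Set.Ioc 0 d, ENNReal.ofReal (α * Real.exp (K * α) * ewensFactor t n α) ≤
      ENNReal.ofReal (ε / 2) * ENNReal.ofReal (ewensFactor t n α) := by
    intro α hα
    rw [← ENNReal.ofReal_mul (by positivity)]
    refine ENNReal.ofReal_le_ofReal (mul_le_mul_of_nonneg_right ?_ (ewensFactor_nonneg hα.1.le _ _))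
    refine le_trans ?_ hdε
    have := hα.1.le
    gcongr
    · exact hα.2
    · exact hα.2
  calc _ ≤ ∫⁻ α in Set.Ioc 0 d ∪ Set.Icc d (n.sqrt : ℝ),
        ENNReal.ofReal (α * Real.exp (K * α) * ewensFactor t n α) ∂π := by
        refine lintegral_mono_set fun α hα => ?_
        rcases le_total α d with h | h
        · exact Or.inl ⟨hα.1, h⟩
        · exact Or.inr ⟨h, hα.2⟩
    _ ≤ (∫⁻ α in Set.Ioc 0 d, ENNReal.ofReal (α * Real.exp (K * α) * ewensFactor t n α) ∂π) +
        ∫⁻ α in Set.Icc d (n.sqrt : ℝ),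
          ENNReal.ofReal (α * Real.exp (K * α) * ewensFactor t n α) ∂π :=
        lintegral_union_le _ _ _
    _ ≤ (∫⁻ α in Set.Ioc 0 d, ENNReal.ofReal (ε / 2) * ENNReal.ofReal (ewensFactor t n α) ∂π) +
        ∫⁻ _ in Set.Icc d (n.sqrt : ℝ), ENNReal.ofReal (ε / 2) *
          ENNReal.ofReal (κ * Real.exp (-(d / 8 * Real.log n)) / (n - 1).factorial) ∂π :=
        add_le_add (setLIntegral_mono' measurableSet_Ioc hnear)
          (setLIntegral_mono' measurableSet_Icc hfar)
    _ ≤ ENNReal.ofReal (ε / 2) * priorFactor π t n +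
        ENNReal.ofReal (ε / 2) * priorFactor π t n := by
        refine add_le_add ?_ ?_
        · rw [lintegral_const_mul _ (measurable_ewensFactor t n).ennreal_ofReal]
          gcongr
          exact setLIntegral_le_lintegral _ _
        · rw [setLIntegral_const]
          calc _ ≤ ENNReal.ofReal (ε / 2) * ENNReal.ofReal
                (κ * Real.exp (-(d / 8 * Real.log n)) / (n - 1).factorial) * 1 := by
                gcongr
                exact prob_le_one
            _ ≤ _ := by
                rw [mul_one]
                gcongr
                exact hκn n hn1
    _ = ENNReal.ofReal ε * priorFactor π t n := by
        rw [← add_mul, ← ENNReal.ofReal_add (by positivity) (by positivity), add_halves]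

/-- V_n is at least a constant over n!, so it suffices that π(α > √n) be small against n^{-2t},
which Markov's inequality yields. -/
theorem eventually_tail_le [IsProbabilityMeasure π]
    (hpos : ∀ e > (0 : ℝ), π (Set.Ioo 0 e) ≠ 0) (ht : 1 ≤ t)
    (hmom : ∀ k : ℕ, 1 ≤ k → ∫⁻ α, ENNReal.ofReal (α ^ k) ∂π ≠ ⊤) {ε : ℝ} (hε : 0 < ε) :
    ∀ᶠ n : ℕ in atTop,
      ENNReal.ofReal (((n : ℝ) + 1) ^ (2 * t) / n.factorial) * π (Set.Ioi (n.sqrt : ℝ)) ≤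
        ENNReal.ofReal ε * priorFactor π t n := by
  obtain ⟨κ, hκ, hκn⟩ := exists_le_priorFactor hpos ht one_pos le_rfl
  -- With s = ⌊√n⌋, (n + 1)^{2t} is at most a constant times s^{4t}; one more power of s gives
  -- convergence to zero.
  set k := 4 * t + 1 with hk
  set A := (∫⁻ α, ENNReal.ofReal (α ^ k) ∂π).toReal with hA
  have hAtop := hmom k (by omega)
  have hsqrt : Tendsto (fun n : ℕ => (n.sqrt : ℝ)) atTop atTop := by
    refine tendsto_natCast_atTop_atTop.comp (tendsto_atTop_atTop.2 fun c => ⟨c * c, fun n hn => ?_⟩)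
    exact Nat.le_sqrt.2 hn
  filter_upwards [eventually_ge_atTop 1, hsqrt.eventually_ge_atTop (4 ^ (2 * t) * A / (ε * κ))]
    with n hn1 hns
  have hs1 : 1 ≤ n.sqrt := Nat.le_sqrt.2 (by simpa using hn1)
  have hs1' : (1 : ℝ) ≤ n.sqrt := by exact_mod_cast hs1
  have hn0 : (0 : ℝ) < n := by exact_mod_cast hn1
  set s : ℝ := (n.sqrt : ℝ) with hs
  set u := (π (Set.Ioi s)).toReal with hu
  have hmarkov : s ^ k * u ≤ A := by
    have h1 : ENNReal.ofReal (s ^ k) * π (Set.Ioi s) ≤ ∫⁻ α, ENNReal.ofReal (α ^ k) ∂π := by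
      refine le_trans ?_ (mul_meas_ge_le_lintegral (by fun_prop) (ENNReal.ofReal (s ^ k)))
      gcongr
      intro α hα
      have : s ≤ α := le_of_lt hα
      simp only [Set.mem_ofPred_eq]
      gcongr
    have h2 := ENNReal.toReal_mono hAtop h1
    rwa [ENNReal.toReal_mul, ENNReal.toReal_ofReal (by positivity)] at h2
  have hns2 : (n : ℝ) + 1 ≤ 4 * s ^ 2 := by
    have h1 : n + 1 ≤ (n.sqrt + 1) * (n.sqrt + 1) := Nat.lt_succ_sqrt n
    have h2 : (n : ℝ) + 1 ≤ (s + 1) * (s + 1) := by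
      rw [hs]
      exact_mod_cast h1
    nlinarith
  have hmain : ((n : ℝ) + 1) ^ (2 * t) * u ≤ ε * κ := by
    have hu0 : 0 ≤ u := ENNReal.toReal_nonneg
    have h1 : ((n : ℝ) + 1) ^ (2 * t) * u * s ≤ 4 ^ (2 * t) * A := by
      calc ((n : ℝ) + 1) ^ (2 * t) * u * s ≤ (4 * s ^ 2) ^ (2 * t) * u * s := by gcongr
        _ = 4 ^ (2 * t) * (s ^ k * u) := by rw [hk]; ring
        _ ≤ _ := by gcongr
    rw [div_le_iff₀ (by positivity)] at hns
    have h2 : ((n : ℝ) + 1) ^ (2 * t) * u * s ≤ ε * κ * s := by linarith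
    exact le_of_mul_le_mul_right h2 (by linarith)
  calc ENNReal.ofReal (((n : ℝ) + 1) ^ (2 * t) / n.factorial) * π (Set.Ioi s)
      = ENNReal.ofReal (((n : ℝ) + 1) ^ (2 * t) * u / n.factorial) := by
        rw [← ENNReal.ofReal_toReal (measure_ne_top π (Set.Ioi s)),
          ← ENNReal.ofReal_mul (by positivity)]
        congr 1
        ring
    _ ≤ ENNReal.ofReal (ε * κ / n.factorial) := by gcongr
    _ = ENNReal.ofReal ε * ENNReal.ofReal
        (κ * Real.exp (-(1 * Real.log n)) / (n - 1).factorial) := by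
        rw [← ENNReal.ofReal_mul hε.le, one_mul, Real.exp_neg, Real.exp_log hn0,
          ← Nat.mul_factorial_pred (by omega : n ≠ 0)]
        push_cast
        congr 1
        field_simp
    _ ≤ _ := by
        gcongr
        exact hκn n hn1

end Prior

/-! ### Upper bounds for the joint density in expectation -/

/-- The marginal likelihood of a block, as an extended nonnegative number. -/
noncomputable def marginalLikE (g q₀ : ℝ → ℝ) {n : ℕ} (x : Fin n → ℝ) (B : Finset (Fin n)) :
    ENNReal :=
  ∫⁻ θ, ∏ i ∈ B, ENNReal.ofReal (g (x i - θ)) ∂(baseMeasure q₀)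

/-- The prior weight of a partition, integrated over concentration parameters in `S`. -/
noncomputable def priorMass (π : Measure ℝ) (n : ℕ) (S : Set ℝ) (P : Finset (Finset (Fin n))) :
    ENNReal :=
  ∫⁻ α in S, ENNReal.ofReal
    (ewensFactor P.card n α * ∏ B ∈ P, (Nat.factorial (B.card - 1) : ℝ)) ∂π

section Expectation

variable {a b : ℝ} {g q₀ : ℝ → ℝ} {n : ℕ}

theorem ofReal_marginalLik (hg : BoundedSupportKernel a b g) (hab : a < b)
    (hq₀ : BoundedBaseDensity q₀) (x : Fin n → ℝ) (B : Finset (Fin n)) :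
    ENNReal.ofReal (marginalLik g q₀ x B) = marginalLikE g q₀ x B := by
  have hgm := hg.isDensity.measurable
  have hqm := hq₀.isDensity.measurable
  have hm : Measurable fun θ => ∏ i ∈ B, ENNReal.ofReal (g (x i - θ)) :=
    Finset.measurable_prod _ fun i _ => by fun_prop
  rw [marginalLik, ofReal_integral_eq_lintegral_ofReal (integrable_marginalLik hg hab hq₀ x B)
    (ae_of_all _ (marginalLik_integrand_nonneg hg hq₀ x B)), marginalLikE, baseMeasure,
    lintegral_withDensity_eq_lintegral_mul _ (by fun_prop) hm]
  refine lintegral_congr fun θ => ?_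
  rw [ENNReal.ofReal_mul (Finset.prod_nonneg fun i _ => hg.isDensity.nonneg _),
    ENNReal.ofReal_prod_of_nonneg fun i _ => hg.isDensity.nonneg _, mul_comm]
  rfl

/-- Division by the true density replaces the law of each observation by Lebesgue measure on E i, at
most; the marginal likelihoods then integrate to block probabilities. Two choices of E are used: the
supports prescribed by a label vector, and the whole line. -/
theorem lintegral_sum_marginalLik_le (hg : BoundedSupportKernel a b g)
    (hq₀ : BoundedBaseDensity q₀) {t : ℕ} {p θ' : Fin t → ℝ} {Ω : Type*} [MeasurableSpace Ω]
    {μ : Measure Ω} [IsProbabilityMeasure μ] {X : Fin n → Ω → ℝ} (hX : iIndepFun X μ)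
    (hXm : ∀ i, Measurable (X i)) (hlaw : ∀ i, μ.map (X i) = mixture g p θ')
    {E : Fin n → Set ℝ} (hE : ∀ i, MeasurableSet (E i)) {𝒬 : Finset (Finset (Finset (Fin n)))}
    (h𝒬 : 𝒬 ⊆ setPartitions Finset.univ) (w : Finset (Finset (Fin n)) → ENNReal) :
    ∫⁻ ω, (∑ P ∈ 𝒬, w P * ∏ B ∈ P, marginalLikE g q₀ (fun i => X i ω) B) *
        ∏ i, ((E i).indicator 1 (X i ω) * (mixtureDensity g p θ' (X i ω))⁻¹) ∂μ ≤
      ∑ P ∈ 𝒬, w P * ∏ B ∈ P, ∫⁻ θ, ∏ i ∈ B,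
        (∫⁻ x in E i, ENNReal.ofReal (g (x - θ))) ∂(baseMeasure q₀) := by
  have hgm := hg.isDensity.measurable
  have hHm := measurable_mixtureDensity hgm p θ'
  have hprob := hq₀.isDensity.isProbabilityMeasure
  set G : Fin n → ℝ → ℝ → ENNReal := fun i x θ =>
    ENNReal.ofReal (g (x - θ)) * (E i).indicator 1 x * (mixtureDensity g p θ' x)⁻¹ with hGdef
  have hG : ∀ i, Measurable (Function.uncurry (G i)) := by
    intro i
    have h1 : Measurable fun q : ℝ × ℝ => ENNReal.ofReal (g (q.1 - q.2)) := by fun_prop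
    have h2 : Measurable fun q : ℝ × ℝ => (E i).indicator (1 : ℝ → ENNReal) q.1 :=
      (measurable_one.indicator (hE i)).comp measurable_fst
    exact (h1.mul h2).mul (hHm.comp measurable_fst).inv
  have hXvec : Measurable fun ω => fun i => X i ω := measurable_pi_lambda _ hXm
  have hrew : ∀ ω, (∑ P ∈ 𝒬, w P * ∏ B ∈ P, marginalLikE g q₀ (fun i => X i ω) B) *
        ∏ i, ((E i).indicator 1 (X i ω) * (mixtureDensity g p θ' (X i ω))⁻¹) =
      ∑ P ∈ 𝒬, w P * ∏ B ∈ P, ∫⁻ θ, ∏ i ∈ B, G i (X i ω) θ ∂(baseMeasure q₀) := by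
    intro ω
    rw [Finset.sum_mul]
    refine Finset.sum_congr rfl fun P hP => ?_
    rw [← prod_blocks_of_mem_setPartitions (h𝒬 hP), mul_assoc, ← Finset.prod_mul_distrib]
    congr 1
    refine Finset.prod_congr rfl fun B _ => ?_
    rw [marginalLikE, ← lintegral_mul_const _ (Finset.measurable_prod _ fun i _ => by fun_prop)]
    refine lintegral_congr fun θ => ?_
    rw [← Finset.prod_mul_distrib]
    exact Finset.prod_congr rfl fun i _ => (mul_assoc _ _ _).symm
  simp_rw [hrew]
  have hmeas : ∀ P : Finset (Finset (Fin n)), Measurable fun ω =>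
      ∏ B ∈ P, ∫⁻ θ, ∏ i ∈ B, G i (X i ω) θ ∂(baseMeasure q₀) := fun P =>
    (Finset.measurable_prod P fun B _ => measurable_lintegral_prod_block hG B).comp hXvec
  rw [lintegral_finsetSum _ fun P _ => (hmeas P).const_mul _]
  refine Finset.sum_le_sum fun P hP => ?_
  rw [lintegral_const_mul _ (hmeas P), lintegral_prod_blocks hX hXm hG P
    (mem_setPartitions.1 (h𝒬 hP)).1]
  refine mul_le_mul_right (Finset.prod_le_prod' fun B _ => lintegral_mono fun θ =>
    Finset.prod_le_prod' fun i _ => ?_) _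
  have hGθ : Measurable fun x => G i x θ := (hG i).of_uncurry_right
  have hu : Measurable fun x => ENNReal.ofReal (g (x - θ)) * (E i).indicator (1 : ℝ → ENNReal) x :=
    (by fun_prop : Measurable fun x => ENNReal.ofReal (g (x - θ))).mul
      (measurable_one.indicator (hE i))
  rw [← lintegral_map (f := fun x => G i x θ) hGθ (hXm i), hlaw i, mixture_eq_withDensity hgm,
    ← lintegral_indicator (hE i)]
  refine (lintegral_mul_inv_density_le hHm hu).trans (lintegral_mono fun x => ?_)
  by_cases hx : x ∈ E i <;> simp [hx]

/-! ### Summation over all partitions, and over those with more than t blocks. -/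

theorem sum_ewensFactor_le_one {α : ℝ} (hα : 0 < α) :
    ∑ P ∈ setPartitions (Finset.univ : Finset (Fin n)),
      ewensFactor P.card n α * ∏ B ∈ P, (Nat.factorial (B.card - 1) : ℝ) ≤ 1 := by
  have h1 := sum_setPartitions_factorial_le hα.le (Finset.univ : Finset (Fin n))
  rw [Finset.card_univ, Fintype.card_fin] at h1
  have h2 : ∑ P ∈ setPartitions (Finset.univ : Finset (Fin n)),
      ewensFactor P.card n α * ∏ B ∈ P, (Nat.factorial (B.card - 1) : ℝ) =
      (∑ P ∈ setPartitions (Finset.univ : Finset (Fin n)),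
        ∏ B ∈ P, α * (Nat.factorial (B.card - 1) : ℝ)) / (ascPochhammer ℝ n).eval α := by
    rw [Finset.sum_div]
    refine Finset.sum_congr rfl fun P _ => ?_
    rw [Finset.prod_mul_distrib, Finset.prod_const, ewensFactor]
    ring
  rw [h2]
  exact div_le_one_of_le₀ h1 (ascPochhammer_eval_nonneg hα.le n)

theorem ewensFactor_mul_prod_nonneg {α : ℝ} (hα : 0 ≤ α) (P : Finset (Finset (Fin n))) :
    0 ≤ ewensFactor P.card n α * ∏ B ∈ P, (Nat.factorial (B.card - 1) : ℝ) :=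
  mul_nonneg (ewensFactor_nonneg hα _ _) (Finset.prod_nonneg fun _ _ => by positivity)

theorem measurable_ofReal_ewensFactor_mul (P : Finset (Finset (Fin n))) :
    Measurable fun α => ENNReal.ofReal
      (ewensFactor P.card n α * ∏ B ∈ P, (Nat.factorial (B.card - 1) : ℝ)) :=
  ((measurable_ewensFactor _ _).mul_const _).ennreal_ofReal

theorem sum_priorMass_le {π : Measure ℝ} {S : Set ℝ} (hS : MeasurableSet S)
    (hS0 : ∀ α ∈ S, 0 < α) :
    ∑ P ∈ setPartitions (Finset.univ : Finset (Fin n)), priorMass π n S P ≤ π S := by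
  unfold priorMass
  rw [← lintegral_finsetSum _ fun P _ => measurable_ofReal_ewensFactor_mul P]
  refine (setLIntegral_mono' hS fun α hα => ?_).trans (setLIntegral_one S).le
  rw [← ENNReal.ofReal_sum_of_nonneg fun P _ => ewensFactor_mul_prod_nonneg (hS0 α hα).le P,
    ENNReal.ofReal_le_one]
  exact sum_ewensFactor_le_one (hS0 α hα)

theorem sum_pow_div_factorial_le {y : ℝ} (hy : 0 ≤ y) (t n : ℕ) :
    ∑ s ∈ Finset.Ioc t n, y ^ s / s.factorial ≤ y ^ (t + 1) * Real.exp y := by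
  calc ∑ s ∈ Finset.Ioc t n, y ^ s / s.factorial
      ≤ ∑ k ∈ Finset.range n, y ^ (t + 1) * (y ^ k / k.factorial) := by
        refine sum_le_sum_of_injOn (fun s => s - (t + 1)) ?_ ?_ ?_ ?_
        · intro s hs
          rw [Finset.mem_Ioc] at hs
          rw [Finset.mem_range]
          omega
        · intro s hs s' hs' h
          rw [Finset.mem_coe, Finset.mem_Ioc] at hs hs'
          simp only at h
          omega
        · intro s hs
          rw [Finset.mem_Ioc] at hs
          rw [← mul_div_assoc, ← pow_add, show t + 1 + (s - (t + 1)) = s by omega]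
          refine div_le_div_of_nonneg_left (pow_nonneg hy s) (by positivity) ?_
          exact_mod_cast Nat.factorial_le (Nat.sub_le _ _)
        · intro k _
          positivity
    _ ≤ _ := by
        rw [← Finset.mul_sum]
        exact mul_le_mul_of_nonneg_left (Real.sum_le_exp_of_nonneg hy n) (pow_nonneg hy _)

/-- For fixed α the block bounds and the convolution estimate give (Kα)^s / s! for the partitions
into s blocks. As s > t, a factor (Kα)^{t+1} comes out of the exponential series; α^t of it restores
the Ewens factor of t clusters, and one α remains as the gain. -/
theorem sum_priorMass_mul_blockProb_le {t : ℕ} {θ' : Fin t → ℝ} {C : ℝ} (hC : 0 < C)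
    {c : Fin n → Fin t}
    (hblock : ∀ B : Finset (Fin n), B.Nonempty →
      ENNReal.ofReal ((B.card - 1).factorial : ℝ) * blockProb a b g q₀ θ' c B ≤
        ENNReal.ofReal (C * labelWeight c B)) {π : Measure ℝ} {S : Set ℝ}
    (hS : MeasurableSet S) (hS0 : ∀ α ∈ S, 0 < α) :
    ∑ P ∈ (setPartitions Finset.univ).filter (fun P => t < P.card),
      priorMass π n S P * ∏ B ∈ P, blockProb a b g q₀ θ' c B ≤
    ENNReal.ofReal ((C * 8 ^ t) ^ (t + 1) * labelWeight c Finset.univ) *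
      ∫⁻ α in S, ENNReal.ofReal (α * Real.exp (C * 8 ^ t * α) * ewensFactor t n α) ∂π := by
  set K := C * 8 ^ t with hK
  have hK0 : 0 < K := by positivity
  have hW := labelWeight_pos c (Finset.univ : Finset (Fin n))
  have hpoint : ∀ α ∈ S, ∑ P ∈ (setPartitions Finset.univ).filter (fun P => t < P.card),
      ENNReal.ofReal (ewensFactor P.card n α * ∏ B ∈ P, (Nat.factorial (B.card - 1) : ℝ)) *
        ∏ B ∈ P, blockProb a b g q₀ θ' c B ≤
      ENNReal.ofReal (K ^ (t + 1) * labelWeight c Finset.univ) *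
        ENNReal.ofReal (α * Real.exp (K * α) * ewensFactor t n α) := by
    intro α hα
    have hα0 := hS0 α hα
    have hterm : ∀ P ∈ (setPartitions Finset.univ).filter (fun P => t < P.card),
        ENNReal.ofReal (ewensFactor P.card n α * ∏ B ∈ P, (Nat.factorial (B.card - 1) : ℝ)) *
          ∏ B ∈ P, blockProb a b g q₀ θ' c B ≤
        ENNReal.ofReal (ewensFactor P.card n α * C ^ P.card * ∏ B ∈ P, labelWeight c B) := by
      intro P hP
      have hP' := (Finset.mem_filter.1 hP).1
      rw [ENNReal.ofReal_mul (ewensFactor_nonneg hα0.le _ _),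
        ENNReal.ofReal_prod_of_nonneg fun B _ => by positivity, mul_assoc,
        ← Finset.prod_mul_distrib, mul_assoc, ENNReal.ofReal_mul (ewensFactor_nonneg hα0.le _ _),
        ← Finset.prod_const, ← Finset.prod_mul_distrib, ENNReal.ofReal_prod_of_nonneg fun B _ =>
          mul_nonneg hC.le (labelWeight_pos c B).le]
      gcongr with B hB
      exact hblock B (nonempty_of_mem_setPartitions hP' hB)
    refine (Finset.sum_le_sum hterm).trans ?_
    rw [← ENNReal.ofReal_sum_of_nonneg fun P _ => mul_nonneg
      (mul_nonneg (ewensFactor_nonneg hα0.le _ _) (pow_nonneg hC.le _))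
      (Finset.prod_nonneg fun B _ => (labelWeight_pos c B).le), ← ENNReal.ofReal_mul (by positivity)]
    refine ENNReal.ofReal_le_ofReal ?_
    have hA := ascPochhammer_eval_nonneg hα0.le n
    calc _ = ∑ s ∈ Finset.Ioc t n, ∑ P ∈ setPartitionsInto Finset.univ s,
          ewensFactor P.card n α * C ^ P.card * ∏ B ∈ P, labelWeight c B := by
          rw [← Finset.sum_fiberwise_of_maps_to (t := Finset.Ioc t n) (g := Finset.card)]
          · refine Finset.sum_congr rfl fun s hs => Finset.sum_congr ?_ fun _ _ => rfl
            ext P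
            rw [Finset.mem_Ioc] at hs
            simp only [Finset.mem_filter, mem_setPartitionsInto]
            constructor
            · rintro ⟨⟨h1, -⟩, h2⟩
              exact ⟨h1, h2⟩
            · rintro ⟨h1, rfl⟩
              exact ⟨⟨h1, hs.1⟩, rfl⟩
          · intro P hP
            rw [Finset.mem_filter] at hP
            have := card_le_of_mem_setPartitions hP.1
            rw [Finset.card_univ, Fintype.card_fin] at this
            exact Finset.mem_Ioc.2 ⟨hP.2, this⟩
      _ = ∑ s ∈ Finset.Ioc t n, (α * C) ^ s / (ascPochhammer ℝ n).eval α *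
          ∑ P ∈ setPartitionsInto Finset.univ s, ∏ B ∈ P, labelWeight c B := by
          refine Finset.sum_congr rfl fun s _ => ?_
          rw [Finset.mul_sum]
          refine Finset.sum_congr rfl fun P hP => ?_
          rw [(mem_setPartitionsInto.1 hP).2, ewensFactor, mul_pow]
          ring
      _ ≤ ∑ s ∈ Finset.Ioc t n, (α * C) ^ s / (ascPochhammer ℝ n).eval α *
          ((8 ^ t) ^ s / s.factorial * labelWeight c Finset.univ) := by
          refine Finset.sum_le_sum fun s _ => mul_le_mul_of_nonneg_left
            (sum_setPartitionsInto_labelWeight_le c s _) (by positivity)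
      _ = labelWeight c Finset.univ / (ascPochhammer ℝ n).eval α *
          ∑ s ∈ Finset.Ioc t n, (K * α) ^ s / s.factorial := by
          rw [Finset.mul_sum]
          refine Finset.sum_congr rfl fun s _ => ?_
          rw [hK, mul_pow, mul_pow, mul_pow]
          ring
      _ ≤ labelWeight c Finset.univ / (ascPochhammer ℝ n).eval α *
          ((K * α) ^ (t + 1) * Real.exp (K * α)) :=
          mul_le_mul_of_nonneg_left (sum_pow_div_factorial_le (by positivity) t n) (by positivity)
      _ = _ := by
          rw [ewensFactor]
          ring
  unfold priorMass
  have hm := fun P : Finset (Finset (Fin n)) => measurable_ofReal_ewensFactor_mul P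
  calc _ = ∫⁻ α in S, ∑ P ∈ (setPartitions Finset.univ).filter (fun P => t < P.card),
      ENNReal.ofReal (ewensFactor P.card n α * ∏ B ∈ P, (Nat.factorial (B.card - 1) : ℝ)) *
        ∏ B ∈ P, blockProb a b g q₀ θ' c B ∂π := by
        rw [lintegral_finsetSum _ fun P _ => (hm P).mul_const _]
        exact Finset.sum_congr rfl fun P _ => (lintegral_mul_const _ (hm P)).symm
    _ ≤ ∫⁻ α in S, ENNReal.ofReal (K ^ (t + 1) * labelWeight c Finset.univ) *
        ENNReal.ofReal (α * Real.exp (K * α) * ewensFactor t n α) ∂π :=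
        setLIntegral_mono' hS hpoint
    _ = _ := lintegral_const_mul _ <| by
        have := measurable_ewensFactor t n
        fun_prop

end Expectation

/-! ### Pointwise bounds for the joint density -/

section Pointwise

variable {a b : ℝ} {g q₀ : ℝ → ℝ} {n : ℕ} {π : Measure ℝ}

theorem marginalLik_eq_zero (hg : BoundedSupportKernel a b g) (x : Fin n → ℝ)
    {B : Finset (Fin n)} {i k : Fin n} (hi : i ∈ B) (hk : k ∈ B) (hik : b - a < |x i - x k|) :
    marginalLik g q₀ x B = 0 := by
  rw [marginalLik, integral_eq_zero_of_ae]
  refine ae_of_all _ fun θ => ?_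
  suffices h : g (x i - θ) = 0 ∨ g (x k - θ) = 0 by
    have h0 : ∏ i ∈ B, g (x i - θ) = 0 := h.elim
      (fun h => Finset.prod_eq_zero (f := fun i => g (x i - θ)) hi h)
      fun h => Finset.prod_eq_zero (f := fun i => g (x i - θ)) hk h
    simp [h0]
  by_contra! h
  have hi' : x i - θ ∈ Set.Icc a b := by_contra fun hn => h.1 (hg.zero_off _ hn)
  have hk' : x k - θ ∈ Set.Icc a b := by_contra fun hn => h.2 (hg.zero_off _ hn)
  rcases lt_abs.1 hik with h' | h'
  · linarith [hi'.1, hi'.2, hk'.1, hk'.2]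
  · linarith [hi'.1, hi'.2, hk'.1, hk'.2]

/-- If there are `t` observations any two of which are too far apart to share a cluster, then
fewer than `t` clusters are impossible. -/
theorem jointDensity_eq_zero_of_separated (hg : BoundedSupportKernel a b g) (x : Fin n → ℝ)
    {t : ℕ} (y : Fin t → Fin n) (hy : ∀ j k, j ≠ k → b - a < |x (y j) - x (y k)|) {s : ℕ}
    (hs : s < t) : jointDensity g q₀ π x s = 0 := by
  rw [jointDensity_eq]
  refine Finset.sum_eq_zero fun P hP => ?_
  obtain ⟨hP, hc⟩ := mem_setPartitionsInto.1 hP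
  have hex : ∀ j : Fin t, ∃ B ∈ P, y j ∈ B := fun j =>
    exists_mem_of_mem_setPartitions hP (Finset.mem_univ _)
  choose β hβ hyβ using hex
  obtain ⟨j, -, k, -, hjk, hβjk⟩ := Finset.exists_ne_map_eq_of_card_lt_of_maps_to
    (s := Finset.univ) (t := P) (f := β) (by simpa [hc] using hs) fun j _ => hβ j
  have h0 : marginalLik g q₀ x (β j) = 0 :=
    marginalLik_eq_zero hg x (hyβ j) (hβjk ▸ hyβ k) (hy j k hjk)
  rw [Finset.prod_eq_zero (hβ j) h0, mul_zero]

theorem ofReal_priorWeight [IsProbabilityMeasure π] (hπ : π (Set.Iic 0) = 0)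
    {P : Finset (Finset (Fin n))} (hP : P ∈ setPartitions Finset.univ) :
    ENNReal.ofReal (priorWeight π n P) = priorMass π n Set.univ P := by
  have hpos : ∀ᵐ α ∂π, 0 < α := by
    filter_upwards [measure_eq_zero_iff_ae_notMem.1 hπ] with α hα using not_le.1 hα
  rw [priorMass, Measure.restrict_univ, priorWeight, ofReal_integral_eq_lintegral_ofReal]
  · rfl
  -- Integrability is needed here, since otherwise the real integral would be 0 by convention. The
  -- integrand is a single term of the Ewens sum, hence at most 1.
  · refine Integrable.of_bound (C := 1)
      ((measurable_ewensFactor _ _).mul_const _).aestronglyMeasurable ?_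
    filter_upwards [hpos] with α hα
    refine (Real.norm_of_nonneg (ewensFactor_mul_prod_nonneg hα.le P)).le.trans ?_
    exact (Finset.single_le_sum (f := fun P : Finset (Finset (Fin n)) =>
      ewensFactor P.card n α * ∏ B ∈ P, (Nat.factorial (B.card - 1) : ℝ))
      (fun Q _ => ewensFactor_mul_prod_nonneg hα.le Q) hP).trans (sum_ewensFactor_le_one hα)
  · filter_upwards [hpos] with α hα using ewensFactor_mul_prod_nonneg hα.le P

theorem priorMass_univ_le (hπ : π (Set.Iic 0) = 0) (m : ℝ) (P : Finset (Finset (Fin n))) :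
    priorMass π n Set.univ P ≤ priorMass π n (Set.Ioc 0 m) P + priorMass π n (Set.Ioi m) P := by
  unfold priorMass
  have h : (Set.univ : Set ℝ) ⊆ Set.Iic 0 ∪ (Set.Ioc 0 m ∪ Set.Ioi m) := fun α _ => by
    rcases le_or_gt α 0 with h | h
    · exact Or.inl h
    · rcases le_or_gt α m with h' | h'
      · exact Or.inr (Or.inl ⟨h, h'⟩)
      · exact Or.inr (Or.inr h')
  refine (lintegral_mono_set h).trans ((lintegral_union_le _ _ _).trans ?_)
  rw [setLIntegral_measure_zero _ _ hπ, zero_add]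
  exact lintegral_union_le _ _ _

theorem ofReal_prod_marginalLik (hg : BoundedSupportKernel a b g) (hab : a < b)
    (hq₀ : BoundedBaseDensity q₀) (x : Fin n → ℝ) (P : Finset (Finset (Fin n))) :
    ENNReal.ofReal (∏ B ∈ P, marginalLik g q₀ x B) = ∏ B ∈ P, marginalLikE g q₀ x B := by
  rw [ENNReal.ofReal_prod_of_nonneg fun B _ => marginalLik_nonneg hg hq₀ x B]
  exact Finset.prod_congr rfl fun B _ => ofReal_marginalLik hg hab hq₀ x B

/-- Small concentrations keep the constraint of more than t blocks, which produces the gain of one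
factor α. For large ones the constraint is dropped, the full Ewens sum being enough. -/
theorem ofReal_sum_jointDensity_le [IsProbabilityMeasure π] (hg : BoundedSupportKernel a b g)
    (hab : a < b) (hq₀ : BoundedBaseDensity q₀) (hπ : π (Set.Iic 0) = 0) (x : Fin n → ℝ)
    (t : ℕ) (m : ℝ) :
    ENNReal.ofReal (∑ s ∈ Finset.Ioc t n, jointDensity g q₀ π x s) ≤
      (∑ P ∈ (setPartitions Finset.univ).filter (fun P => t < P.card),
        priorMass π n (Set.Ioc 0 m) P * ∏ B ∈ P, marginalLikE g q₀ x B) +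
      ∑ P ∈ setPartitions Finset.univ,
        priorMass π n (Set.Ioi m) P * ∏ B ∈ P, marginalLikE g q₀ x B := by
  have h1 : ∑ s ∈ Finset.Ioc t n, jointDensity g q₀ π x s =
      ∑ P ∈ (setPartitions (Finset.univ : Finset (Fin n))).filter (fun P => t < P.card),
        priorWeight π n P * ∏ B ∈ P, marginalLik g q₀ x B := by
    rw [← Finset.sum_fiberwise_of_maps_to (t := Finset.Ioc t n) (g := Finset.card)]
    · refine Finset.sum_congr rfl fun s hs => ?_
      rw [jointDensity_eq]
      refine Finset.sum_congr ?_ fun _ _ => rfl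
      ext P
      rw [Finset.mem_Ioc] at hs
      simp only [Finset.mem_filter, mem_setPartitionsInto]
      constructor
      · rintro ⟨h1, rfl⟩
        exact ⟨⟨h1, hs.1⟩, rfl⟩
      · rintro ⟨⟨h1, -⟩, h2⟩
        exact ⟨h1, h2⟩
    · intro P hP
      rw [Finset.mem_filter] at hP
      have := card_le_of_mem_setPartitions hP.1
      rw [Finset.card_univ, Fintype.card_fin] at this
      exact Finset.mem_Ioc.2 ⟨hP.2, this⟩
  have hM0 : ∀ P : Finset (Finset (Fin n)), 0 ≤ ∏ B ∈ P, marginalLik g q₀ x B := fun P =>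
    Finset.prod_nonneg fun B _ => marginalLik_nonneg hg hq₀ x B
  rw [h1, ENNReal.ofReal_sum_of_nonneg fun P _ => mul_nonneg (priorWeight_nonneg hπ n P) (hM0 P)]
  calc _ ≤ ∑ P ∈ (setPartitions Finset.univ).filter (fun P => t < P.card),
        (priorMass π n (Set.Ioc 0 m) P * ∏ B ∈ P, marginalLikE g q₀ x B +
          priorMass π n (Set.Ioi m) P * ∏ B ∈ P, marginalLikE g q₀ x B) := by
        refine Finset.sum_le_sum fun P hP => ?_
        rw [ENNReal.ofReal_mul (priorWeight_nonneg hπ n P),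
          ofReal_priorWeight hπ (Finset.mem_filter.1 hP).1,
          ofReal_prod_marginalLik hg hab hq₀, ← add_mul]
        gcongr
        exact priorMass_univ_le hπ m P
    _ ≤ _ := by
        rw [Finset.sum_add_distrib]
        gcongr
        exact Finset.filter_subset _ _

/-- Lower bound for the marginal likelihood of all observations from one component. -/
theorem le_marginalLik (hg : BoundedSupportKernel a b g) (hab : a < b)
    (hq₀ : BoundedBaseDensity q₀) {L : ℝ} (hL0 : 0 ≤ L)
    (hL : ∀ x ∈ Set.Ioo a b, ∀ y ∈ Set.Ioo a b, g x * Real.exp (-(L * |x - y|)) ≤ g y)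
    {θ₀ r l e : ℝ} (hl : 0 < l) (hr : ∀ y, |y - θ₀| < r → l ≤ q₀ y) (he : 0 < e) (her : e ≤ r)
    (hn : 1 ≤ n) (x : Fin n → ℝ) (B : Finset (Fin n))
    (hx : ∀ i ∈ B, x i ∈ Set.Ioo (θ₀ + a + e / n) (θ₀ + b)) :
    Real.exp (-(L * e)) * l * (e / n) * ∏ i ∈ B, g (x i - θ₀) ≤ marginalLik g q₀ x B := by
  have hn0 : (0 : ℝ) < n := by exact_mod_cast hn
  have hn1 : (1 : ℝ) ≤ n := by exact_mod_cast hn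
  have hen : e / n ≤ e := div_le_self he.le hn1
  have hen0 : 0 < e / n := by positivity
  have hg0 := hg.isDensity.nonneg
  -- The parameter is restricted to a window of width e/n to the right of θ₀. Each observation loses
  -- at most exp(-L e/n) there, hence the block at most exp(-L e); the left margin e/n in `hx` keeps
  -- every x_i - θ inside (a, b).
  have key := mul_le_integral_of_le_on_Ioo (u := θ₀) (v := θ₀ + e / n)
    (κ := (Real.exp (-(L * e)) * ∏ i ∈ B, g (x i - θ₀)) * l)
    (integrable_marginalLik hg hab hq₀ x B) (marginalLik_integrand_nonneg hg hq₀ x B)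
    (by linarith) fun θ hθ => ?_
  · rw [add_sub_cancel_left] at key
    refine le_trans (le_of_eq ?_) key
    ring
  · refine mul_le_mul ?_ (hr θ ?_) hl.le (Finset.prod_nonneg fun i _ => hg0 _)
    · calc Real.exp (-(L * e)) * ∏ i ∈ B, g (x i - θ₀)
          ≤ Real.exp (-(L * (e / n))) ^ B.card * ∏ i ∈ B, g (x i - θ₀) := by
            refine mul_le_mul_of_nonneg_right ?_ (Finset.prod_nonneg fun i _ => hg0 _)
            rw [← Real.exp_nat_mul]
            refine Real.exp_le_exp.2 ?_
            have hB : (B.card : ℝ) ≤ n := by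
              have := Finset.card_le_univ B
              rw [Fintype.card_fin] at this
              exact_mod_cast this
            have h1 : (B.card : ℝ) * (L * (e / n)) ≤ n * (L * (e / n)) :=
              mul_le_mul_of_nonneg_right hB (by positivity)
            have h2 : (n : ℝ) * (L * (e / n)) = L * e := by field_simp
            linarith
        _ = ∏ i ∈ B, g (x i - θ₀) * Real.exp (-(L * (e / n))) := by
            rw [Finset.prod_mul_distrib, Finset.prod_const, mul_comm]
        _ ≤ ∏ i ∈ B, g (x i - θ) := by
            refine Finset.prod_le_prod (fun i _ => mul_nonneg (hg0 _) (Real.exp_pos _).le)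
              fun i hi => ?_
            have hxi := hx i hi
            refine le_trans (mul_le_mul_of_nonneg_left (Real.exp_le_exp.2 ?_) (hg0 _))
              (hL (x i - θ₀) ⟨by linarith [hxi.1], by linarith [hxi.2]⟩ (x i - θ)
                ⟨by linarith [hxi.1, hθ.2], by linarith [hxi.2, hθ.1]⟩)
            refine neg_le_neg (mul_le_mul_of_nonneg_left ?_ hL0)
            rw [abs_le]
            constructor
            · linarith [hθ.1]
            · linarith [hθ.2]
    · rw [abs_lt]
      exact ⟨by linarith [hθ.1], by linarith [hθ.2]⟩

/-- Lower bound for the joint density, from the partition by components. -/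
theorem le_jointDensity [IsProbabilityMeasure π] (hg : BoundedSupportKernel a b g) (hab : a < b)
    (hq₀ : BoundedBaseDensity q₀) (hπ : π (Set.Iic 0) = 0) {L : ℝ} (hL0 : 0 ≤ L)
    (hL : ∀ x ∈ Set.Ioo a b, ∀ y ∈ Set.Ioo a b, g x * Real.exp (-(L * |x - y|)) ≤ g y)
    {t : ℕ} {θ' : Fin t → ℝ} {r l e δ : ℝ} (hl : 0 < l)
    (hr : ∀ j y, |y - θ' j| < r → l ≤ q₀ y) (he : 0 < e) (her : e ≤ r) (hδ : 0 < δ)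
    (hn : 1 ≤ n) (x : Fin n → ℝ) (c : Fin n → Fin t)
    (hx : ∀ i, x i ∈ Set.Ioo (θ' (c i) + a + e / n) (θ' (c i) + b))
    (hcount : ∀ j, δ * n ≤ labelCount c Finset.univ j) :
    ENNReal.ofReal ((Real.exp (-(L * e)) * l * e * δ) ^ t * labelWeight c Finset.univ) *
      priorFactor π t n * ∏ i, ENNReal.ofReal (g (x i - θ' (c i))) ≤
        ENNReal.ofReal (jointDensity g q₀ π x t) := by
  classical
  have hn0 : (0 : ℝ) < n := by exact_mod_cast hn
  have hg0 := hg.isDensity.nonneg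
  set A : Fin t → Finset (Fin n) := fun j => Finset.univ.filter fun i => c i = j with hA
  have hcard : ∀ j, (A j).card = labelCount c Finset.univ j := fun j => rfl
  have hcpos : ∀ j, 0 < labelCount c Finset.univ j := fun j => by
    have : (0 : ℝ) < labelCount c Finset.univ j := (by positivity : 0 < δ * n).trans_le (hcount j)
    exact_mod_cast this
  have hne : ∀ j, (A j).Nonempty := fun j => Finset.card_pos.1 (hcpos j)
  have hmemA : ∀ i j, i ∈ A j ↔ c i = j := fun i j => by simp [hA]
  have hinj : Function.Injective A := by
    intro j k hjk
    obtain ⟨i, hi⟩ := hne j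
    exact ((hmemA i j).1 hi).symm.trans ((hmemA i k).1 (hjk ▸ hi))
  set P := Finset.univ.image A with hP
  have hprodP : ∀ {M : Type} [CommMonoid M] (F : Finset (Fin n) → M),
      ∏ B ∈ P, F B = ∏ j, F (A j) := fun F => Finset.prod_image fun j _ k _ h => hinj h
  have hPc : P.card = t := by
    rw [hP, Finset.card_image_of_injective _ hinj, Finset.card_univ, Fintype.card_fin]
  have hPmem : P ∈ setPartitions Finset.univ := by
    refine mem_setPartitions.2 ⟨?_, ?_, ?_⟩
    · intro B hB B' hB' hne
      simp only [hP, Finset.coe_image, Finset.coe_univ, Set.image_univ, Set.mem_range] at hB hB'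
      obtain ⟨j, rfl⟩ := hB
      obtain ⟨k, rfl⟩ := hB'
      refine Finset.disjoint_left.2 fun i hi hi' => hne ?_
      rw [← (hmemA i j).1 hi, ← (hmemA i k).1 hi']
    · intro h
      obtain ⟨j, -, hj⟩ := Finset.mem_image.1 h
      exact (hne j).ne_empty hj
    · ext i
      simp only [Finset.mem_sup, id, Finset.mem_univ, iff_true]
      exact ⟨A (c i), Finset.mem_image_of_mem _ (Finset.mem_univ _), (hmemA i _).2 rfl⟩
  set κ := Real.exp (-(L * e)) * l * e with hκ
  have hκ0 : 0 < κ := by positivity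
  have hterm : ENNReal.ofReal (priorWeight π n P * ∏ B ∈ P, marginalLik g q₀ x B) ≤
      ENNReal.ofReal (jointDensity g q₀ π x t) := by
    rw [jointDensity_eq]
    refine ENNReal.ofReal_le_ofReal (Finset.single_le_sum
      (f := fun P => priorWeight π n P * ∏ B ∈ P, marginalLik g q₀ x B) (fun Q _ =>
        mul_nonneg (priorWeight_nonneg hπ n Q)
          (Finset.prod_nonneg fun B _ => marginalLik_nonneg hg hq₀ x B))
      (mem_setPartitionsInto.2 ⟨hPmem, hPc⟩))
  have hprior : priorMass π n Set.univ P =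
      priorFactor π t n * ENNReal.ofReal (∏ j, ((labelCount c Finset.univ j - 1).factorial : ℝ)) := by
    rw [priorMass, Measure.restrict_univ, hPc, hprodP, priorFactor,
      ← lintegral_mul_const _ (measurable_ewensFactor t n).ennreal_ofReal]
    exact lintegral_congr fun α => ENNReal.ofReal_mul' (Finset.prod_nonneg fun _ _ => by positivity)
  have hmarg : ∏ j, (κ / n * ∏ i ∈ A j, g (x i - θ' (c i))) ≤ ∏ B ∈ P, marginalLik g q₀ x B := by
    rw [hprodP]
    refine Finset.prod_le_prod (fun j _ => mul_nonneg (by positivity)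
      (Finset.prod_nonneg fun i _ => hg0 _)) fun j _ => ?_
    have h1 := le_marginalLik hg hab hq₀ hL0 hL hl (hr j) he her hn x (A j) fun i hi => by
      rw [← (hmemA i j).1 hi]
      exact hx i
    refine le_trans (le_of_eq ?_) h1
    rw [Finset.prod_congr rfl fun i hi => by rw [(hmemA i j).1 hi]]
    rw [hκ]
    ring
  have hsplit : ∏ j, ∏ i ∈ A j, g (x i - θ' (c i)) = ∏ i, g (x i - θ' (c i)) :=
    Finset.prod_fiberwise Finset.univ c fun i => g (x i - θ' (c i))
  -- For a component with N ≥ δ n observations, (N-1)!/n is at least δ N!/(N+1)², because N² ≤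
  -- (N+1)². The width 1/n of the parameter window thus has exactly the order of the weight.
  have hweights : (κ * δ) ^ t * labelWeight c Finset.univ ≤
      (∏ j, ((labelCount c Finset.univ j - 1).factorial : ℝ)) * ∏ _j : Fin t, κ / n := by
    rw [labelWeight, ← Finset.prod_mul_distrib]
    calc (κ * δ) ^ t * ∏ j, sizeWeight (labelCount c Finset.univ j)
        = ∏ j, κ * δ * sizeWeight (labelCount c Finset.univ j) := by
          rw [Finset.prod_mul_distrib, Finset.prod_const, Finset.card_univ, Fintype.card_fin]
      _ ≤ _ := by
          refine Finset.prod_le_prod (fun j _ => mul_nonneg (by positivity) (sizeWeight_pos _).le)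
            fun j _ => ?_
          obtain ⟨k, hk⟩ : ∃ k, labelCount c Finset.univ j = k + 1 :=
            Nat.exists_eq_succ_of_ne_zero (hcpos j).ne'
          have hj := hcount j
          rw [hk] at hj ⊢
          push_cast at hj
          rw [sizeWeight, Nat.add_sub_cancel, Nat.factorial_succ]
          push_cast
          have hfac : (0 : ℝ) < k.factorial := by positivity
          have h1 : δ * (((k : ℝ) + 1) * (1 / (k + 1 + 1) ^ 2)) ≤ 1 / n := by
            rw [le_div_iff₀ hn0]
            calc δ * (((k : ℝ) + 1) * (1 / (k + 1 + 1) ^ 2)) * n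
                = δ * n * (((k : ℝ) + 1) * (1 / (k + 1 + 1) ^ 2)) := by ring
              _ ≤ (k + 1) * (((k : ℝ) + 1) * (1 / (k + 1 + 1) ^ 2)) := by gcongr
              _ = (((k : ℝ) + 1) / (k + 1 + 1)) ^ 2 := by
                  field_simp
              _ ≤ 1 := by
                  refine pow_le_one₀ (by positivity) ((div_le_one (by positivity)).2 ?_)
                  linarith
          calc _ = k.factorial * κ * (δ * (((k : ℝ) + 1) * (1 / (k + 1 + 1) ^ 2))) := by ring
            _ ≤ k.factorial * κ * (1 / n) := by gcongr
            _ = _ := by ring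
  refine le_trans ?_ hterm
  rw [ENNReal.ofReal_mul (priorWeight_nonneg hπ n P), ofReal_priorWeight hπ hPmem, hprior]
  calc _ ≤ ENNReal.ofReal ((∏ j, ((labelCount c Finset.univ j - 1).factorial : ℝ)) *
          ∏ _j : Fin t, κ / n) * priorFactor π t n *
          ENNReal.ofReal (∏ i, g (x i - θ' (c i))) := by
        rw [ENNReal.ofReal_prod_of_nonneg fun i _ => hg0 _]
        gcongr
    _ = priorFactor π t n *
        ENNReal.ofReal (∏ j, ((labelCount c Finset.univ j - 1).factorial : ℝ)) *
        ENNReal.ofReal (∏ j, (κ / n * ∏ i ∈ A j, g (x i - θ' (c i)))) := by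
        rw [Finset.prod_mul_distrib, hsplit, ENNReal.ofReal_mul (Finset.prod_nonneg fun _ _ =>
          by positivity), ENNReal.ofReal_mul (p := ∏ _j : Fin t, κ / n)
          (Finset.prod_nonneg fun _ _ => by positivity)]
        ring
    _ ≤ _ := by gcongr

theorem abs_div_add_sub_one_lt {J N ε : ℝ} (hJ : 0 < J) (hN : 0 ≤ N) (h : N < ε * J) :
    |J / (J + N) - 1| < ε := by
  have hs : 0 < J + N := by linarith
  have h1 : J / (J + N) - 1 = -(N / (J + N)) := by
    rw [div_sub_one hs.ne', ← neg_div]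
    ring_nf
  have hε : 0 < ε := by
    by_contra hε
    linarith [mul_nonpos_of_nonpos_of_nonneg (not_lt.1 hε) hJ.le]
  rw [h1, abs_neg, abs_of_nonneg (div_nonneg hN hs.le), div_lt_iff₀ hs]
  linarith [mul_nonneg hε.le hN]

theorem abs_posteriorClusters_sub_one_lt (hg : BoundedSupportKernel a b g)
    (hq₀ : BoundedBaseDensity q₀) (hπ : π (Set.Iic 0) = 0) (x : Fin n → ℝ) {t : ℕ} (htn : t ≤ n)
    (hlow : ∀ s < t, jointDensity g q₀ π x s = 0) (hpos : 0 < jointDensity g q₀ π x t) {ε : ℝ}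
    (hN : ∑ s ∈ Finset.Ioc t n, jointDensity g q₀ π x s < ε * jointDensity g q₀ π x t) :
    |posteriorClusters g q₀ π x t - 1| < ε := by
  set N := ∑ s ∈ Finset.Ioc t n, jointDensity g q₀ π x s with hNdef
  have hN0 : 0 ≤ N := Finset.sum_nonneg fun s _ => jointDensity_nonneg hg hq₀ hπ x s
  have hsum : ∑ r ∈ Finset.range (n + 1), jointDensity g q₀ π x r =
      jointDensity g q₀ π x t + N := by
    rw [hNdef, ← Finset.sum_insert (s := Finset.Ioc t n) (by simp)]
    symm
    refine Finset.sum_subset (fun s hs => ?_) fun s hs hs' => hlow s ?_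
    · simp only [Finset.mem_insert, Finset.mem_Ioc, Finset.mem_range] at hs ⊢
      omega
    · simp only [Finset.mem_insert, Finset.mem_Ioc, Finset.mem_range] at hs hs'
      omega
  rw [posteriorClusters, hsum]
  exact abs_div_add_sub_one_lt hpos hN0 hN

end Pointwise

/-! ### Events of high probability under the true mixture -/

section Events

variable {a b : ℝ} {g q₀ : ℝ → ℝ} {t : ℕ} {p θ' : Fin t → ℝ}

theorem mixtureDensity_eq (hg : BoundedSupportKernel a b g)
    (hsep : ∀ j k, j ≠ k → b - a < |θ' j - θ' k|) {x : ℝ} {j : Fin t}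
    (hx : x ∈ Set.Ioo (θ' j + a) (θ' j + b)) :
    mixtureDensity g p θ' x = ENNReal.ofReal (p j) * ENNReal.ofReal (g (x - θ' j)) := by
  rw [mixtureDensity, Finset.sum_eq_single j]
  · intro k _ hk
    rw [hg.zero_off, ENNReal.ofReal_zero, mul_zero]
    rintro ⟨h1, h2⟩
    rcases lt_abs.1 (hsep k j hk) with h | h
    · linarith [hx.1, hx.2]
    · linarith [hx.1, hx.2]
  · simp

theorem mixture_Ioc_le (hg : BoundedSupportKernel a b g) {M : ℝ} (hM : ∀ x, g x ≤ M)
    (hp : ∀ j, 0 < p j) (hp1 : ∑ j, p j = 1) (u v : ℝ) :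
    mixture g p θ' (Set.Ioc u v) ≤ ENNReal.ofReal (M * (v - u)) := by
  have hM0 : 0 ≤ M := (hg.isDensity.nonneg 0).trans (hM 0)
  rw [mixture_eq_withDensity hg.isDensity.measurable, withDensity_apply _ measurableSet_Ioc]
  calc _ ≤ ∫⁻ _ in Set.Ioc u v, ENNReal.ofReal M := by
        refine lintegral_mono fun x => ?_
        calc mixtureDensity g p θ' x ≤ ∑ j, ENNReal.ofReal (p j) * ENNReal.ofReal M := by
              unfold mixtureDensity
              gcongr
              exact hM _
          _ = ENNReal.ofReal M := by
              rw [← Finset.sum_mul, ← ENNReal.ofReal_sum_of_nonneg fun j _ => (hp j).le, hp1,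
                ENNReal.ofReal_one, one_mul]
    _ = _ := by
        rw [setLIntegral_const, Real.volume_Ioc, ENNReal.ofReal_mul hM0]

theorem mixture_Ioo_pos (hg : BoundedSupportKernel a b g) (hp : ∀ j, 0 < p j) (j : Fin t)
    {u v : ℝ} (huv : u < v) (hu : θ' j + a ≤ u) (hv : v ≤ θ' j + b) :
    0 < mixture g p θ' (Set.Ioo u v) := by
  obtain ⟨m, hm0, hm⟩ := hg.pos_on
  rw [mixture_eq_withDensity hg.isDensity.measurable, withDensity_apply _ measurableSet_Ioo]
  have hpos : 0 < ENNReal.ofReal (p j) * ENNReal.ofReal m * ENNReal.ofReal (v - u) := by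
    rw [← ENNReal.ofReal_mul (hp j).le, ← ENNReal.ofReal_mul (mul_pos (hp j) hm0).le,
      ENNReal.ofReal_pos]
    exact mul_pos (mul_pos (hp j) hm0) (sub_pos.2 huv)
  refine hpos.trans_le ?_
  rw [← Real.volume_Ioo, ← setLIntegral_const]
  refine setLIntegral_mono' measurableSet_Ioo fun x hx => ?_
  calc ENNReal.ofReal (p j) * ENNReal.ofReal m
      ≤ ENNReal.ofReal (p j) * ENNReal.ofReal (g (x - θ' j)) := by
        gcongr
        exact hm _ ⟨by linarith [hx.1], by linarith [hx.2]⟩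
    _ ≤ mixtureDensity g p θ' x :=
        Finset.single_le_sum (f := fun j => ENNReal.ofReal (p j) * ENNReal.ofReal (g (x - θ' j)))
          (fun _ _ => zero_le) (Finset.mem_univ j)

variable {Ω : Type*} [MeasurableSpace Ω] {μ : Measure Ω}
  {X : ℕ → Ω → ℝ} {P : Measure ℝ}

open Classical in
/-- Law of large numbers for the number of visits to a set of positive probability. -/
theorem IsIIDSample.tendsto_measure_card_lt [IsProbabilityMeasure μ] (hX : IsIIDSample μ X P) {E : Set ℝ}
    (hE : MeasurableSet E) (hPE : 0 < P.real E) :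
    Tendsto (fun n : ℕ => μ {ω | (((Finset.univ : Finset (Fin n)).filter
      fun i : Fin n => X i ω ∈ E).card : ℝ) < P.real E / 2 * n}) atTop (𝓝 0) := by
  set q := P.real E with hq
  set Y : ℕ → Ω → ℝ := fun i ω => E.indicator 1 (X i ω) with hY
  have hφ : Measurable (E.indicator (1 : ℝ → ℝ)) := measurable_one.indicator hE
  have hYm : ∀ i, Measurable (Y i) := fun i => hφ.comp (hX.measurable i)
  have hind : Pairwise (Function.onFun (IndepFun · · μ) Y) := fun i k hik =>
    (hX.indep.indepFun hik).comp hφ hφ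
  have hid : ∀ i, IdentDistrib (Y i) (Y 0) μ μ := fun i =>
    IdentDistrib.comp (⟨(hX.measurable i).aemeasurable, (hX.measurable 0).aemeasurable,
      by rw [hX.law, hX.law]⟩ : IdentDistrib (X i) (X 0) μ μ) hφ
  have hint : Integrable (Y 0) μ := by
    refine Integrable.of_bound (hYm 0).aestronglyMeasurable 1 (ae_of_all _ fun ω => ?_)
    by_cases h : X 0 ω ∈ E <;> simp [hY, h]
  have hmean : ∫ ω, Y 0 ω ∂μ = q := by
    rw [hq, ← hX.law 0, ← integral_indicator_one hE,
      integral_map (hX.measurable 0).aemeasurable hφ.aestronglyMeasurable]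
  have hslln := strong_law_ae_real Y hint hind hid
  rw [hmean] at hslln
  have havg : ∀ n : ℕ, AEStronglyMeasurable
      (fun ω => (∑ i ∈ Finset.range n, Y i ω) / (n : ℝ)) μ := fun n =>
    Measurable.aestronglyMeasurable (by fun_prop)
  have hmeas := tendstoInMeasure_of_tendsto_ae havg hslln
  rw [tendstoInMeasure_iff_norm] at hmeas
  refine tendsto_of_tendsto_of_tendsto_of_le_of_le tendsto_const_nhds (hmeas (q / 2) (by positivity))
    (fun _ => zero_le) fun n => measure_mono fun ω hω => ?_
  rw [Set.mem_ofPred_eq] at hω ⊢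
  have hcard : (((Finset.univ : Finset (Fin n)).filter fun i : Fin n => X i ω ∈ E).card : ℝ) =
      ∑ i ∈ Finset.range n, Y i ω := by
    rw [← Fin.sum_univ_eq_sum_range (fun i => Y i ω), Finset.card_filter]
    push_cast
    refine Finset.sum_congr rfl fun i _ => ?_
    by_cases h : X i ω ∈ E <;> simp [hY, h]
  rw [hcard] at hω
  rcases n.eq_zero_or_pos with rfl | hn
  · simp at hω
  have hn0 : (0 : ℝ) < n := by exact_mod_cast hn
  rw [← div_lt_iff₀ hn0] at hω
  rw [Real.norm_eq_abs, le_abs]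
  right
  linarith

theorem IsIIDSample.measure_exists_mem_le (hX : IsIIDSample μ X P) {E : Set ℝ}
    (hE : MeasurableSet E) (n : ℕ) :
    μ {ω | ∃ i : Fin n, X i ω ∈ E} ≤ n * P E := by
  calc μ {ω | ∃ i : Fin n, X i ω ∈ E} = μ (⋃ i : Fin n, X i ⁻¹' E) := by
        congr 1
        ext ω
        simp
    _ ≤ ∑ i : Fin n, μ (X i ⁻¹' E) := measure_iUnion_fintype_le _ _
    _ = n * P E := by
        have h : ∀ i : Fin n, μ (X i ⁻¹' E) = P E := fun i => by
          rw [← hX.law i, Measure.map_apply (hX.measurable i) hE]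
        simp [h]

end Events

/-! ### From the joint densities to the posterior -/

section Posterior

variable {a b : ℝ} {g q₀ : ℝ → ℝ} {t n : ℕ} {p θ' : Fin t → ℝ} {π : Measure ℝ}

/-- Finiteness of V_n is what allows cancelling it in Markov's inequality. Here α^t ≤ α^(t), and the
later factors of α^(n) are at least 1 because t ≥ 1. -/
theorem priorFactor_le_one [IsProbabilityMeasure π] (hπ : π (Set.Iic 0) = 0) (ht : 1 ≤ t)
    (htn : t ≤ n) : priorFactor π t n ≤ 1 := by
  have hpos : ∀ᵐ α ∂π, 0 < α := by
    filter_upwards [measure_eq_zero_iff_ae_notMem.1 hπ] with α hα using not_le.1 hα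
  calc priorFactor π t n ≤ ∫⁻ _, 1 ∂π := lintegral_mono_ae <| by
        filter_upwards [hpos] with α hα
        rw [ENNReal.ofReal_le_one]
        refine div_le_one_of_le₀ ?_ (ascPochhammer_eval_nonneg hα.le n)
        induction n, htn using Nat.le_induction with
        | base =>
          rw [ascPochhammer_eval_eq_prod, ← Finset.card_range t, ← Finset.prod_const,
            Finset.card_range]
          exact Finset.prod_le_prod (fun _ _ => hα.le) fun i _ => by
            linarith [(i.cast_nonneg : (0 : ℝ) ≤ i)]
        | succ n htn ih =>
          rw [ascPochhammer_succ_eval]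
          have hn : (1 : ℝ) ≤ n := by exact_mod_cast ht.trans htn
          exact ih.trans (le_mul_of_one_le_right (ascPochhammer_eval_nonneg hα.le n)
            (by linarith))
    _ = 1 := by simp

/-- One term of the multinomial expansion of (∑ p_j)^n = 1, with at most (n + 1)² lost per label. It
makes the threshold for large concentrations independent of c, so that this event is counted once
and not once per label vector. -/
theorem factorial_mul_prod_le (hp : ∀ j, 0 < p j) (hp1 : ∑ j, p j = 1) (c : Fin n → Fin t) :
    (n.factorial : ℝ) / ((n : ℝ) + 1) ^ (2 * t) ≤ labelWeight c Finset.univ / ∏ i, p (c i) := by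
  have h1 := factorial_mul_prod_pow_le p (fun j => (hp j).le) c Finset.univ
  rw [hp1, one_pow, mul_one, Finset.card_univ, Fintype.card_fin] at h1
  have hprod : 0 < ∏ i, p (c i) := Finset.prod_pos fun i _ => hp _
  rw [div_le_div_iff₀ (by positivity) hprod]
  refine h1.trans ?_
  have hpow : ((n : ℝ) + 1) ^ (2 * t) = ∏ _j : Fin t, ((n : ℝ) + 1) ^ 2 := by
    rw [Finset.prod_const, Finset.card_univ, Fintype.card_fin, pow_mul]
  rw [labelWeight, hpow, ← Finset.prod_mul_distrib]
  refine Finset.prod_le_prod (fun j _ => by positivity) fun j _ => ?_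
  have h2 : (labelCount c Finset.univ j : ℝ) ≤ n := by
    have := Finset.card_le_univ ((Finset.univ : Finset (Fin n)).filter fun i => c i = j)
    rw [Fintype.card_fin] at this
    exact_mod_cast this
  rw [sizeWeight, mul_assoc]
  refine le_mul_of_one_le_right (by positivity) ?_
  rw [one_div, inv_mul_eq_div, one_le_div (by positivity)]
  gcongr

/-- If the posterior is far from one, then one of two weighted likelihoods is large. -/
theorem le_or_le_of_le_abs_posterior_sub_one [IsProbabilityMeasure π]
    (hg : BoundedSupportKernel a b g) (hab : a < b) (hq₀ : BoundedBaseDensity q₀)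
    (hπ : π (Set.Iic 0) = 0) (hp : ∀ j, 0 < p j) (hp1 : ∑ j, p j = 1)
    (hsep : ∀ j k, j ≠ k → b - a < |θ' j - θ' k|) (htn : t ≤ n)
    (hV0 : priorFactor π t n ≠ 0) {x : Fin n → ℝ} {c : Fin n → Fin t}
    (hx : ∀ i, x i ∈ Set.Ioo (θ' (c i) + a) (θ' (c i) + b)) {κ : ℝ} (hκ : 0 < κ)
    (hJ : ENNReal.ofReal (κ * labelWeight c Finset.univ) * priorFactor π t n *
      ∏ i, ENNReal.ofReal (g (x i - θ' (c i))) ≤ ENNReal.ofReal (jointDensity g q₀ π x t))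
    (hlow : ∀ s < t, jointDensity g q₀ π x s = 0) {ε : ℝ} (hε : 0 < ε)
    (hpost : ε ≤ |posteriorClusters g q₀ π x t - 1|) (m : ℝ) :
    ENNReal.ofReal (ε / 2 * κ * (labelWeight c Finset.univ / ∏ i, p (c i))) * priorFactor π t n ≤
      (∑ P ∈ (setPartitions Finset.univ).filter (fun P => t < P.card),
        priorMass π n (Set.Ioc 0 m) P * ∏ B ∈ P, marginalLikE g q₀ x B) *
      ∏ i, ((Set.Ioo (θ' (c i) + a) (θ' (c i) + b)).indicator 1 (x i) *
        (mixtureDensity g p θ' (x i))⁻¹) ∨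
    ENNReal.ofReal (ε / 2 * κ * (n.factorial / ((n : ℝ) + 1) ^ (2 * t))) * priorFactor π t n ≤
      (∑ P ∈ setPartitions Finset.univ,
        priorMass π n (Set.Ioi m) P * ∏ B ∈ P, marginalLikE g q₀ x B) *
      ∏ i, (Set.univ.indicator 1 (x i) * (mixtureDensity g p θ' (x i))⁻¹) := by
  obtain ⟨m₀, hm₀, hgm⟩ := hg.pos_on
  have hgpos : ∀ i, 0 < g (x i - θ' (c i)) := fun i =>
    hm₀.trans_le (hgm _ ⟨by linarith [(hx i).1], by linarith [(hx i).2]⟩)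
  have hW := labelWeight_pos c (Finset.univ : Finset (Fin n))
  have hprod : 0 < ∏ i, p (c i) := Finset.prod_pos fun i _ => hp _
  have hGpos : 0 < ∏ i, g (x i - θ' (c i)) := Finset.prod_pos fun i _ => hgpos i
  rw [← ENNReal.ofReal_prod_of_nonneg fun i _ => (hgpos i).le] at hJ
  have hJpos : 0 < jointDensity g q₀ π x t := by
    rw [← ENNReal.ofReal_pos]
    refine lt_of_lt_of_le (pos_iff_ne_zero.2 ?_) hJ
    exact mul_ne_zero (mul_ne_zero (ENNReal.ofReal_pos.2 (mul_pos hκ hW)).ne' hV0)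
      (ENNReal.ofReal_pos.2 hGpos).ne'
  set N := ∑ s ∈ Finset.Ioc t n, jointDensity g q₀ π x s with hN
  have hNJ : ε * jointDensity g q₀ π x t ≤ N := by
    by_contra! h
    exact absurd hpost (not_le.2 (abs_posteriorClusters_sub_one_lt hg hq₀ hπ x htn hlow hJpos h))
  set N₁ := ∑ P ∈ (setPartitions Finset.univ).filter (fun P => t < P.card),
    priorMass π n (Set.Ioc 0 m) P * ∏ B ∈ P, marginalLikE g q₀ x B with hN₁
  set N₂ := ∑ P ∈ setPartitions Finset.univ,
    priorMass π n (Set.Ioi m) P * ∏ B ∈ P, marginalLikE g q₀ x B with hN₂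
  have hNN : ENNReal.ofReal N ≤ N₁ + N₂ := ofReal_sum_jointDensity_le hg hab hq₀ hπ x t m
  set H := ∏ i, (mixtureDensity g p θ' (x i))⁻¹ with hH
  have hH1 : ∏ i, ((Set.Ioo (θ' (c i) + a) (θ' (c i) + b)).indicator 1 (x i) *
      (mixtureDensity g p θ' (x i))⁻¹) = H :=
    Finset.prod_congr rfl fun i _ => by rw [Set.indicator_of_mem (hx i), Pi.one_apply, one_mul]
  have hH2 : ∏ i, (Set.univ.indicator 1 (x i) * (mixtureDensity g p θ' (x i))⁻¹) = H :=
    Finset.prod_congr rfl fun i _ => by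
      rw [Set.indicator_of_mem (Set.mem_univ _), Pi.one_apply, one_mul]
  -- By separation only the component c_i has mass at x_i. The kernel product cancels against the
  -- one in the lower bound for J_t, and only ∏ p(c_i) stays in the denominator.
  have hHval : H = ENNReal.ofReal ((∏ i, p (c i)) * ∏ i, g (x i - θ' (c i)))⁻¹ := by
    rw [← Finset.prod_mul_distrib, ← Finset.prod_inv_distrib,
      ENNReal.ofReal_prod_of_nonneg fun i _ => (inv_pos.2 (mul_pos (hp _) (hgpos i))).le]
    refine Finset.prod_congr rfl fun i _ => ?_
    rw [mixtureDensity_eq hg hsep (hx i), ← ENNReal.ofReal_mul (hp _).le,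
      ENNReal.ofReal_inv_of_pos (mul_pos (hp _) (hgpos i))]
  set V := priorFactor π t n
  set W := labelWeight c (Finset.univ : Finset (Fin n)) with hWdef
  have hkey : ENNReal.ofReal (ε * κ * (W / ∏ i, p (c i))) * V ≤ N₁ * H + N₂ * H := by
    calc _ = ENNReal.ofReal ε * (ENNReal.ofReal (κ * W) * V *
          ENNReal.ofReal (∏ i, g (x i - θ' (c i)))) * H := by
          rw [hHval]
          have h1 : ENNReal.ofReal ε * (ENNReal.ofReal (κ * W) * V *
              ENNReal.ofReal (∏ i, g (x i - θ' (c i)))) *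
              ENNReal.ofReal ((∏ i, p (c i)) * ∏ i, g (x i - θ' (c i)))⁻¹ =
              (ENNReal.ofReal ε * ENNReal.ofReal (κ * W) *
              ENNReal.ofReal (∏ i, g (x i - θ' (c i))) *
              ENNReal.ofReal ((∏ i, p (c i)) * ∏ i, g (x i - θ' (c i)))⁻¹) * V := by ring
          rw [h1, ← ENNReal.ofReal_mul hε.le, ← ENNReal.ofReal_mul (by positivity),
            ← ENNReal.ofReal_mul (by positivity)]
          congr 2
          field_simp
      _ ≤ ENNReal.ofReal ε * ENNReal.ofReal (jointDensity g q₀ π x t) * H := by gcongr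
      _ ≤ ENNReal.ofReal N * H := by
          rw [← ENNReal.ofReal_mul hε.le]
          gcongr
      _ ≤ (N₁ + N₂) * H := by gcongr
      _ = _ := add_mul _ _ _
  rw [hH1, hH2]
  -- The threshold of `hkey` is split into two equal halves, one for each range of α; the second
  -- half is lowered to a value free of c.
  by_contra! hcon
  have h2 : N₂ * H < ENNReal.ofReal (ε / 2 * κ * (W / ∏ i, p (c i))) * V := by
    refine hcon.2.trans_le ?_
    exact mul_le_mul' (ENNReal.ofReal_le_ofReal (mul_le_mul_of_nonneg_left
      (factorial_mul_prod_le hp hp1 c) (by positivity))) le_rfl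
  refine absurd hkey (not_le.2 ((ENNReal.add_lt_add hcon.1 h2).trans_le (le_of_eq ?_)))
  rw [← add_mul, ← ENNReal.ofReal_add (by positivity) (by positivity)]
  congr 2
  ring

end Posterior

/-! ### Consistency -/

theorem measure_le_ofReal_div {Ω : Type*} [MeasurableSpace Ω] {μ : Measure Ω} {Y : Ω → ENNReal}
    (hY : Measurable Y) {V : ENNReal} (hV0 : V ≠ 0) (hV : V ≠ ⊤) {x y : ℝ} (hx : 0 < x)
    (h : ∫⁻ ω, Y ω ∂μ ≤ ENNReal.ofReal y * V) :
    μ {ω | ENNReal.ofReal x * V ≤ Y ω} ≤ ENNReal.ofReal (y / x) := by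
  have h1 := (mul_meas_ge_le_lintegral hY (ENNReal.ofReal x * V)).trans h
  rw [mul_right_comm] at h1
  have h2 := (ENNReal.mul_le_mul_iff_left hV0 hV).1 h1
  rw [ENNReal.ofReal_div_of_pos hx, ENNReal.le_div_iff_mul_le
    (Or.inl (ENNReal.ofReal_pos.2 hx).ne') (Or.inl ENNReal.ofReal_ne_top), mul_comm]
  exact h2

section Markov

variable {a b : ℝ} {g q₀ : ℝ → ℝ} {t n : ℕ} {p θ' : Fin t → ℝ} {π : Measure ℝ}
  {Ω : Type*} [MeasurableSpace Ω] {μ : Measure Ω} {X : Fin n → Ω → ℝ}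

theorem measurable_weighted_sum (hg : BoundedSupportKernel a b g) (hq₀ : BoundedBaseDensity q₀)
    (hXm : ∀ i, Measurable (X i)) {E : Fin n → Set ℝ} (hE : ∀ i, MeasurableSet (E i))
    (𝒬 : Finset (Finset (Finset (Fin n)))) (w : Finset (Finset (Fin n)) → ENNReal) :
    Measurable fun ω => (∑ P ∈ 𝒬, w P * ∏ B ∈ P, marginalLikE g q₀ (fun i => X i ω) B) *
      ∏ i, ((E i).indicator 1 (X i ω) * (mixtureDensity g p θ' (X i ω))⁻¹) := by
  have hgm := hg.isDensity.measurable
  have hprob := hq₀.isDensity.isProbabilityMeasure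
  have hXvec : Measurable fun ω => fun i => X i ω := measurable_pi_lambda _ hXm
  have hG : ∀ i : Fin n, Measurable (Function.uncurry fun x θ : ℝ => ENNReal.ofReal (g (x - θ))) :=
    fun _ => (hgm.comp (measurable_fst.sub measurable_snd)).ennreal_ofReal
  have hB : ∀ B, Measurable fun ω => marginalLikE g q₀ (fun i => X i ω) B := fun B =>
    (measurable_lintegral_prod_block (ν := baseMeasure q₀) hG B).comp hXvec
  refine Measurable.mul (Finset.measurable_sum _ fun P _ =>
    (Finset.measurable_prod _ fun B _ => hB B).const_mul _) (Finset.measurable_prod _ fun i _ => ?_)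
  exact ((measurable_one.indicator (hE i)).comp (hXm i)).mul
    ((measurable_mixtureDensity hgm p θ').comp (hXm i)).inv

theorem sum_prod_weights (hp1 : ∑ j, p j = 1) : ∑ c : Fin n → Fin t, ∏ i, p (c i) = 1 := by
  have h := Finset.prod_univ_sum (fun _ : Fin n => (Finset.univ : Finset (Fin t)))
    (fun _ j => p j)
  rw [Fintype.piFinset_univ] at h
  rw [← h, hp1, Finset.prod_const_one]

/-- In Markov's inequality the label weight occurs both in the mean and in the threshold and
cancels. What remains is a constant times ∏ p(c_i), so the sum over the t^n label vectors costs
nothing. -/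
theorem sum_measure_small_concentration_le [IsProbabilityMeasure μ]
    (hg : BoundedSupportKernel a b g) (hq₀ : BoundedBaseDensity q₀) (hp : ∀ j, 0 < p j)
    (hp1 : ∑ j, p j = 1) (hX : iIndepFun X μ) (hXm : ∀ i, Measurable (X i))
    (hlaw : ∀ i, μ.map (X i) = mixture g p θ') {C : ℝ} (hC : 0 < C)
    (hblock : ∀ (c : Fin n → Fin t) (B : Finset (Fin n)), B.Nonempty →
      ENNReal.ofReal ((B.card - 1).factorial : ℝ) * blockProb a b g q₀ θ' c B ≤
        ENNReal.ofReal (C * labelWeight c B))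
    {V : ENNReal} (hV0 : V ≠ 0) (hV : V ≠ ⊤) {m ε₂ κ : ℝ} (hε₂ : 0 < ε₂) (hκ : 0 < κ)
    (hR : ∫⁻ α in Set.Ioc 0 m, ENNReal.ofReal (α * Real.exp (C * 8 ^ t * α) * ewensFactor t n α) ∂π
      ≤ ENNReal.ofReal ε₂ * V) :
    ∑ c : Fin n → Fin t, μ {ω |
      ENNReal.ofReal (κ * (labelWeight c Finset.univ / ∏ i, p (c i))) * V ≤
        (∑ P ∈ (setPartitions Finset.univ).filter (fun P => t < P.card),
          priorMass π n (Set.Ioc 0 m) P * ∏ B ∈ P, marginalLikE g q₀ (fun i => X i ω) B) *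
        ∏ i, ((Set.Ioo (θ' (c i) + a) (θ' (c i) + b)).indicator 1 (X i ω) *
          (mixtureDensity g p θ' (X i ω))⁻¹)} ≤
      ENNReal.ofReal ((C * 8 ^ t) ^ (t + 1) * ε₂ / κ) := by
  set K := C * 8 ^ t with hK
  have hK0 : 0 < K := by positivity
  have hprod : ∀ c : Fin n → Fin t, 0 < ∏ i, p (c i) := fun c => Finset.prod_pos fun i _ => hp _
  have hterm : ∀ c : Fin n → Fin t, μ {ω |
      ENNReal.ofReal (κ * (labelWeight c Finset.univ / ∏ i, p (c i))) * V ≤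
        (∑ P ∈ (setPartitions Finset.univ).filter (fun P => t < P.card),
          priorMass π n (Set.Ioc 0 m) P * ∏ B ∈ P, marginalLikE g q₀ (fun i => X i ω) B) *
        ∏ i, ((Set.Ioo (θ' (c i) + a) (θ' (c i) + b)).indicator 1 (X i ω) *
          (mixtureDensity g p θ' (X i ω))⁻¹)} ≤
      ENNReal.ofReal (K ^ (t + 1) * ε₂ / κ * ∏ i, p (c i)) := by
    intro c
    have hW := labelWeight_pos c (Finset.univ : Finset (Fin n))
    have hpc := hprod c
    have h1 := lintegral_sum_marginalLik_le hg hq₀ hX hXm hlaw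
      (E := fun i => Set.Ioo (θ' (c i) + a) (θ' (c i) + b)) (fun i => measurableSet_Ioo)
      (𝒬 := (setPartitions Finset.univ).filter (fun P => t < P.card)) (Finset.filter_subset _ _)
      (priorMass π n (Set.Ioc 0 m))
    have h2 := sum_priorMass_mul_blockProb_le hC (hblock c) (π := π)
      (measurableSet_Ioc (a := (0 : ℝ)) (b := m)) fun α hα => hα.1
    have h3 := h1.trans (h2.trans (mul_le_mul_right hR _))
    rw [← mul_assoc, ← ENNReal.ofReal_mul (by positivity)] at h3
    refine (measure_le_ofReal_div (measurable_weighted_sum hg hq₀ hXm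
      (fun i => measurableSet_Ioo) _ _) hV0 hV (by positivity) h3).trans (le_of_eq ?_)
    congr 1
    field_simp
    rw [hK]
  refine (Finset.sum_le_sum fun c _ => hterm c).trans ?_
  rw [← ENNReal.ofReal_sum_of_nonneg fun c _ => mul_nonneg (by positivity) (hprod c).le,
    ← Finset.mul_sum, sum_prod_weights hp1, mul_one]

/-- Without prescribed supports every block integrates to 1, so the mean is at most the sum of the
prior masses, hence at most π(α > m). -/
theorem measure_large_concentration_le [IsProbabilityMeasure μ]
    (hg : BoundedSupportKernel a b g) (hq₀ : BoundedBaseDensity q₀)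
    (hX : iIndepFun X μ) (hXm : ∀ i, Measurable (X i))
    (hlaw : ∀ i, μ.map (X i) = mixture g p θ')
    {V : ENNReal} (hV0 : V ≠ 0) (hV : V ≠ ⊤) {m ε₂ κ : ℝ} (hm : 0 ≤ m) (hε₂ : 0 < ε₂) (hκ : 0 < κ)
    (hR : ENNReal.ofReal (((n : ℝ) + 1) ^ (2 * t) / n.factorial) * π (Set.Ioi m) ≤
      ENNReal.ofReal ε₂ * V) :
    μ {ω | ENNReal.ofReal (κ * (n.factorial / ((n : ℝ) + 1) ^ (2 * t))) * V ≤
      (∑ P ∈ setPartitions Finset.univ,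
        priorMass π n (Set.Ioi m) P * ∏ B ∈ P, marginalLikE g q₀ (fun i => X i ω) B) *
      ∏ i, (Set.univ.indicator 1 (X i ω) * (mixtureDensity g p θ' (X i ω))⁻¹)} ≤
      ENNReal.ofReal (ε₂ / κ) := by
  have hprob := hq₀.isDensity.isProbabilityMeasure
  have h1 := lintegral_sum_marginalLik_le hg hq₀ hX hXm hlaw
    (E := fun _ => Set.univ) (fun i => MeasurableSet.univ)
    (𝒬 := setPartitions Finset.univ) subset_rfl (priorMass π n (Set.Ioi m))
  simp only [Measure.restrict_univ, hg.isDensity.lintegral_shift, Finset.prod_const_one,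
    lintegral_one, measure_univ, mul_one] at h1
  have h2 := h1.trans (sum_priorMass_le (π := π) measurableSet_Ioi fun α hα => hm.trans_lt hα)
  set r : ℝ := n.factorial / ((n : ℝ) + 1) ^ (2 * t) with hr
  have hr0 : 0 < r := by positivity
  have h3 : π (Set.Ioi m) ≤ ENNReal.ofReal (ε₂ * r) * V := by
    calc π (Set.Ioi m) = ENNReal.ofReal r *
          (ENNReal.ofReal (((n : ℝ) + 1) ^ (2 * t) / n.factorial) * π (Set.Ioi m)) := by
          rw [← mul_assoc, ← ENNReal.ofReal_mul hr0.le, hr, div_mul_div_cancel₀ (by positivity),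
            div_self (by positivity), ENNReal.ofReal_one, one_mul]
      _ ≤ ENNReal.ofReal r * (ENNReal.ofReal ε₂ * V) := by gcongr
      _ = _ := by
          rw [← mul_assoc, ← ENNReal.ofReal_mul hr0.le, mul_comm r]
  refine (measure_le_ofReal_div (measurable_weighted_sum hg hq₀ hXm
    (fun i => MeasurableSet.univ) _ _) hV0 hV (by positivity) (h2.trans h3)).trans (le_of_eq ?_)
  congr 1
  field_simp

end Markov

/-! ### What the assumptions on the prior provide, and the consistency proof. -/

/-- The power-law lower bound makes the density positive just to the right of zero. This is the form
in which the behaviour of the prior at zero enters. -/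
theorem PolynomialNearZero.measure_Ioo_ne_zero {π : Measure ℝ} {f : ℝ → ℝ}
    (hf : HasLebesgueDensity π f) (h : PolynomialNearZero f) {e : ℝ} (he : 0 < e) :
    π (Set.Ioo 0 e) ≠ 0 := by
  obtain ⟨ε, hε, δ, hδ, β, hβ⟩ := h
  have hmin : 0 < min e ε := lt_min he hε
  rw [hf.eq_withDensity, withDensity_apply _ measurableSet_Ioo, ← pos_iff_ne_zero,
    setLIntegral_pos_iff hf.measurable.ennreal_ofReal]
  have h1 : 0 < volume (Set.Ioo 0 (min e ε)) := by
    rw [Real.volume_Ioo, ENNReal.ofReal_pos]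
    linarith
  refine h1.trans_le (measure_mono fun α hα => ⟨?_, hα.1, hα.2.trans_le (min_le_left _ _)⟩)
  rw [Function.mem_support, ← pos_iff_ne_zero, ENNReal.ofReal_pos]
  refine lt_of_lt_of_le ?_ (hβ α ⟨hα.1, hα.2.trans_le (min_le_right _ _)⟩).1
  have := Real.rpow_pos_of_pos hα.1 β
  positivity

theorem SubfactorialMoments.lintegral_pow_ne_top {π : Measure ℝ} {ρ : ℝ}
    (h : SubfactorialMoments π ρ) {k : ℕ} (hk : 1 ≤ k) :
    ∫⁻ α, ENNReal.ofReal (α ^ k) ∂π ≠ ⊤ := by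
  obtain ⟨D, -, ν, -, h⟩ := h
  exact ((h k hk).trans ENNReal.ofReal_lt_top).ne

/-- Outside four families of events the posterior is close to 1: too few observations in some
component or at its right end, an observation too close to a left endpoint, an excessive weighted
likelihood from small α, and one from large α. Each family receives the probability budget η/4. -/
theorem tendsto_posteriorClusters {a b : ℝ} {g q₀ : ℝ → ℝ} (hab : a < b)
    (hg : BoundedSupportKernel a b g) (hq₀ : BoundedBaseDensity q₀) {π : Measure ℝ}
    [IsProbabilityMeasure π] (hπ : π (Set.Iic 0) = 0)
    (hpos : ∀ e > (0 : ℝ), π (Set.Ioo 0 e) ≠ 0)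
    (hmom : ∀ k : ℕ, 1 ≤ k → ∫⁻ α, ENNReal.ofReal (α ^ k) ∂π ≠ ⊤) {t : ℕ} {p θ' : Fin t → ℝ}
    (hP : AdmissibleTruth a b q₀ p θ') {Ω : Type*} [MeasurableSpace Ω] {μ : Measure Ω}
    [IsProbabilityMeasure μ] {X : ℕ → Ω → ℝ} (hX : IsIIDSample μ X (mixture g p θ')) :
    TendstoInMeasure μ (fun n ω => posteriorClusters g q₀ π (fun i : Fin n => X i ω) t) atTop
      (fun _ => 1) := by
  classical
  have hp := hP.weight_pos
  have hp1 := hP.weight_sum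
  have ht : 1 ≤ t := by
    rcases t.eq_zero_or_pos with rfl | h
    · simp at hp1
    · exact h
  obtain ⟨M, hM0, hM⟩ := hg.exists_bound hab
  obtain ⟨L, hL0, hL⟩ := hg.mul_exp_le
  obtain ⟨γ, hγ, hsep⟩ : ∃ γ : ℝ, 0 < γ ∧ ∀ j k, j ≠ k → b - a + γ ≤ |θ' j - θ' k| := by
    have h : ∀ᶠ γ in 𝓝[>] (0 : ℝ), 0 < γ ∧ ∀ j k, j ≠ k → b - a + γ ≤ |θ' j - θ' k| := by
      refine (eventually_mem_nhdsWithin (s := Set.Ioi (0 : ℝ))).and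
        (eventually_all.2 fun j => eventually_all.2 fun k => ?_)
      by_cases hjk : j = k
      · simp [hjk]
      · have h0 : 0 < |θ' j - θ' k| - (b - a) := sub_pos.2 (hP.separated j k hjk)
        filter_upwards [mem_nhdsWithin_of_mem_nhds (Iic_mem_nhds h0)] with γ hγ _
        linarith [Set.mem_Iic.1 hγ]
    exact h.exists
  obtain ⟨C, hC, hblock⟩ := exists_block_bound hg hq₀ hγ hsep
  obtain ⟨r, l, hr0, hl, hr⟩ : ∃ r l : ℝ, 0 < r ∧ 0 < l ∧
      ∀ j y, |y - θ' j| < r → l ≤ q₀ y := by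
    choose lj hlj hj using hP.base_pos_near
    have h1 : ∀ᶠ l in 𝓝[>] (0 : ℝ), 0 < l ∧ ∀ j, l ≤ lj j :=
      (eventually_mem_nhdsWithin (s := Set.Ioi (0 : ℝ))).and (eventually_all.2 fun j =>
        mem_nhdsWithin_of_mem_nhds (Iic_mem_nhds (hlj j)))
    obtain ⟨l, hl, hlle⟩ := h1.exists
    choose rj hrj hq using fun j => Metric.eventually_nhds_iff.1 (hj j)
    have h2 : ∀ᶠ r in 𝓝[>] (0 : ℝ), 0 < r ∧ ∀ j, r ≤ rj j :=
      (eventually_mem_nhdsWithin (s := Set.Ioi (0 : ℝ))).and (eventually_all.2 fun j =>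
        mem_nhdsWithin_of_mem_nhds (Iic_mem_nhds (hrj j)))
    obtain ⟨r, hr, hrle⟩ := h2.exists
    refine ⟨r, l, hr, hl, fun j y hy => (hlle j).trans (hq j ?_)⟩
    rw [Real.dist_eq]
    exact hy.trans_le (hrle j)
  set S : Fin t → Set ℝ := fun j => Set.Ioo (θ' j + a) (θ' j + b) with hS
  -- Observations in the right-end strips of width d of two different components are more than b - a
  -- + γ - d ≥ b - a apart.
  set d := min γ (b - a) with hd
  have hd0 : 0 < d := lt_min hγ (sub_pos.2 hab)
  set T : Fin t → Set ℝ := fun j => Set.Ioo (θ' j + b - d) (θ' j + b) with hT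
  have hfin : IsProbabilityMeasure (mixture g p θ') := by
    rw [← hX.law 0]
    exact Measure.isProbabilityMeasure_map (hX.measurable 0).aemeasurable
  have hSpos : ∀ j, 0 < (mixture g p θ').real (S j) := fun j =>
    ENNReal.toReal_pos (mixture_Ioo_pos hg hp j (by linarith) le_rfl le_rfl).ne'
      (measure_ne_top _ _)
  have hTpos : ∀ j, 0 < (mixture g p θ').real (T j) := fun j =>
    ENNReal.toReal_pos (mixture_Ioo_pos hg hp j (by linarith)
      (by linarith [min_le_right γ (b - a)]) le_rfl).ne' (measure_ne_top _ _)
  obtain ⟨δ, hδ, hδle⟩ : ∃ δ : ℝ, 0 < δ ∧ ∀ j, δ ≤ (mixture g p θ').real (S j) / 2 := by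
    have h : ∀ᶠ δ in 𝓝[>] (0 : ℝ), 0 < δ ∧ ∀ j, δ ≤ (mixture g p θ').real (S j) / 2 :=
      (eventually_mem_nhdsWithin (s := Set.Ioi (0 : ℝ))).and (eventually_all.2 fun j =>
        mem_nhdsWithin_of_mem_nhds (Iic_mem_nhds (half_pos (hSpos j))))
    exact h.exists
  rw [tendstoInMeasure_iff_norm]
  intro ε hε
  rw [ENNReal.tendsto_nhds_zero]
  intro η' hη'
  obtain ⟨η, hη, hηη'⟩ : ∃ η : ℝ, 0 < η ∧ ENNReal.ofReal η ≤ η' := by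
    obtain ⟨η, h0, h1⟩ := ENNReal.lt_iff_exists_nnreal_btwn.1 hη'
    exact ⟨η, by exact_mod_cast h0, by simpa using h1.le⟩
  -- The expected number of observations within e/n of one of the t left endpoints is at most t M e
  -- ≤ η/4.
  set e := min r (η / (4 * (t * M))) with he
  have ht0 : (0 : ℝ) < t := by exact_mod_cast ht
  have he0 : 0 < e := lt_min hr0 (by positivity)
  have heη : t * (M * e) ≤ η / 4 := by
    have h1 : e ≤ η / (4 * (t * M)) := min_le_right _ _
    rw [le_div_iff₀ (by positivity)] at h1
    linarith
  set κ := (Real.exp (-(L * e)) * l * e * δ) ^ t with hκ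
  have hκ0 : 0 < κ := by positivity
  set K := C * 8 ^ t with hK
  have hK0 : 0 < K := by positivity
  -- Chosen so that both Markov bounds, with numerators K^{t+1} ε₂ and ε₂, are at most η/4.
  set ε₂ := η / 4 * (ε / 2 * κ) / (K ^ (t + 1) + 1) with hε₂
  have hε₂0 : 0 < ε₂ := by positivity
  have hε₂1 : K ^ (t + 1) * ε₂ / (ε / 2 * κ) ≤ η / 4 := by
    rw [div_le_iff₀ (by positivity), hε₂, mul_div_assoc', div_le_iff₀ (by positivity)]
    nlinarith [pow_pos hK0 (t + 1), mul_pos (mul_pos (half_pos hε) hκ0) hη]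
  have hε₂2 : ε₂ / (ε / 2 * κ) ≤ η / 4 := by
    rw [div_le_iff₀ (by positivity), hε₂]
    exact div_le_self (by positivity) (by linarith [pow_pos hK0 (t + 1)])
  set D : ℕ → Fin t → Set Ω := fun n j => {ω | (((Finset.univ : Finset (Fin n)).filter
      fun i : Fin n => X i ω ∈ S j).card : ℝ) < (mixture g p θ').real (S j) / 2 * n} ∪
    {ω | (((Finset.univ : Finset (Fin n)).filter
      fun i : Fin n => X i ω ∈ T j).card : ℝ) < (mixture g p θ').real (T j) / 2 * n} with hDdef
  have hD : ∀ᶠ n in atTop, ∑ j, μ (D n j) ≤ ENNReal.ofReal (η / 4) := by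
    have h1 : Tendsto (fun n => ∑ j, μ (D n j)) atTop (𝓝 (∑ _j : Fin t, 0)) := by
      refine tendsto_finsetSum _ fun j _ => ?_
      have h2 := (hX.tendsto_measure_card_lt measurableSet_Ioo (hSpos j)).add
        (hX.tendsto_measure_card_lt measurableSet_Ioo (hTpos j))
      rw [add_zero] at h2
      refine tendsto_of_tendsto_of_tendsto_of_le_of_le tendsto_const_nhds h2
        (fun _ => zero_le) fun n => ?_
      refine (le_of_eq ?_).trans (measure_union_le _ _)
      simp only [hDdef]
      congr!
    rw [Finset.sum_const_zero] at h1
    exact h1.eventually_le_const (ENNReal.ofReal_pos.2 (by positivity))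
  set F : ℕ → Fin t → Set Ω := fun n j =>
    {ω | ∃ i : Fin n, X i ω ∈ Set.Ioc (θ' j + a) (θ' j + a + e / n)} with hFdef
  have hF : ∀ n : ℕ, 1 ≤ n → ∑ j, μ (F n j) ≤ ENNReal.ofReal (η / 4) := by
    intro n hn
    have hn0 : (0 : ℝ) < n := by exact_mod_cast hn
    calc ∑ j, μ (F n j) ≤ ∑ _j : Fin t, ENNReal.ofReal (M * e) := by
          refine Finset.sum_le_sum fun j _ =>
            (hX.measure_exists_mem_le measurableSet_Ioc n).trans ?_
          refine (mul_le_mul_right (mixture_Ioc_le hg hM hp hp1 _ _) _).trans (le_of_eq ?_)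
          rw [← ENNReal.ofReal_natCast, ← ENNReal.ofReal_mul hn0.le]
          congr 1
          field_simp
          ring
      _ = ENNReal.ofReal (t * (M * e)) := by
          rw [Finset.sum_const, Finset.card_univ, Fintype.card_fin, nsmul_eq_mul,
            ENNReal.ofReal_mul ht0.le, ENNReal.ofReal_natCast]
      _ ≤ _ := ENNReal.ofReal_le_ofReal heη
  filter_upwards [eventually_ge_atTop t, eventually_ge_atTop 1, hD,
    eventually_lintegral_mul_exp_le hpos ht hK0.le hε₂0,
    eventually_tail_le hpos ht hmom hε₂0] with n htn hn1 hDn hR1 hR2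
  have hn0 : (0 : ℝ) < n := by exact_mod_cast hn1
  have hV1 : priorFactor π t n ≠ ⊤ :=
    ((priorFactor_le_one hπ ht htn).trans_lt ENNReal.one_lt_top).ne
  have hV0 : priorFactor π t n ≠ 0 := by
    obtain ⟨κ', hκ', h⟩ := exists_le_priorFactor hpos ht one_pos le_rfl
    refine (lt_of_lt_of_le ?_ (h n hn1)).ne'
    rw [ENNReal.ofReal_pos]
    have := Real.exp_pos (-(1 * Real.log n))
    positivity
  have hXind : iIndepFun (fun i : Fin n => X i) μ := hX.indep.precomp Fin.val_injective
  have hXm : ∀ i : Fin n, Measurable (X i) := fun i => hX.measurable i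
  have hlaw : ∀ i : Fin n, μ.map (X i) = mixture g p θ' := fun i => hX.law i
  have hsmall := sum_measure_small_concentration_le (X := fun i : Fin n => X i) hg hq₀ hp hp1
    hXind hXm hlaw hC (fun c B hB => hblock c B hB) hV0 hV1 hε₂0
    (by positivity : 0 < ε / 2 * κ) hR1
  have hlarge := measure_large_concentration_le (X := fun i : Fin n => X i) (p := p) (θ' := θ')
    hg hq₀ hXind hXm hlaw hV0 hV1 (Nat.cast_nonneg _) hε₂0 (by positivity : 0 < ε / 2 * κ) hR2
  set A : (Fin n → Fin t) → Set Ω := fun c => {ω |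
      ENNReal.ofReal (ε / 2 * κ * (labelWeight c Finset.univ / ∏ i, p (c i))) *
        priorFactor π t n ≤
        (∑ P ∈ (setPartitions Finset.univ).filter (fun P => t < P.card),
          priorMass π n (Set.Ioc 0 (n.sqrt : ℝ)) P *
            ∏ B ∈ P, marginalLikE g q₀ (fun i : Fin n => X i ω) B) *
        ∏ i : Fin n, ((Set.Ioo (θ' (c i) + a) (θ' (c i) + b)).indicator 1 (X i ω) *
          (mixtureDensity g p θ' (X i ω))⁻¹)} with hA
  set Z : Set Ω := {ω | ENNReal.ofReal (ε / 2 * κ * (n.factorial / ((n : ℝ) + 1) ^ (2 * t))) *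
      priorFactor π t n ≤
      (∑ P ∈ setPartitions Finset.univ, priorMass π n (Set.Ioi (n.sqrt : ℝ)) P *
        ∏ B ∈ P, marginalLikE g q₀ (fun i : Fin n => X i ω) B) *
      ∏ i : Fin n, (Set.univ.indicator 1 (X i ω) * (mixtureDensity g p θ' (X i ω))⁻¹)} with hZ
  -- The inclusion is pathwise: the labels c are those realised at ω, and the union over all c
  -- covers whichever vector occurs.
  have hincl : ∀ᵐ ω ∂μ, ω ∈ {ω | ε ≤ ‖posteriorClusters g q₀ π (fun i : Fin n => X i ω) t - 1‖} →
      ω ∈ (⋃ j, D n j) ∪ (⋃ j, F n j) ∪ ((⋃ c, A c) ∪ Z) := by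
    filter_upwards [hX.ae_forall_mem hg] with ω hω (hpost : ε ≤ ‖_‖)
    by_contra hcon
    simp only [Set.mem_union, Set.mem_iUnion, not_or, not_exists] at hcon
    obtain ⟨⟨hnD, hnF⟩, hnA, hnZ⟩ := hcon
    rw [Real.norm_eq_abs] at hpost
    choose c hc using hω
    have hx : ∀ i : Fin n, X i ω ∈ Set.Ioo (θ' (c i) + a + e / n) (θ' (c i) + b) := by
      intro i
      refine ⟨?_, (hc i).2⟩
      by_contra h
      exact hnF (c i) ⟨i, (hc i).1, not_lt.1 h⟩
    have hlabel : ∀ (i : Fin n) (j : Fin t), X i ω ∈ S j → c i = j := by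
      intro i j hij
      by_contra hne
      rcases lt_abs.1 (hP.separated (c i) j hne) with h | h
      · linarith [(hc i).1, (hc i).2, hij.1, hij.2]
      · linarith [(hc i).1, (hc i).2, hij.1, hij.2]
    have hcount : ∀ j, δ * n ≤ labelCount (fun i : Fin n => c i) Finset.univ j := by
      intro j
      have h1 : ω ∉ _ := fun h => hnD j (Or.inl h)
      rw [Set.mem_ofPred_eq, not_lt] at h1
      calc δ * n ≤ (mixture g p θ').real (S j) / 2 * n := by
            gcongr
            exact hδle j
        _ ≤ _ := h1
        _ ≤ _ := by
            refine Nat.cast_le.2 (Finset.card_le_card fun i hi => ?_)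
            simp only [Finset.mem_filter, Finset.mem_univ, true_and] at hi ⊢
            exact hlabel i j hi
    have hright : ∀ j, ∃ i : Fin n, X i ω ∈ T j := by
      intro j
      have h1 : ω ∉ _ := fun h => hnD j (Or.inr h)
      rw [Set.mem_ofPred_eq, not_lt] at h1
      have h2 : (0 : ℝ) < (mixture g p θ').real (T j) / 2 * n := by
        have := hTpos j
        positivity
      have h3 := h2.trans_le h1
      obtain ⟨i, hi⟩ := Finset.card_pos.1 (Nat.cast_pos.1 h3)
      exact ⟨i, (Finset.mem_filter.1 hi).2⟩
    choose y hy using hright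
    have hlow : ∀ s < t, jointDensity g q₀ π (fun i : Fin n => X i ω) s = 0 := by
      intro s hs
      refine jointDensity_eq_zero_of_separated hg _ y (fun j k hjk => ?_) hs
      have hdγ : d ≤ γ := min_le_left _ _
      rw [lt_abs]
      rcases le_abs.1 (hsep j k hjk) with h | h
      · left
        linarith [(hy j).1, (hy j).2, (hy k).1, (hy k).2]
      · right
        linarith [(hy j).1, (hy j).2, (hy k).1, (hy k).2]
    have hJ := le_jointDensity hg hab hq₀ hπ hL0 hL hl hr he0 (min_le_left _ _) hδ hn1
      (fun i : Fin n => X i ω) (fun i => c i) hx hcount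
    rcases le_or_le_of_le_abs_posterior_sub_one (p := p) hg hab hq₀ hπ hp hp1 hP.separated htn hV0
      (x := fun i : Fin n => X i ω) (c := fun i => c i) (fun i => hc i) hκ0 hJ hlow hε hpost
      (n.sqrt : ℝ) with h | h
    · exact hnA _ h
    · exact hnZ h
  calc μ {ω | ε ≤ ‖posteriorClusters g q₀ π (fun i : Fin n => X i ω) t - 1‖}
      ≤ μ ((⋃ j, D n j) ∪ (⋃ j, F n j) ∪ ((⋃ c, A c) ∪ Z)) := measure_mono_ae hincl
    _ ≤ (∑ j, μ (D n j) + ∑ j, μ (F n j)) + (∑ c, μ (A c) + μ Z) :=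
        (measure_union_le _ _).trans (add_le_add
          ((measure_union_le _ _).trans (add_le_add (measure_iUnion_fintype_le _ _)
            (measure_iUnion_fintype_le _ _)))
          ((measure_union_le _ _).trans (add_le_add (measure_iUnion_fintype_le _ _) le_rfl)))
    _ ≤ (ENNReal.ofReal (η / 4) + ENNReal.ofReal (η / 4)) +
        (ENNReal.ofReal (η / 4) + ENNReal.ofReal (η / 4)) :=
        add_le_add (add_le_add hDn (hF n hn1)) (add_le_add
          (hsmall.trans (ENNReal.ofReal_le_ofReal hε₂1))
          (hlarge.trans (ENNReal.ofReal_le_ofReal hε₂2)))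
    _ = ENNReal.ofReal η := by
        rw [← ENNReal.ofReal_add (by positivity) (by positivity),
          ← ENNReal.ofReal_add (by positivity) (by positivity)]
        congr 1
        ring
    _ ≤ η' := hηη'

end DPMixture

/-! ### The main theorem. -/

theorem mainTheorem1 (a b : ℝ) (hab : a < b) (g q₀ : ℝ → ℝ)
    (hg : DPMixture.BoundedSupportKernel a b g) (hq₀ : DPMixture.BoundedBaseDensity q₀) :
    (∃ ρ₀ > (0 : ℝ), ∀ ρ ≥ ρ₀, ∀ (π : Measure ℝ) [IsProbabilityMeasure π] (f : ℝ → ℝ),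
      π (Set.Iic 0) = 0 →
      DPMixture.HasLebesgueDensity π f →
      DPMixture.PolynomialNearZero f →
      DPMixture.SubfactorialMoments π ρ →
      ∀ (t : ℕ) (p θ : Fin t → ℝ), DPMixture.AdmissibleTruth a b q₀ p θ →
      ∀ (Ω : Type*) [MeasurableSpace Ω] (μ : Measure Ω) [IsProbabilityMeasure μ]
        (X : ℕ → Ω → ℝ), DPMixture.IsIIDSample μ X (DPMixture.mixture g p θ) →
        TendstoInMeasure μ
          (fun n ω => DPMixture.posteriorClusters g q₀ π (fun i : Fin n => X i ω) t)
          atTop (fun _ => 1)) ∧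
    (∀ αstar > (0 : ℝ),
      ∀ (t : ℕ) (p θ : Fin t → ℝ), DPMixture.AdmissibleTruth a b q₀ p θ →
      ∃ c < (1 : ℝ),
        ∀ (Ω : Type*) [MeasurableSpace Ω] (μ : Measure Ω) [IsProbabilityMeasure μ]
          (X : ℕ → Ω → ℝ), DPMixture.IsIIDSample μ X (DPMixture.mixture g p θ) →
          Tendsto (fun n : ℕ => μ {ω | c < DPMixture.posteriorClusters g q₀
            (Measure.dirac αstar) (fun i : Fin n => X i ω) t}) atTop (𝓝 0) ∧
          ∀ᵐ ω ∂μ, limsup (fun n : ℕ => DPMixture.posteriorClusters g q₀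
            (Measure.dirac αstar) (fun i : Fin n => X i ω) t) atTop ≤ c) := by
  refine ⟨?_, fun αstar hα t p θ hP =>
    DPMixture.fixed_concentration_inconsistent hab hg hq₀ hα hP⟩
  -- Any positive ρ₀ would do, since the subfactorial bound is used only through the finiteness of
  -- the moments.
  exact ⟨1, one_pos, fun ρ _ π _ f hπ hf hpoly hsub t p θ hP Ω _ μ _ X hX =>
    DPMixture.tendsto_posteriorClusters hab hg hq₀ hπ
      (fun e he => DPMixture.PolynomialNearZero.measure_Ioo_ne_zero hf hpoly he)
      (fun k hk => hsub.lintegral_pow_ne_top hk) hP hX⟩
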